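/- **Setting.** A *Markov automaton* (MA) $\mathcal M$ has a finite state set $S$ with initial state $s_I$, a finite action set $\mathrm{Act}\ni\bot$, probabilistic transitions $s\xrightarrow{\alpha}\mu$ ($\alpha\in\mathrm{Act}$, $\mu\in\mathrm{Dist}(S)$; at most one per pair $(s,\alpha)$), Markovian transitions $s\xrightarrow{r}\mu$ with rate $r>0$ (at most one per state), and finitely many reward functions $\rho_j\colon S\sqcup(S\times\mathrm{Act})\to\mathbb R_{\ge0}$. Every state has an outgoing transition, and $S=PS\sqcup MS$, where states in $PS$ have only probabilistic and states in $MS$ only Markovian transitions. $E(s)$ is the rate of $s\in MS$ and $\lambda=\max_{s\in MS}E(s)$. $P(s,\alpha,s')$ is the probability of moving to $s'$ by the $\alpha$-transition of $s$, where the Markovian transition is labelled $\bot$; $\alpha$ is enabled in $s$ if $P(s,\alpha,s')>0$ for some $s'$. A *scheduler* of $\mathcal M$ is a measurable map that assigns to every finite path (including its sojourn times) a distribution over the actions enabled in its last state. It induces a probability measure $\Pr^{\mathcal M}_\sigma$ on infinite paths $s_0,(t_0,\alpha_0),s_1,(t_1,\alpha_1),\dots$ with $s_0=s_I$: in $s_i\in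 PS$ one has $t_i=0$ and $\alpha_i$ is chosen by $\sigma$; in $s_i\in MS$ one has $\alpha_i=\bot$ and $t_i$ is exponential with rate $E(s_i)$, independent of $s_{i+1}$ and of the past; $s_{i+1}$ has law $P(s_i,\alpha_i,\cdot)$. We assume that $\mathcal M$ is *non-Zeno*: $\sum_i t_i=\infty$ holds $\Pr^{\mathcal M}_\sigma$-almost surely for every scheduler $\sigma$. For $\delta>0$ the *digitization* $\mathcal M_\delta$ is the Markov decision process with the same states, initial state and actions, with transition probabilities $$P_\delta(s,\bot,s')=P(s,\bot,s')(1-e^{-E(s)\delta})+[s=s']\,e^{-E(s)\delta}\quad(s\in MS),\qquad P_\delta(s,\alpha,s')=P(s,\alpha,s')\ \text{otherwise,}$$ and action rewards $\rho_{\delta,j}(s,\alpha)=\rho_j(s,\alpha)$ for $s\in PS$, $\rho_{\delta,j}(s,\bot)=\big(\rho_j(s,\bot)+\rho_j(s)/E(s)\big)(1-e^{-E(s)\delta})$ for $s\in MS$, and $0$ otherwise. Its schedulers are history-dependent and randomized (histories are finite sequences of states and actions). **Objectives.** An *objective* is one of the following. * A reachability objective $(I,G)$ with $G\subseteq S$ and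 $I=[a,b]$, $0\le a<b$, or $I=[a,\infty)$, $0\le a$ (untimed if $I=[0,\infty)$), where the finite end points of $I$ are integer multiples of $\delta$. Its value on $\mathcal M$ under $\sigma$ is the $\Pr^{\mathcal M}_\sigma$-probability that for some $n$ one has $s_n\in G$ and $I\cap[\tau_n,\tau_n+t_n]\ne\emptyset$, with $\tau_n=\sum_{i<n}t_i$. Its value on $\mathcal M_\delta$ under $\sigma$ is the probability that for some $n$ one has $s_n\in G$ and $|\{i<n : s_i\in MS\}|\in J$, where $J=\{k\in\mathbb N : k\delta\in I\}$ if $a=0$ and $J=\{k\in\mathbb N : k\delta\in I,\ k\delta>a\}$ if $a>0$. * An expected-reward objective $(j,G)$ with $G\subseteq S$. Its value in $[0,\infty]$, on $\mathcal M$ or on $\mathcal M_\delta$, is the expected total reward collected before the first visit of $G$ (over the whole path if $G$ is never visited). On $\mathcal M$ step $i$ contributes $\rho_j(s_i)t_i+\rho_j(s_i,\alpha_i)$, on $\mathcal M_\delta$ it contributes $\rho_{\delta,j}(s_i,\alpha_i)$. Let $\mathbb O=(\mathbb O_1,\dots,\mathbb O_d)$ be any tuple of such objectives with threshold relations $\rhd_1,\dots,\rhd_d\in\{<,\le,>,\ge\}$.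 A point $p\in\mathbb R^d$ is *achievable* on $\mathcal M$ (on $\mathcal M_\delta$) if a single scheduler $\sigma$ of $\mathcal M$ (of $\mathcal M_\delta$) satisfies (value of $\mathbb O_i$ under $\sigma$) $\rhd_i\,p_i$ for all $i$. **Error boxes.** Put $e(c)=1-(1+\lambda\delta)^{c/\delta}e^{-\lambda c}$. For $\mathbb O_i=(I,G)$ with $a=\inf I$ let $\varepsilon^{\downarrow}_i=e(a)$ if $a>0$ and $\varepsilon^{\downarrow}_i=0$ if $a=0$; and let $\varepsilon^{\uparrow}_i=u+v$, where $u=e(b)$ if $I=[a,b]$ and $u=0$ if $I=[a,\infty)$, and $v=1-e^{-\lambda\delta}$ if $a>0$ and $v=0$ if $a=0$. For expected-reward objectives $\varepsilon^{\downarrow}_i=\varepsilon^{\uparrow}_i=0$. Let $B(p)=\prod_{i=1}^d[p_i-\varepsilon^{\downarrow}_i,\;p_i+\varepsilon^{\uparrow}_i]$. **Theorem.** For every non-Zeno MA $\mathcal M$, every $\delta>0$, and all objectives $\mathbb O$ and threshold relations $\rhd$ as above, $\mathcal U\subseteq\{p\in\mathbb R^d : p\text{ is achievable on }\mathcal M\}\subseteq\mathcal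 O$, where $$\mathcal U=\{p'\in\mathbb R^d : \forall p\in\mathbb R^d,\ p'\in B(p)\text{ implies that }p\text{ is achievable on }\mathcal M_\delta\},$$ $$\mathcal O=\{p'\in\mathbb R^d : \exists p\in\mathbb R^d,\ p'\in B(p)\text{ and }p\text{ is achievable on }\mathcal M_\delta\}.$$ -/

import Mathlib

open MeasureTheory ProbabilityTheory
open scoped NNReal ENNReal

/-- Markov automata with finite state space `S`, finite set of actions `A` and reward functions
indexed by `Fin ℓ`.  The automata are action-deterministic (at most one probabilistic transition
per state and action), have at most one Markovian transition per state, satisfy maximal progress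
(no state has both kinds of transitions), and have no terminal states. -/
structure MarkovAutomaton (S A : Type*) (ℓ : ℕ) where
  /-- initial state -/
  init : S
  /-- the distinguished action `⊥` that labels Markovian transitions in paths -/
  tau : A
  /-- `probTrans s α = some μ` iff there is a probabilistic transition `s —α→ μ` -/
  probTrans : S → A → Option (PMF S)
  /-- `markovTrans s = some (r, μ)` iff there is a Markovian transition `s —r→ μ` with rate `r` -/
  markovTrans : S → Option ({r : ℝ // 0 < r} × PMF S)
  maximal_progress : ∀ s, (∃ α, (probTrans s α).isSome) → markovTrans s = none
  no_terminal : ∀ s, (∃ α, (probTrans s α).isSome) ∨ (markovTrans s).isSome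
  /-- state rewards (gained per time unit) -/
  stateReward : Fin ℓ → S → ℝ≥0
  /-- action rewards (gained per transition) -/
  actionReward : Fin ℓ → S → A → ℝ≥0

/-- Markov decision processes with action rewards indexed by `Fin ℓ` and without terminal states. -/
structure MDP (S A : Type*) [Fintype S] (ℓ : ℕ) where
  init : S
  tau : A
  prob : S → A → S → ℝ
  prob_nonneg : ∀ s α s', 0 ≤ prob s α s'
  prob_sum : ∀ s α, ∑ s', prob s α s' = 0 ∨ ∑ s', prob s α s' = 1
  no_terminal : ∀ s, ∃ α, ∑ s', prob s α s' = 1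
  reward : Fin ℓ → S → A → ℝ≥0

/-- Time intervals `[a, b]` with `0 ≤ a < b`, or `[a, ∞)` with `0 ≤ a`. -/
inductive TimeInterval where
  | bounded (a b : ℝ≥0) (hab : a < b)
  | unbounded (a : ℝ≥0)

/-- Objectives: reachability of a goal set within a time interval (untimed if the interval is
`[0, ∞)`), or expected reward, for the `j`-th reward function, until a goal set is reached. -/
inductive Objective (S : Type*) (ℓ : ℕ) where
  | reach (I : TimeInterval) (G : Set S)
  | expReward (j : Fin ℓ) (G : Set S)

/-- The four threshold relations `<, ≤, >, ≥`. -/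
inductive ThresholdRel where
  | lt | le | gt | ge

def ThresholdRel.Holds : ThresholdRel → EReal → EReal → Prop
  | .lt, x, y => x < y
  | .le, x, y => x ≤ y
  | .gt, x, y => x > y
  | .ge, x, y => x ≥ y

namespace TimeInterval

def toSet : TimeInterval → Set ℝ≥0
  | bounded a b _ => Set.Icc a b
  | unbounded a => Set.Ici a

def lower : TimeInterval → ℝ≥0
  | bounded a _ _ => a
  | unbounded a => a

/-- The finite endpoints of the interval are integer multiples of the digitization constant. -/
def WellFormed (δ : ℝ≥0) : TimeInterval → Prop
  | bounded a b _ => (∃ k : ℕ, a = k * δ) ∧ (∃ k : ℕ, b = k * δ)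
  | unbounded a => ∃ k : ℕ, a = k * δ

/-- The digitization step bounds of an interval: for a well-formed interval with lower end point
`a = j δ` and upper end point `b = k δ` this is `{0, …, k}` (or `ℕ`) if `a = 0`,
and `{j + 1, …, k}` (or `{j + 1, j + 2, …}`) if `a > 0`. -/
def stepBounds (δ : ℝ≥0) (I : TimeInterval) : Set ℕ :=
  {k | (k : ℝ≥0) * δ ∈ I.toSet ∧ (0 < I.lower → I.lower < (k : ℝ≥0) * δ)}

end TimeInterval

def Objective.WellFormed {S : Type*} {ℓ : ℕ} (δ : ℝ≥0) : Objective S ℓ → Prop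
  | .reach I _ => I.WellFormed δ
  | .expReward _ _ => True

noncomputable section

/-! ### Markov decision processes -/

namespace MDP

variable {S A : Type*} [Fintype S] {ℓ : ℕ}

/-- The set `Act(s)` of enabled actions. -/
def enabled (D : MDP S A ℓ) (s : S) : Set A := {α | ∃ s', 0 < D.prob s α s'}

/-- Finite paths `s₀ —α₀→ s₁ … —αₙ₋₁→ sₙ` of length `n`: the entry with index `i + 1` is
`(αᵢ, sᵢ₊₁)`, and the entry with index `0` is `(⊥, s₀)`, whose first component has no meaning. -/
abbrev Hist (S A : Type*) (n : ℕ) := Finset.Iic n → A × S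

/-- The last state of a finite path. -/
def Hist.last {S A : Type*} {n : ℕ} (h : Hist S A n) : S := (h ⟨n, Finset.mem_Iic.2 le_rfl⟩).2

/-- Schedulers of an MDP (history-dependent and randomized). -/
structure Scheduler (D : MDP S A ℓ) where
  choice : (n : ℕ) → Hist S A n → PMF A
  choice_enabled : ∀ n h α, choice n h α ≠ 0 → α ∈ D.enabled (Hist.last h)

theorem sum_prob_of_enabled (D : MDP S A ℓ) {s : S} {α : A} (h : α ∈ D.enabled s) :
    ∑ s', D.prob s α s' = 1 := by
  rcases D.prob_sum s α with h0 | h1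
  · obtain ⟨s', hs'⟩ := h
    have := (Finset.sum_eq_zero_iff_of_nonneg (fun i _ => D.prob_nonneg s α i)).1 h0 s'
      (Finset.mem_univ _)
    exact absurd this hs'.ne'
  · exact h1

set_option linter.unusedSectionVars false

variable [Fintype A] [MeasurableSpace S] [DiscreteMeasurableSpace S]
  [MeasurableSpace A] [DiscreteMeasurableSpace A]

/-- Distribution of the next step (action and successor state), given the history. -/
def Scheduler.step {D : MDP S A ℓ} (σ : D.Scheduler) (n : ℕ) (h : Hist S A n) : Measure (A × S) :=
  ∑ α, ∑ s', (σ.choice n h α * ENNReal.ofReal (D.prob (Hist.last h) α s')) • Measure.dirac (α, s')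

theorem Scheduler.isProbabilityMeasure_step {D : MDP S A ℓ} (σ : D.Scheduler) (n : ℕ)
    (h : Hist S A n) : IsProbabilityMeasure (σ.step n h) := by
  constructor
  have key : ∀ α, ∑ s', σ.choice n h α * ENNReal.ofReal (D.prob (Hist.last h) α s')
      = σ.choice n h α := by
    intro α
    rw [← Finset.mul_sum]
    by_cases hα : σ.choice n h α = 0
    · simp [hα]
    · rw [← ENNReal.ofReal_sum_of_nonneg (fun i _ => D.prob_nonneg _ α i),
        D.sum_prob_of_enabled (σ.choice_enabled n h α hα)]
      simp
  simp only [Scheduler.step, Measure.coe_finsetSum, Finset.sum_apply, Measure.smul_apply,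
    measure_univ, smul_eq_mul, mul_one, key]
  rw [← tsum_fintype (L := .unconditional A)]
  exact (σ.choice n h).tsum_coe

def Scheduler.stepKernel {D : MDP S A ℓ} (σ : D.Scheduler) (n : ℕ) :
    Kernel (Hist S A n) (A × S) where
  toFun := σ.step n
  measurable' := measurable_of_countable _

instance {D : MDP S A ℓ} (σ : D.Scheduler) (n : ℕ) : IsMarkovKernel (σ.stepKernel n) :=
  ⟨σ.isProbabilityMeasure_step n⟩

/-- The probability measure on infinite paths that is induced by a scheduler.  The entry with index
`i + 1` of an infinite path is `(αᵢ, sᵢ₊₁)` and the entry with index `0` is `(⊥, s₀)`,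
with `s₀` the initial state. -/
def Scheduler.pathMeasure {D : MDP S A ℓ} (σ : D.Scheduler) : Measure (ℕ → A × S) :=
  Kernel.traj (X := fun _ => A × S) σ.stepKernel 0 (fun _ => (D.tau, D.init))

/-- The reward collected along an infinite path, until the goal set `G` is reached (forever, if
`G` is never reached): step `i` counts iff none of the states `s₀, …, sᵢ` is in `G`. -/
def pathReward (D : MDP S A ℓ) (j : Fin ℓ) (G : Set S) (ω : ℕ → A × S) : ℝ≥0∞ :=
  ∑' i : ℕ, {i : ℕ | ∀ k ≤ i, (ω k).2 ∉ G}.indicator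
    (fun i => (D.reward j (ω i).2 (ω (i + 1)).1 : ℝ≥0∞)) i

/-- Expected reward until `G` is reached. -/
def expReward (D : MDP S A ℓ) (σ : D.Scheduler) (j : Fin ℓ) (G : Set S) : ℝ≥0∞ :=
  ∫⁻ ω, D.pathReward j G ω ∂σ.pathMeasure

end MDP

/-! ### Markov automata -/

namespace MarkovAutomaton

section Basic

variable {S A : Type*} {ℓ : ℕ}

/-- The probabilistic states `PS`. -/
def PS (M : MarkovAutomaton S A ℓ) : Set S := {s | ∃ α, (M.probTrans s α).isSome}

/-- The Markovian states `MS`. -/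
def MS (M : MarkovAutomaton S A ℓ) : Set S := {s | (M.markovTrans s).isSome}

/-- The exit rate `E(s)` of a Markovian state (`0` for the other states). -/
def exitRate (M : MarkovAutomaton S A ℓ) (s : S) : ℝ :=
  (M.markovTrans s).elim 0 (fun p => (p.1 : ℝ))

/-- The maximum exit rate over the Markovian states. -/
def maxRate (M : MarkovAutomaton S A ℓ) : ℝ := sSup (M.exitRate '' M.MS)

open Classical in
/-- The successor distribution for action `α` in state `s`, if there is one; the action `⊥` also
stands for the Markovian transition of a Markovian state. -/
def succ (M : MarkovAutomaton S A ℓ) (s : S) (α : A) : Option (PMF S) :=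
  (M.probTrans s α).or (if α = M.tau then (M.markovTrans s).map Prod.snd else none)

/-- The transition probabilities `P(s, α, s')`. -/
def prob (M : MarkovAutomaton S A ℓ) (s : S) (α : A) (s' : S) : ℝ :=
  (M.succ s α).elim 0 (fun μ => (μ s').toReal)

/-- The set `Act(s)` of enabled actions. -/
def enabled (M : MarkovAutomaton S A ℓ) (s : S) : Set A := {α | ∃ s', 0 < M.prob s α s'}

theorem prob_nonneg (M : MarkovAutomaton S A ℓ) (s : S) (α : A) (s' : S) :
    0 ≤ M.prob s α s' := by
  unfold prob
  cases M.succ s α <;> simp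

theorem sum_prob [Fintype S] (M : MarkovAutomaton S A ℓ) (s : S) (α : A) :
    ∑ s', M.prob s α s' = if (M.succ s α).isSome then 1 else 0 := by
  unfold prob
  cases M.succ s α with
  | none => simp
  | some μ =>
    simp only [Option.elim_some, Option.isSome_some, if_true]
    rw [← ENNReal.toReal_sum (fun i _ => μ.apply_ne_top i)]
    rw [← tsum_fintype (L := .unconditional S), μ.tsum_coe, ENNReal.toReal_one]

theorem sum_prob_of_enabled [Fintype S] (M : MarkovAutomaton S A ℓ) {s : S} {α : A}
    (h : α ∈ M.enabled s) : ∑ s', M.prob s α s' = 1 := by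
  rw [sum_prob]
  obtain ⟨s', hs'⟩ := h
  cases hh : M.succ s α with
  | none => simp [prob, hh] at hs'
  | some μ => simp

theorem succ_tau_of_mem_MS (M : MarkovAutomaton S A ℓ) {s : S} (h : s ∈ M.MS) :
    (M.succ s M.tau).isSome := by
  have h' : (M.markovTrans s).isSome := h
  simp [succ, h']

theorem exists_succ (M : MarkovAutomaton S A ℓ) (s : S) : ∃ α, (M.succ s α).isSome := by
  rcases M.no_terminal s with ⟨α, h⟩ | h
  · exact ⟨α, by simp [succ, h]⟩
  · exact ⟨M.tau, M.succ_tau_of_mem_MS h⟩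

theorem exitRate_nonneg (M : MarkovAutomaton S A ℓ) (s : S) : 0 ≤ M.exitRate s := by
  unfold exitRate
  cases M.markovTrans s with
  | none => simp
  | some p => exact p.1.2.le

theorem exitRate_pos (M : MarkovAutomaton S A ℓ) {s : S} (h : s ∈ M.MS) : 0 < M.exitRate s := by
  have h' : (M.markovTrans s).isSome := h
  obtain ⟨p, hp⟩ := Option.isSome_iff_exists.1 h'
  simp only [exitRate, hp]
  exact p.1.2

/-- Finite paths of length `n`: the entry with index `i + 1` is `(tᵢ, αᵢ, sᵢ₊₁)`, consisting of the
sojourn time in `sᵢ` (zero in probabilistic states), the action taken there (`⊥` in Markovian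
states) and the next state; the entry with index `0` is `(0, ⊥, s₀)`, where only `s₀` has a
meaning. -/
abbrev Hist (S A : Type*) (n : ℕ) := Finset.Iic n → ℝ≥0 × A × S

/-- The last state of a finite path. -/
def Hist.last {n : ℕ} (h : Hist S A n) : S := (h ⟨n, Finset.mem_Iic.2 le_rfl⟩).2.2

/-- The `i`-th state of an infinite path. -/
def state (ω : ℕ → ℝ≥0 × A × S) (i : ℕ) : S := (ω i).2.2

/-- The sojourn time in the `i`-th state of an infinite path. -/
def sojournTime (ω : ℕ → ℝ≥0 × A × S) (i : ℕ) : ℝ≥0 := (ω (i + 1)).1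

/-- The action taken in the `i`-th state of an infinite path. -/
def action (ω : ℕ → ℝ≥0 × A × S) (i : ℕ) : A := (ω (i + 1)).2.1

/-- The time at which the `n`-th state of an infinite path is entered. -/
def entryTime (ω : ℕ → ℝ≥0 × A × S) (n : ℕ) : ℝ≥0 := ∑ i ∈ Finset.range n, sojournTime ω i

open Classical in
/-- The distribution of the sojourn time in a state: exponential in Markovian states, zero in
probabilistic states. -/
def sojournMeasure (M : MarkovAutomaton S A ℓ) (s : S) : Measure ℝ≥0 :=
  if s ∈ M.MS then (expMeasure (M.exitRate s)).map Real.toNNReal else Measure.dirac 0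

theorem isProbabilityMeasure_sojournMeasure (M : MarkovAutomaton S A ℓ) (s : S) :
    IsProbabilityMeasure (M.sojournMeasure s) := by
  unfold sojournMeasure
  split_ifs with h
  · have := isProbabilityMeasure_expMeasure (M.exitRate_pos h)
    exact Measure.isProbabilityMeasure_map measurable_real_toNNReal.aemeasurable
  · infer_instance

end Basic

section Prob

set_option linter.unusedSectionVars false

variable {S A : Type*} {ℓ : ℕ} [Fintype S] [Fintype A] [MeasurableSpace S]
  [DiscreteMeasurableSpace S] [MeasurableSpace A] [DiscreteMeasurableSpace A]

/-- Generic schedulers: measurable, history-dependent (including sojourn times), randomized. -/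
structure Scheduler (M : MarkovAutomaton S A ℓ) where
  choice : (n : ℕ) → Hist S A n → PMF A
  measurable_choice : ∀ n α, Measurable (fun h => choice n h α)
  choice_enabled : ∀ n h α, choice n h α ≠ 0 → α ∈ M.enabled (Hist.last h)

/-- Distribution of the next step (sojourn time, action and successor state), given the history.
In a Markovian state `⊥` is the only enabled action, so that it is chosen with probability one. -/
def Scheduler.step {M : MarkovAutomaton S A ℓ} (σ : M.Scheduler) (n : ℕ) (h : Hist S A n) :
    Measure (ℝ≥0 × A × S) :=
  ∑ α, ∑ s', (σ.choice n h α * ENNReal.ofReal (M.prob (Hist.last h) α s')) •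
    (M.sojournMeasure (Hist.last h)).map (fun t => (t, α, s'))

theorem Scheduler.isProbabilityMeasure_step {M : MarkovAutomaton S A ℓ} (σ : M.Scheduler) (n : ℕ)
    (h : Hist S A n) : IsProbabilityMeasure (σ.step n h) := by
  constructor
  have key : ∀ α, ∑ s', σ.choice n h α * ENNReal.ofReal (M.prob (Hist.last h) α s')
      = σ.choice n h α := by
    intro α
    rw [← Finset.mul_sum]
    by_cases hα : σ.choice n h α = 0
    · simp [hα]
    · rw [← ENNReal.ofReal_sum_of_nonneg (fun i _ => M.prob_nonneg _ α i),
        M.sum_prob_of_enabled (σ.choice_enabled n h α hα)]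
      simp
  have := M.isProbabilityMeasure_sojournMeasure (Hist.last h)
  have h1 : ∀ (α : A) (s' : S), (M.sojournMeasure (Hist.last h)).map
      (fun t => (t, α, s')) Set.univ = 1 := by
    intro α s'
    rw [Measure.map_apply (by fun_prop) MeasurableSet.univ]
    simp
  simp only [Scheduler.step, Measure.coe_finsetSum, Finset.sum_apply, Measure.smul_apply,
    h1, smul_eq_mul, mul_one, key]
  rw [← tsum_fintype (L := .unconditional A)]
  exact (σ.choice n h).tsum_coe

theorem Hist.measurable_last {n : ℕ} : Measurable (Hist.last : Hist S A n → S) :=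
  measurable_snd.comp (measurable_snd.comp (measurable_pi_apply _))

def Scheduler.stepKernel {M : MarkovAutomaton S A ℓ} (σ : M.Scheduler) (n : ℕ) :
    Kernel (Hist S A n) (ℝ≥0 × A × S) where
  toFun := σ.step n
  measurable' := by
    refine Measure.measurable_of_measurable_coe _ (fun B hB => ?_)
    simp only [Scheduler.step, Measure.coe_finsetSum, Finset.sum_apply, Measure.smul_apply,
      smul_eq_mul]
    refine Finset.measurable_sum _ (fun α _ => Finset.measurable_sum _ (fun s' _ => ?_))
    refine ((σ.measurable_choice n α).mul ?_).mul ?_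
    · exact (measurable_of_countable
        (fun s => ENNReal.ofReal (M.prob s α s'))).comp Hist.measurable_last
    · exact (measurable_of_countable
        (fun s => (M.sojournMeasure s).map (fun t => (t, α, s')) B)).comp Hist.measurable_last

instance {M : MarkovAutomaton S A ℓ} (σ : M.Scheduler) (n : ℕ) : IsMarkovKernel (σ.stepKernel n) :=
  ⟨σ.isProbabilityMeasure_step n⟩

/-- The probability measure on infinite paths that is induced by a scheduler. -/
def Scheduler.pathMeasure {M : MarkovAutomaton S A ℓ} (σ : M.Scheduler) :
    Measure (ℕ → ℝ≥0 × A × S) :=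
  Kernel.traj (X := fun _ => ℝ≥0 × A × S) σ.stepKernel 0 (fun _ => (0, M.tau, M.init))

/-- No Zeno behaviour: under every scheduler, time diverges almost surely. -/
def NonZeno (M : MarkovAutomaton S A ℓ) : Prop :=
  ∀ σ : M.Scheduler, ∀ᵐ ω ∂σ.pathMeasure, ∑' i, (sojournTime ω i : ℝ≥0∞) = ∞

/-- The set of paths reaching `G` within the time interval `I`: the sojourn of some visit of `G`
overlaps with `I`. -/
def timedReach (I : TimeInterval) (G : Set S) : Set (ℕ → ℝ≥0 × A × S) :=
  {ω | ∃ n, state ω n ∈ G ∧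
    (I.toSet ∩ Set.Icc (entryTime ω n) (entryTime ω n + sojournTime ω n)).Nonempty}

/-- The reward collected along an infinite path, until the goal set `G` is reached (forever, if
`G` is never reached): step `i` counts iff none of the states `s₀, …, sᵢ` is in `G`. -/
def pathReward (M : MarkovAutomaton S A ℓ) (j : Fin ℓ) (G : Set S) (ω : ℕ → ℝ≥0 × A × S) : ℝ≥0∞ :=
  ∑' i : ℕ, {i : ℕ | ∀ k ≤ i, state ω k ∉ G}.indicator
    (fun i => ((M.stateReward j (state ω i) * sojournTime ω i
      + M.actionReward j (state ω i) (action ω i) : ℝ≥0) : ℝ≥0∞)) i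

/-- Expected reward until `G` is reached. -/
def expReward (M : MarkovAutomaton S A ℓ) (σ : M.Scheduler) (j : Fin ℓ) (G : Set S) : ℝ≥0∞ :=
  ∫⁻ ω, M.pathReward j G ω ∂σ.pathMeasure

/-- The value of an objective on the automaton under a scheduler. -/
def value (M : MarkovAutomaton S A ℓ) (σ : M.Scheduler) : Objective S ℓ → ℝ≥0∞
  | .reach I G => σ.pathMeasure (timedReach I G)
  | .expReward j G => M.expReward σ j G

/-- The point `p` is achievable on the automaton: some scheduler meets all the thresholds. -/
def Achieves {d : ℕ} (M : MarkovAutomaton S A ℓ) (obj : Fin d → Objective S ℓ)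
    (rel : Fin d → ThresholdRel) (p : Fin d → ℝ) : Prop :=
  ∃ σ : M.Scheduler, ∀ i, (rel i).Holds (M.value σ (obj i) : EReal) ((p i : ℝ) : EReal)

end Prob

/-! ### Digitization -/

section Digitization

variable {S A : Type*} {ℓ : ℕ}

open Classical in
/-- Transition probabilities of the digitization. -/
def digProb (M : MarkovAutomaton S A ℓ) (δ : ℝ≥0) (s : S) (α : A) (s' : S) : ℝ :=
  if s ∈ M.MS ∧ α = M.tau then
    M.prob s M.tau s' * (1 - Real.exp (-(M.exitRate s * δ)))
      + (if s = s' then Real.exp (-(M.exitRate s * δ)) else 0)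
  else M.prob s α s'

open Classical in
/-- Action rewards of the digitization. -/
def digReward (M : MarkovAutomaton S A ℓ) (δ : ℝ≥0) (j : Fin ℓ) (s : S) (α : A) : ℝ≥0 :=
  if s ∈ M.PS then M.actionReward j s α
  else if s ∈ M.MS ∧ α = M.tau then
    (M.actionReward j s M.tau + 1 / (M.exitRate s).toNNReal * M.stateReward j s)
      * (1 - Real.exp (-(M.exitRate s * δ))).toNNReal
  else 0

theorem digProb_nonneg (M : MarkovAutomaton S A ℓ) (δ : ℝ≥0) (s : S) (α : A) (s' : S) :
    0 ≤ M.digProb δ s α s' := by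
  have h1 : 0 ≤ 1 - Real.exp (-(M.exitRate s * δ)) := by
    rw [sub_nonneg, Real.exp_le_one_iff, neg_nonpos]
    exact mul_nonneg (M.exitRate_nonneg s) δ.coe_nonneg
  unfold digProb
  split_ifs
  · exact add_nonneg (mul_nonneg (M.prob_nonneg _ _ _) h1) (Real.exp_pos _).le
  · exact add_nonneg (mul_nonneg (M.prob_nonneg _ _ _) h1) le_rfl
  · exact M.prob_nonneg _ _ _

theorem sum_digProb [Fintype S] (M : MarkovAutomaton S A ℓ) (δ : ℝ≥0) (s : S) (α : A) :
    ∑ s', M.digProb δ s α s' = if (M.succ s α).isSome then 1 else 0 := by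
  classical
  rw [← M.sum_prob]
  by_cases h : s ∈ M.MS ∧ α = M.tau
  · obtain ⟨h1, rfl⟩ := h
    have h2 : ∑ s', M.prob s M.tau s' = 1 := by
      rw [M.sum_prob, if_pos (M.succ_tau_of_mem_MS h1)]
    simp only [digProb, h1, and_self, if_true, Finset.sum_add_distrib, ← Finset.sum_mul, h2]
    simp
  · simp only [digProb, if_neg h]

/-- The digitization of a Markov automaton with respect to the digitization constant `δ`. -/
def digitization [Fintype S] (M : MarkovAutomaton S A ℓ) (δ : ℝ≥0) : MDP S A ℓ where
  init := M.init
  tau := M.tau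
  prob := M.digProb δ
  prob_nonneg := M.digProb_nonneg δ
  prob_sum s α := by
    rw [M.sum_digProb]
    split_ifs <;> simp
  no_terminal s := by
    obtain ⟨α, h⟩ := M.exists_succ s
    exact ⟨α, by rw [M.sum_digProb, if_pos h]⟩
  reward := M.digReward δ

/-- The number of digitization steps before the `n`-th state of a digital path: the number of
transitions that emerge from Markovian states. -/
def digSteps (M : MarkovAutomaton S A ℓ) (ω : ℕ → A × S) (n : ℕ) : ℕ :=
  {i : ℕ | i < n ∧ (ω i).2 ∈ M.MS}.ncard

/-- The set of digital paths that reach `G` with a number of digitization steps in `J`. -/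
def dsReach (M : MarkovAutomaton S A ℓ) (J : Set ℕ) (G : Set S) : Set (ℕ → A × S) :=
  {ω | ∃ n, (ω n).2 ∈ G ∧ M.digSteps ω n ∈ J}

variable [Fintype S] [Fintype A] [MeasurableSpace S]
  [DiscreteMeasurableSpace S] [MeasurableSpace A] [DiscreteMeasurableSpace A]

/-- The value of an objective on the digitization under a scheduler. -/
def digValue (M : MarkovAutomaton S A ℓ) (δ : ℝ≥0) (σ : (M.digitization δ).Scheduler) :
    Objective S ℓ → ℝ≥0∞
  | .reach I G => σ.pathMeasure (M.dsReach (I.stepBounds δ) G)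
  | .expReward j G => (M.digitization δ).expReward σ j G

/-- The point `p` is achievable on the digitization. -/
def DigAchieves {d : ℕ} (M : MarkovAutomaton S A ℓ) (δ : ℝ≥0) (obj : Fin d → Objective S ℓ)
    (rel : Fin d → ThresholdRel) (p : Fin d → ℝ) : Prop :=
  ∃ σ : (M.digitization δ).Scheduler,
    ∀ i, (rel i).Holds (M.digValue δ σ (obj i) : EReal) ((p i : ℝ) : EReal)

end Digitization

/-! ### Error bounds -/

section Error

variable {S A : Type*} {ℓ : ℕ}

/-- `1 - (1 + λ δ) ^ (c / δ) * exp (-λ c)` with `λ` the maximum exit rate; the exponent is a natural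
number when `c` is an end point of a well-formed interval. -/
def stepError (M : MarkovAutomaton S A ℓ) (δ c : ℝ≥0) : ℝ :=
  1 - (1 + M.maxRate * δ) ^ ((c : ℝ) / δ) * Real.exp (-(M.maxRate * c))

open Classical in
/-- The lower error bound of a time interval. -/
def lowerError (M : MarkovAutomaton S A ℓ) (δ : ℝ≥0) (I : TimeInterval) : ℝ :=
  if I.lower = 0 then 0 else M.stepError δ I.lower

open Classical in
/-- The contribution of the lower end point `a` to the upper error bound of a time interval. -/
def upperErrorLeft (M : MarkovAutomaton S A ℓ) (δ a : ℝ≥0) : ℝ :=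
  if a = 0 then 0 else 1 - Real.exp (-(M.maxRate * δ))

/-- The upper error bound of a time interval. -/
def upperError (M : MarkovAutomaton S A ℓ) (δ : ℝ≥0) : TimeInterval → ℝ
  | .bounded a b _ => M.stepError δ b + M.upperErrorLeft δ a
  | .unbounded a => M.upperErrorLeft δ a

def objLowerError (M : MarkovAutomaton S A ℓ) (δ : ℝ≥0) : Objective S ℓ → ℝ
  | .reach I _ => M.lowerError δ I
  | .expReward _ _ => 0

def objUpperError (M : MarkovAutomaton S A ℓ) (δ : ℝ≥0) : Objective S ℓ → ℝ
  | .reach I _ => M.upperError δ I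
  | .expReward _ _ => 0

/-- The error box (hyperrectangle) around the point `p`. -/
def errorBox {d : ℕ} (M : MarkovAutomaton S A ℓ) (δ : ℝ≥0) (obj : Fin d → Objective S ℓ)
    (p : Fin d → ℝ) : Set (Fin d → ℝ) :=
  Set.univ.pi fun i =>
    Set.Icc (p i - M.objLowerError δ (obj i)) (p i + M.objUpperError δ (obj i))

variable [Fintype S] [Fintype A] [MeasurableSpace S]
  [DiscreteMeasurableSpace S] [MeasurableSpace A] [DiscreteMeasurableSpace A]

/-- Points such that all points whose error box contains them are achievable on the
digitization. -/
def underApprox {d : ℕ} (M : MarkovAutomaton S A ℓ) (δ : ℝ≥0) (obj : Fin d → Objective S ℓ)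
    (rel : Fin d → ThresholdRel) : Set (Fin d → ℝ) :=
  {p' | ∀ p, p' ∈ M.errorBox δ obj p → M.DigAchieves δ obj rel p}

/-- Points that lie in the error box of some point that is achievable on the digitization. -/
def overApprox {d : ℕ} (M : MarkovAutomaton S A ℓ) (δ : ℝ≥0) (obj : Fin d → Objective S ℓ)
    (rel : Fin d → ThresholdRel) : Set (Fin d → ℝ) :=
  {p' | ∃ p, p' ∈ M.errorBox δ obj p ∧ M.DigAchieves δ obj rel p}

end Error

end MarkovAutomaton

end

/-! The proof couples the automaton with its digitization. A timed path determines a digital path: a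
sojourn of length `t` in a Markovian state becomes `⌊t / δ⌋` self-loops followed by the actual jump,
and the digital clock restarts whenever a new state is entered. Memorylessness makes this exact:
after any number of complete periods in a Markovian state `s`, the sojourn outlasts one more period
with probability `exp (-E(s) δ)`, and otherwise the jump has law `P(s, ⊥, ·)`. This is the
transition law of the digitization (`Scheduler.step_nextDig`).

A scheduler of the automaton may use exact sojourn times. Averaging its choices over all timed
histories with a given digital history yields a scheduler of the digitization
(`Scheduler.exists_compatible_digScheduler`). Conversely, a digital scheduler acts on timed
histories by reading off their digital histories (`compatible_liftScheduler`). For such a compatible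
pair, the digital path of a random timed path has the law of the digitization
(`Scheduler.Compatible.map_dig`), so that all objectives can be compared path by path on one
probability space.

Expected rewards agree exactly: the digital rewards of one visit form a geometric series whose sum
is the mean reward of the sojourn (`Scheduler.tsum_lintegral_tickReward`).

For reachability, a state entered after `N` digitization steps is entered at a time of at most `N
δ`, so the digital clock never lags behind. The two notions of reaching the goal can differ only if
more than `k` steps are made within time `k δ`, for an end point `k δ` of the interval, or if the
digitization step whose index is that of a positive lower end point is a genuine jump
(`mem_timedReach_of_dig_mem`, `dig_mem_of_mem_timedReach`). The jump has probability at most `1 -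
exp (-λ δ)` by memorylessness (`Scheduler.measure_jumpAt_le`). The overrun is bounded by a
submartingale argument (`Scheduler.survival_zero_le`, `Scheduler.measure_overrun_le`) whose one-step
inequality, `survival_le_lintegral`, is an equality if the current rate is `λ`.

Hence the values under compatible schedulers differ by at most the one-sided errors, and both
inclusions follow by moving each threshold to the appropriate side of its error interval. -/

/-! ### Trajectory measures and their one-step transitions -/

section Traj

open Preorder

variable {X : Type*} [MeasurableSpace X]

/-- Splitting an integral over a trajectory at time `n`. -/
theorem lintegral_traj_succ {κ : (n : ℕ) → Kernel (Finset.Iic n → X) X} [∀ n, IsMarkovKernel (κ n)]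
    (x₀ : Finset.Iic 0 → X) (n : ℕ) {f : (Finset.Iic n → X) → X → ℝ≥0∞}
    (hf : Measurable (Function.uncurry f)) :
    ∫⁻ ω, f (frestrictLe (π := fun _ => X) n ω) (ω (n + 1)) ∂(Kernel.traj (X := fun _ => X) κ 0 x₀)
      = ∫⁻ ω, ∫⁻ y, f (frestrictLe (π := fun _ => X) n ω) y ∂(κ n (frestrictLe (π := fun _ => X) n ω))
        ∂(Kernel.traj (X := fun _ => X) κ 0 x₀) := by
  have h := Kernel.partialTraj_compProd_eq_map_traj (X := fun _ => X) (κ := κ) (Nat.zero_le n)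
    (x₀ := x₀)
  have h1 : ∫⁻ ω, f (frestrictLe (π := fun _ => X) n ω) (ω (n + 1))
      ∂(Kernel.traj (X := fun _ => X) κ 0 x₀)
      = ∫⁻ p, Function.uncurry f p ∂((Kernel.traj (X := fun _ => X) κ 0 x₀).map
        (fun x ↦ (frestrictLe (π := fun _ => X) n x, x (n + 1)))) := by
    rw [lintegral_map hf (by fun_prop)]
    rfl
  rw [h1, ← h, Measure.lintegral_compProd hf, ← Kernel.traj_map_frestrictLe_apply,
    lintegral_map _ (by fun_prop)]
  · rfl
  · exact hf.lintegral_kernel_prod_right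

/-- A probability measure on trajectories in a countable space is determined by its initial value
and its one-step transition probabilities. -/
theorem eq_traj_of_transition [Countable X] [DiscreteMeasurableSpace X]
    {κ : (n : ℕ) → Kernel (Finset.Iic n → X) X} [∀ n, IsMarkovKernel (κ n)]
    (x₀ : Finset.Iic 0 → X) (ν : Measure (ℕ → X)) [IsProbabilityMeasure ν]
    (h0 : ∀ᵐ ω ∂ν, frestrictLe (π := fun _ => X) 0 ω = x₀)
    (hstep : ∀ n h a, ν {ω | frestrictLe (π := fun _ => X) n ω = h ∧ ω (n + 1) = a}
      = ν {ω | frestrictLe (π := fun _ => X) n ω = h} * κ n h {a}) :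
    ν = Kernel.traj (X := fun _ => X) κ 0 x₀ := by
  have hmeas : ∀ n, Measurable (frestrictLe (π := fun _ : ℕ => X) n) := fun n => by fun_prop
  have key : ∀ n, ν.map (frestrictLe (π := fun _ => X) n)
      = Kernel.partialTraj (X := fun _ => X) κ 0 n x₀ := by
    intro n
    induction n with
    | zero =>
      rw [Kernel.partialTraj_self, Kernel.id_apply, Measure.map_congr (g := fun _ => x₀) h0]
      simp
    | succ n ih =>
      let g : (Finset.Iic n → X) × X → (Finset.Iic (n + 1) → X) := fun p i =>
        if h : i.1 ≤ n then p.1 ⟨i.1, Finset.mem_Iic.2 h⟩ else p.2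
      have hg : Measurable g := by
        refine measurable_pi_lambda _ fun i => ?_
        by_cases h : i.1 ≤ n
        · simp only [g, h, dif_pos]; fun_prop
        · simp only [g, h, dif_neg, not_false_eq_true]; fun_prop
      have hgf : frestrictLe (π := fun _ : ℕ => X) (n + 1)
          = g ∘ (fun x ↦ (frestrictLe (π := fun _ => X) n x, x (n + 1))) := by
        funext ω i
        by_cases h : i.1 ≤ n
        · simp [g, h]
        · have : i.1 = n + 1 := le_antisymm (Finset.mem_Iic.1 i.2) (by omega)
          simp [g, this]
      -- The space is countable, so equality on singletons suffices, and there it is `hstep`.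
      have hpair : ν.map (fun x ↦ (frestrictLe (π := fun _ => X) n x, x (n + 1)))
          = (Kernel.partialTraj (X := fun _ => X) κ 0 n x₀) ⊗ₘ (κ n) := by
        rw [← ih]
        refine Measure.ext_of_singleton fun ⟨h, a⟩ => ?_
        rw [Measure.map_apply (by fun_prop) (measurableSet_singleton _),
          Measure.compProd_apply (measurableSet_singleton _), lintegral_map
            (Kernel.measurable_kernel_prodMk_left (measurableSet_singleton _)) (hmeas n)]
        have e1 : (fun x : ℕ → X ↦ (frestrictLe (π := fun _ => X) n x, x (n + 1))) ⁻¹' {(h, a)}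
            = {ω | frestrictLe (π := fun _ => X) n ω = h ∧ ω (n + 1) = a} := by
          ext ω; simp [Prod.ext_iff]
        have hms : MeasurableSet {ω : ℕ → X | frestrictLe (π := fun _ => X) n ω = h} :=
          hmeas n (measurableSet_singleton h)
        rw [e1, hstep, mul_comm, ← lintegral_indicator_const hms]
        refine lintegral_congr fun ω => ?_
        by_cases hω : frestrictLe (π := fun _ => X) n ω = h
        · subst hω
          rw [Set.indicator_of_mem (by simp)]
          congr 1; ext y; simp
        · rw [Set.indicator_of_notMem (by simpa using hω)]
          symm
          convert! measure_empty (μ := κ n (frestrictLe (π := fun _ => X) n ω))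
          ext y; simp [hω]
      rw [hgf, ← Measure.map_map hg (by fun_prop), hpair,
        Kernel.partialTraj_compProd_eq_map_traj (X := fun _ => X) (Nat.zero_le n),
        Measure.map_map hg (by fun_prop), ← hgf, Kernel.traj_map_frestrictLe_apply]
  -- Every finite index set lies in an initial segment, so the marginals from `key` determine the
  -- measure.
  refine IsProjectiveLimit.unique (P := fun I : Finset ℕ =>
    (Kernel.traj (X := fun _ => X) κ 0 x₀).map (I.restrict (π := fun _ => X))) (fun I => ?_)
    (fun I => rfl)
  have hI : I ⊆ Finset.Iic (I.sup id) := I.subset_Iic_sup_id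
  have hr : I.restrict (π := fun _ : ℕ => X)
      = Finset.restrict₂ (π := fun _ => X) hI ∘ frestrictLe (π := fun _ => X) (I.sup id) := rfl
  rw [hr, ← Measure.map_map (by fun_prop) (by fun_prop), key,
    ← Kernel.traj_map_frestrictLe_apply, Measure.map_map (by fun_prop) (by fun_prop)]
  rfl

end Traj

noncomputable section

set_option linter.unusedSectionVars false

namespace MarkovAutomaton

/-! ### Exponential sojourn times and their complete periods -/

section Sojourn

variable {S A : Type*} {ℓ : ℕ} (M : MarkovAutomaton S A ℓ) (δ : ℝ≥0)

open Classical in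
/-- The number of complete digitization periods within a sojourn of length `t` in `s`. -/
def ticks (s : S) (t : ℝ≥0) : ℕ := if s ∈ M.MS then ⌊t / δ⌋₊ else 0

variable {M}

theorem probTrans_of_mem_MS {s : S} (hs : s ∈ M.MS) (α : A) : M.probTrans s α = none := by
  by_contra h
  have h1 := M.maximal_progress s ⟨α, Option.isSome_iff_ne_none.2 h⟩
  have h2 : (M.markovTrans s).isSome := hs
  simp [h1] at h2

theorem eq_tau_of_mem_MS {s : S} (hs : s ∈ M.MS) {α : A} (h : (M.succ s α).isSome) :
    α = M.tau := by
  by_contra hα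
  simp [succ, probTrans_of_mem_MS hs, hα] at h

theorem isSome_succ_of_mem_enabled {s : S} {α : A} (h : α ∈ M.enabled s) :
    (M.succ s α).isSome := by
  obtain ⟨s', hs'⟩ := h
  by_contra hn
  rw [Option.not_isSome_iff_eq_none] at hn
  simp [prob, hn] at hs'

theorem mem_PS_iff {s : S} : s ∈ M.PS ↔ s ∉ M.MS := by
  constructor
  · rintro ⟨α, hα⟩ h
    simp [probTrans_of_mem_MS h α] at hα
  · intro h
    exact (M.no_terminal s).resolve_right h

theorem sojournMeasure_of_notMem {s : S} (hs : s ∉ M.MS) :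
    M.sojournMeasure s = Measure.dirac 0 := by
  simp [sojournMeasure, hs]

instance (s : S) : IsProbabilityMeasure (M.sojournMeasure s) :=
  M.isProbabilityMeasure_sojournMeasure s

theorem lintegral_sojournMeasure {s : S} (hs : s ∈ M.MS) {f : ℝ≥0 → ℝ≥0∞} (hf : Measurable f) :
    ∫⁻ t, f t ∂M.sojournMeasure s
      = ∫⁻ x in Set.Ici (0 : ℝ), ENNReal.ofReal (M.exitRate s * Real.exp (-(M.exitRate s * x)))
          * f x.toNNReal := by
  rw [sojournMeasure, if_pos hs, lintegral_map hf measurable_real_toNNReal, expMeasure,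
    gammaMeasure, lintegral_withDensity_eq_lintegral_mul (f := gammaPDF 1 (M.exitRate s)) _
      (measurable_gammaPDFReal _ _).ennreal_ofReal
      (g := fun x => f x.toNNReal) (hf.comp measurable_real_toNNReal),
    ← lintegral_indicator measurableSet_Ici]
  refine lintegral_congr fun x => ?_
  have h := exponentialPDF_eq (M.exitRate s) x
  rw [exponentialPDF, exponentialPDFReal] at h
  simp only [Pi.mul_apply, gammaPDF, h]
  by_cases hx : 0 ≤ x <;> simp [hx]

theorem lintegral_Ici_exp {r c : ℝ} (hr : 0 < r) :
    ∫⁻ x in Set.Ici c, ENNReal.ofReal (r * Real.exp (-(r * x)))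
      = ENNReal.ofReal (Real.exp (-(r * c))) := by
  have h1 := integral_exp_mul_Ioi (a := -r) (by linarith) c
  have h2 := integrableOn_exp_mul_Ioi (a := -r) (by linarith) c
  rw [setLIntegral_congr Ioi_ae_eq_Ici.symm, ← ofReal_integral_eq_lintegral_ofReal]
  · congr 1
    rw [integral_const_mul]
    simp only [← neg_mul, h1]
    field_simp
  · simp only [← neg_mul]
    exact h2.const_mul r
  · exact Filter.Eventually.of_forall fun x => by positivity

theorem sojournMeasure_Ici {s : S} (hs : s ∈ M.MS) (c : ℝ≥0) :
    M.sojournMeasure s (Set.Ici c) = ENNReal.ofReal (Real.exp (-(M.exitRate s * c))) := by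
  rw [← lintegral_indicator_one measurableSet_Ici,
    lintegral_sojournMeasure hs (measurable_one.indicator measurableSet_Ici),
    ← lintegral_Ici_exp (M.exitRate_pos hs), ← lintegral_indicator measurableSet_Ici,
    ← lintegral_indicator measurableSet_Ici]
  refine lintegral_congr fun x => ?_
  by_cases hx : (c : ℝ) ≤ x
  · have h0 : 0 ≤ x := c.2.trans hx
    have h1 : c ≤ x.toNNReal := by rwa [Real.le_toNNReal_iff_coe_le h0]
    simp [hx, h0, h1]
  · by_cases h0 : 0 ≤ x
    · have h1 : ¬ c ≤ x.toNNReal := by rwa [Real.le_toNNReal_iff_coe_le h0]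
      simp [hx, h0, h1]
    · simp [hx, h0]

/-- By the layer cake formula the mean is the integral of the tail `exp (-E t)`. -/
theorem lintegral_id_sojournMeasure {s : S} (hs : s ∈ M.MS) :
    ∫⁻ t : ℝ≥0, (t : ℝ≥0∞) ∂M.sojournMeasure s = ENNReal.ofReal (1 / M.exitRate s) := by
  have h := lintegral_eq_lintegral_meas_le (M.sojournMeasure s) (f := fun t : ℝ≥0 => (t : ℝ))
    (Filter.Eventually.of_forall fun t => t.2) (by fun_prop)
  simp only [ENNReal.ofReal_coe_nnreal] at h
  have hE := M.exitRate_pos hs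
  rw [h, setLIntegral_congr_fun (g := fun t => ENNReal.ofReal (Real.exp (-(M.exitRate s * t))))
    measurableSet_Ioi]
  · have h1 := lintegral_Ici_exp (c := 0) hE
    rw [setLIntegral_congr Ioi_ae_eq_Ici.symm] at h1
    simp only [ENNReal.ofReal_mul hE.le] at h1
    rw [lintegral_const_mul' _ _ ENNReal.ofReal_ne_top] at h1
    simp only [mul_zero, neg_zero, Real.exp_zero, ENNReal.ofReal_one] at h1
    rw [one_div, ENNReal.ofReal_inv_of_pos hE]
    exact ENNReal.eq_inv_of_mul_eq_one_left ((mul_comm _ _).trans h1)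
  · intro t ht
    have : {a : ℝ≥0 | t ≤ (a : ℝ)} = Set.Ici t.toNNReal := by
      ext a; simp [Real.toNNReal_le_iff_le_coe]
    simp only [this, sojournMeasure_Ici hs]
    rw [Real.coe_toNNReal _ (le_of_lt ht)]

variable {δ}

theorem le_ticks_iff (hδ : 0 < δ) {s : S} (hs : s ∈ M.MS) (r : ℕ) (t : ℝ≥0) :
    r ≤ M.ticks δ s t ↔ r * δ ≤ t := by
  rw [ticks, if_pos hs, Nat.le_floor_iff (by positivity), le_div_iff₀ hδ]

theorem ticks_of_notMem {s : S} (hs : s ∉ M.MS) (t : ℝ≥0) : M.ticks δ s t = 0 := by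
  rw [ticks, if_neg hs]

/-- The number of complete periods is geometric: each further period costs the same factor. This is
the discrete form of memorylessness used throughout. -/
theorem sojournMeasure_le_ticks (hδ : 0 < δ) {s : S} (hs : s ∈ M.MS) (r : ℕ) :
    M.sojournMeasure s {t | r ≤ M.ticks δ s t}
      = ENNReal.ofReal (Real.exp (-(M.exitRate s * δ))) ^ r := by
  have h : {t | r ≤ M.ticks δ s t} = Set.Ici (r * δ) := by
    ext t; simp [le_ticks_iff hδ hs]
  rw [h, sojournMeasure_Ici hs, ← ENNReal.ofReal_pow (Real.exp_pos _).le, ← Real.exp_nat_mul]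
  congr 2
  push_cast; ring

theorem sojournMeasure_ticks_eq (hδ : 0 < δ) {s : S} (hs : s ∈ M.MS) (r : ℕ) :
    M.sojournMeasure s {t | M.ticks δ s t = r}
      = ENNReal.ofReal (Real.exp (-(M.exitRate s * δ))) ^ r
        * ENNReal.ofReal (1 - Real.exp (-(M.exitRate s * δ))) := by
  have h : {t | M.ticks δ s t = r} = {t | r ≤ M.ticks δ s t} \ {t | r + 1 ≤ M.ticks δ s t} := by
    ext t; simp only [Set.mem_ofPred_eq, Set.mem_sdiff]; omega
  have hm : MeasurableSet {t | r + 1 ≤ M.ticks δ s t} := by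
    have : {t | r + 1 ≤ M.ticks δ s t} = Set.Ici (((r + 1 : ℕ) : ℝ≥0) * δ) := by
      ext t; simp only [Set.mem_ofPred_eq, le_ticks_iff hδ hs, Set.mem_Ici]
    rw [this]; exact measurableSet_Ici
  rw [h, measure_sdiff (by intro t ht; simp only [Set.mem_ofPred_eq] at ht ⊢; omega) hm.nullMeasurableSet
    (measure_ne_top _ _), sojournMeasure_le_ticks hδ hs, sojournMeasure_le_ticks hδ hs,
    ENNReal.ofReal_sub _ (Real.exp_pos _).le, ENNReal.ofReal_one, ENNReal.mul_sub
      (by intros; exact ENNReal.pow_ne_top ENNReal.ofReal_ne_top), mul_one, pow_succ]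

theorem measurable_ticks (s : S) : Measurable (M.ticks δ s) := by
  unfold ticks
  split_ifs
  · exact Nat.measurable_floor.comp (measurable_id.div_const δ)
  · exact measurable_const

end Sojourn

/-! ### One step of the timed process seen digitally -/

section Step

variable {S A : Type*} {ℓ : ℕ} {M : MarkovAutomaton S A ℓ} {δ : ℝ≥0}

variable (M δ) in
/-- The next action and state of the digital path, after `r` elapsed periods in state `s`
from which the timed path proceeds by `y`. -/
def nextDig (s : S) (r : ℕ) (y : ℝ≥0 × A × S) : A × S :=
  if r < M.ticks δ s y.1 then (M.tau, s) else y.2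

variable [Fintype S] [Fintype A] [MeasurableSpace S]
  [DiscreteMeasurableSpace S] [MeasurableSpace A] [DiscreteMeasurableSpace A]

theorem sum_ofReal_prob {s : S} {α : A} (h : α ∈ M.enabled s) :
    ∑ s', ENNReal.ofReal (M.prob s α s') = 1 := by
  rw [← ENNReal.ofReal_sum_of_nonneg (fun i _ => M.prob_nonneg _ α i), M.sum_prob_of_enabled h,
    ENNReal.ofReal_one]

theorem tau_mem_enabled {s : S} (hs : s ∈ M.MS) : M.tau ∈ M.enabled s := by
  by_contra h
  have h1 : ∑ s', M.prob s M.tau s' = 1 := by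
    rw [M.sum_prob, if_pos (M.succ_tau_of_mem_MS hs)]
  have h2 : ∀ s', M.prob s M.tau s' = 0 := fun s' =>
    le_antisymm (not_lt.1 fun h' => h ⟨s', h'⟩) (M.prob_nonneg _ _ _)
  simp [h2] at h1

theorem exists_mem_enabled (M : MarkovAutomaton S A ℓ) (s : S) : ∃ α, α ∈ M.enabled s := by
  obtain ⟨α, hα⟩ := M.exists_succ s
  refine ⟨α, ?_⟩
  by_contra h
  have h1 : ∑ s', M.prob s α s' = 1 := by
    rw [M.sum_prob, if_pos hα]
  have h2 : ∀ s', M.prob s α s' = 0 := fun s' =>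
    le_antisymm (not_lt.1 fun h' => h ⟨s', h'⟩) (M.prob_nonneg _ _ _)
  simp [h2] at h1

namespace Scheduler

variable (σ : M.Scheduler) {n : ℕ} (h : Hist S A n)

instance : IsProbabilityMeasure (σ.step n h) := σ.isProbabilityMeasure_step n h

theorem lintegral_step {f : ℝ≥0 × A × S → ℝ≥0∞} (hf : Measurable f) :
    ∫⁻ y, f y ∂σ.step n h = ∑ α, σ.choice n h α * ∑ s', ENNReal.ofReal (M.prob h.last α s') *
      ∫⁻ t, f (t, α, s') ∂M.sojournMeasure h.last := by
  simp only [Scheduler.step, lintegral_finsetSum_measure, lintegral_smul_measure, smul_eq_mul,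
    Finset.mul_sum]
  refine Finset.sum_congr rfl fun α _ => Finset.sum_congr rfl fun s' _ => ?_
  rw [lintegral_map hf (by fun_prop), mul_assoc]

/-- By maximal progress, `⊥` is the only enabled action of a Markovian state. -/
theorem choice_of_mem_MS (hs : h.last ∈ M.MS) : σ.choice n h = PMF.pure M.tau := by
  have h0 : ∀ α, α ≠ M.tau → σ.choice n h α = 0 := by
    intro α hα
    by_contra hne
    exact hα (eq_tau_of_mem_MS hs (isSome_succ_of_mem_enabled (σ.choice_enabled n h α hne)))
  classical
  ext α
  rw [PMF.pure_apply]
  split_ifs with hα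
  · subst hα
    have := (σ.choice n h).tsum_coe
    rwa [tsum_eq_single M.tau h0] at this
  · exact h0 α hα

theorem lintegral_step_of_mem_MS (hs : h.last ∈ M.MS) {f : ℝ≥0 × A × S → ℝ≥0∞}
    (hf : Measurable f) :
    ∫⁻ y, f y ∂σ.step n h = ∑ s', ENNReal.ofReal (M.prob h.last M.tau s') *
      ∫⁻ t, f (t, M.tau, s') ∂M.sojournMeasure h.last := by
  classical
  simp [lintegral_step σ h hf, σ.choice_of_mem_MS h hs, PMF.pure_apply]

theorem lintegral_step_of_notMem_MS (hs : h.last ∉ M.MS) {f : ℝ≥0 × A × S → ℝ≥0∞}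
    (hf : Measurable f) :
    ∫⁻ y, f y ∂σ.step n h = ∑ α, σ.choice n h α *
      ∑ s', ENNReal.ofReal (M.prob h.last α s') * f (0, α, s') := by
  simp only [lintegral_step σ h hf, sojournMeasure_of_notMem hs]
  refine Finset.sum_congr rfl fun α _ => ?_
  congr 1
  refine Finset.sum_congr rfl fun s' _ => ?_
  rw [lintegral_dirac' (f := fun t => f (t, α, s')) _ (by fun_prop)]

/-- In Markovian states, integrals of functions of the sojourn time. -/
theorem lintegral_step_time (hs : h.last ∈ M.MS) {f : ℝ≥0 → ℝ≥0∞} (hf : Measurable f) :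
    ∫⁻ y, f y.1 ∂σ.step n h = ∫⁻ t, f t ∂M.sojournMeasure h.last := by
  rw [lintegral_step_of_mem_MS σ h hs (f := fun y => f y.1) (by fun_prop)]
  simp only [← Finset.sum_mul, sum_ofReal_prob (tau_mem_enabled hs), one_mul]

theorem step_time_preimage (hs : h.last ∈ M.MS) {B : Set ℝ≥0} (hB : MeasurableSet B) :
    σ.step n h {y | y.1 ∈ B} = M.sojournMeasure h.last B := by
  rw [← lintegral_indicator_one hB, ← lintegral_step_time σ h hs (measurable_one.indicator hB),
    ← lintegral_indicator_one (show MeasurableSet {y : ℝ≥0 × A × S | y.1 ∈ B} from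
      measurable_fst hB)]
  rfl

theorem ae_step_of_notMem_MS (hs : h.last ∉ M.MS) : ∀ᵐ y ∂σ.step n h, y.1 = 0 := by
  have hm : MeasurableSet {y : ℝ≥0 × A × S | ¬ y.1 = 0} :=
    (measurable_fst (measurableSet_singleton 0)).compl
  rw [ae_iff, ← lintegral_indicator_one hm, lintegral_step_of_notMem_MS σ h hs
    (measurable_one.indicator hm)]
  simp

theorem sum_choice (σ : M.Scheduler) {n : ℕ} (h : Hist S A n) : ∑ α, σ.choice n h α = 1 := by
  rw [← tsum_fintype (L := .unconditional A)]
  exact (σ.choice n h).tsum_coe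

theorem measurableSet_nextDig (s : S) (r : ℕ) (B : Set (A × S)) :
    MeasurableSet {y | r ≤ M.ticks δ s y.1 ∧ M.nextDig δ s r y ∈ B} := by
  have h1 : Measurable fun y : ℝ≥0 × A × S => M.ticks δ s y.1 :=
    (measurable_ticks s).comp measurable_fst
  have h2 : Measurable fun y : ℝ≥0 × A × S => M.nextDig δ s r y :=
    Measurable.ite (measurableSet_lt measurable_const h1) measurable_const measurable_snd
  exact (measurableSet_le measurable_const h1).inter (h2 (MeasurableSet.of_discrete))

/-- With `q = exp (-E δ)`, a further self-loop after `r` periods has weight `q ^ (r + 1)` and a jump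
has weight `q ^ r * (1 - q)`. Taking out the factor `q ^ r` leaves the transition probabilities of
the digitization, independently of `r`. -/
theorem step_nextDig_of_mem_MS (hδ : 0 < δ) (hs : h.last ∈ M.MS) (r : ℕ) (B : Set (A × S)) :
    σ.step n h {y | r ≤ M.ticks δ h.last y.1 ∧ M.nextDig δ h.last r y ∈ B}
      = ENNReal.ofReal (Real.exp (-(M.exitRate h.last * δ))) ^ r *
        ∑ s', ENNReal.ofReal (M.digProb δ h.last M.tau s') * B.indicator 1 (M.tau, s') := by
  classical
  have hstep := fun f hf => lintegral_step_of_mem_MS σ h hs (f := f) hf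
  generalize h.last = s at *
  set q := ENNReal.ofReal (Real.exp (-(M.exitRate s * δ))) with hq
  have hm := measurableSet_nextDig (M := M) (δ := δ) s r B
  have hE : 0 ≤ 1 - Real.exp (-(M.exitRate s * δ)) := by
    rw [sub_nonneg, Real.exp_le_one_iff, neg_nonpos]
    exact mul_nonneg (M.exitRate_nonneg s) δ.coe_nonneg
  rw [← lintegral_indicator_one hm, hstep _ (measurable_one.indicator hm)]
  -- The sojourn either completes period `r + 1`, and the digital path stays in `s`, or it has
  -- exactly `r` complete periods, and the jump goes to `s'`.
  have hin : ∀ s', ∫⁻ t, {y | r ≤ M.ticks δ s y.1 ∧ M.nextDig δ s r y ∈ B}.indicator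
      (1 : ℝ≥0 × A × S → ℝ≥0∞) (t, M.tau, s') ∂M.sojournMeasure s
      = B.indicator 1 (M.tau, s) * q ^ (r + 1) + B.indicator 1 (M.tau, s') *
        (q ^ r * ENNReal.ofReal (1 - Real.exp (-(M.exitRate s * δ)))) := by
    intro s'
    have hm1 : MeasurableSet {t | r + 1 ≤ M.ticks δ s t} :=
      measurableSet_le measurable_const (measurable_ticks s)
    have hm2 : MeasurableSet {t | M.ticks δ s t = r} :=
      measurable_ticks s (measurableSet_singleton r)
    rw [← sojournMeasure_le_ticks hδ hs, ← sojournMeasure_ticks_eq hδ hs,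
      ← lintegral_indicator_one hm1, ← lintegral_indicator_one hm2,
      ← lintegral_const_mul _ (measurable_one.indicator hm1),
      ← lintegral_const_mul _ (measurable_one.indicator hm2),
      ← lintegral_add_left ((measurable_one.indicator hm1).const_mul _)]
    refine lintegral_congr fun t => ?_
    rcases lt_trichotomy (M.ticks δ s t) r with hr | hr | hr
    · simp [Set.indicator_apply, hr.ne, show ¬ r ≤ M.ticks δ s t by omega,
        show ¬ r < M.ticks δ s t by omega]
    · simp [Set.indicator_apply, hr, nextDig]
    · simp [Set.indicator_apply, hr, hr.le, hr.ne', nextDig]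
  simp only [hin, mul_add, Finset.sum_add_distrib, ← Finset.sum_mul,
    sum_ofReal_prob (tau_mem_enabled hs), one_mul, Finset.mul_sum]
  have hd : ∀ s', ENNReal.ofReal (M.digProb δ s M.tau s')
      = ENNReal.ofReal (M.prob s M.tau s') * ENNReal.ofReal (1 - Real.exp (-(M.exitRate s * δ)))
        + if s = s' then q else 0 := by
    intro s'
    rw [digProb, if_pos ⟨hs, rfl⟩, ENNReal.ofReal_add (mul_nonneg (M.prob_nonneg _ _ _) hE)
      (by split_ifs <;> positivity), ENNReal.ofReal_mul (M.prob_nonneg _ _ _)]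
    split_ifs <;> simp [q]
  simp only [hd, add_mul, mul_add, Finset.sum_add_distrib, ite_mul, zero_mul, mul_ite, mul_zero,
    Finset.sum_ite_eq, Finset.mem_univ, if_true]
  rw [add_comm]
  congr 1
  · refine Finset.sum_congr rfl fun s' _ => ?_
    ring
  · ring

/-- The digital step from a timed history is distributed as in the digitization. -/
theorem step_nextDig (hδ : 0 < δ) (r : ℕ) (α : A) (s' : S) :
    σ.step n h {y | r ≤ M.ticks δ h.last y.1 ∧ M.nextDig δ h.last r y = (α, s')}
      = σ.step n h {y | r ≤ M.ticks δ h.last y.1} *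
        (σ.choice n h α * ENNReal.ofReal (M.digProb δ h.last α s')) := by
  classical
  by_cases hs : h.last ∈ M.MS
  · have h1 := step_nextDig_of_mem_MS σ h hδ hs r {(α, s')}
    simp only [Set.mem_singleton_iff] at h1
    have h2 := step_time_preimage σ h hs (B := {t | r ≤ M.ticks δ h.last t})
      (measurableSet_le measurable_const (measurable_ticks _))
    simp only [Set.mem_ofPred_eq] at h2
    rw [h1, h2, sojournMeasure_le_ticks hδ hs,
      choice_of_mem_MS σ h hs, PMF.pure_apply]
    congr 1
    by_cases hα : α = M.tau
    · subst hα
      simp [Set.indicator_apply, Prod.ext_iff]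
    · simp [Prod.ext_iff, hα, Ne.symm hα]
  · have hm := measurableSet_nextDig (M := M) (δ := δ) h.last r {(α, s')}
    rw [← lintegral_indicator_one (by simpa using hm), lintegral_step_of_notMem_MS σ h hs
      (measurable_one.indicator (by simpa using hm))]
    -- A probabilistic state has no complete periods, so only `r = 0` carries mass.
    by_cases hr : r = 0
    · subst hr
      have hd : M.digProb δ h.last α s' = M.prob h.last α s' := by
        rw [digProb, if_neg (by tauto)]
      rw [show {y : ℝ≥0 × A × S | 0 ≤ M.ticks δ h.last y.1} = Set.univ by ext; simp,
        measure_univ, one_mul, hd, Finset.sum_eq_single α, Finset.sum_eq_single s']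
      · simp [nextDig, ticks_of_notMem hs]
      · intro b _ hb
        simp [nextDig, ticks_of_notMem hs, hb]
      · simp
      · intro b _ hb
        simp [nextDig, ticks_of_notMem hs, hb]
      · simp
    · simp [ticks_of_notMem hs, hr]

end Scheduler

end Step

/-! ### The digital path of a timed path -/

section DigitalPath

open Preorder

variable {S A : Type*} {ℓ : ℕ} (M : MarkovAutomaton S A ℓ) (δ : ℝ≥0)

/-- The number of complete digitization periods within the `i`-th sojourn. -/
def sojournTicks (ω : ℕ → ℝ≥0 × A × S) (i : ℕ) : ℕ := M.ticks δ (state ω i) (sojournTime ω i)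

/-- The position in a timed path that corresponds to the `n`-th position of its digital path:
`(i, r)` stands for the `i`-th state after `r` complete digitization periods. -/
def cursor (ω : ℕ → ℝ≥0 × A × S) : ℕ → ℕ × ℕ
  | 0 => (0, 0)
  | n + 1 => if (cursor ω n).2 < M.sojournTicks δ ω (cursor ω n).1
      then ((cursor ω n).1, (cursor ω n).2 + 1) else ((cursor ω n).1 + 1, 0)

/-- The digital path of a timed path. -/
def dig (ω : ℕ → ℝ≥0 × A × S) (n : ℕ) : A × S :=
  if (M.cursor δ ω n).2 = 0 then (ω (M.cursor δ ω n).1).2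
  else (M.tau, state ω (M.cursor δ ω n).1)

/-- The position in the digital path at which the `i`-th state of the timed path is entered. -/
def blockStart (ω : ℕ → ℝ≥0 × A × S) (i : ℕ) : ℕ :=
  ∑ l ∈ Finset.range i, (M.sojournTicks δ ω l + 1)

variable {M δ} {ω ω' : ℕ → ℝ≥0 × A × S}

/-- The `i`-th state of the timed path occupies a block of `sojournTicks + 1` digital positions, and
these blocks tile `ℕ`. The converse, that every admissible pair is attained at its position, is
`cursor_blockStart_add`. -/
theorem cursor_spec (n : ℕ) :
    (M.cursor δ ω n).2 ≤ M.sojournTicks δ ω (M.cursor δ ω n).1 ∧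
      M.blockStart δ ω (M.cursor δ ω n).1 + (M.cursor δ ω n).2 = n := by
  induction n with
  | zero => simp [cursor, blockStart]
  | succ n ih =>
    rw [cursor]
    split_ifs with h
    · exact ⟨h, by simp only; omega⟩
    · refine ⟨Nat.zero_le _, ?_⟩
      simp only [blockStart, Finset.sum_range_succ] at ih ⊢
      omega

theorem cursor_blockStart_add (i r : ℕ) (hr : r ≤ M.sojournTicks δ ω i) :
    M.cursor δ ω (M.blockStart δ ω i + r) = (i, r) := by
  induction i generalizing r with
  | zero =>
    induction r with
    | zero => simp [blockStart, cursor]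
    | succ r ih => rw [← add_assoc, cursor, ih (by omega), if_pos (by simp only; omega)]
  | succ i ihi =>
    induction r with
    | zero =>
      have h : M.blockStart δ ω (i + 1) + 0
          = (M.blockStart δ ω i + M.sojournTicks δ ω i) + 1 := by
        simp only [blockStart, Finset.sum_range_succ]; omega
      rw [h, cursor, ihi _ le_rfl, if_neg (lt_irrefl _)]
    | succ r ih => rw [← add_assoc, cursor, ih (by omega), if_pos (by simp only; omega)]

theorem cursor_eq_iff {n i r : ℕ} : M.cursor δ ω n = (i, r) ↔
    M.blockStart δ ω i + r = n ∧ r ≤ M.sojournTicks δ ω i := by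
  constructor
  · intro h
    have := cursor_spec (M := M) (δ := δ) (ω := ω) n
    rw [h] at this
    exact this.symm
  · rintro ⟨rfl, h⟩
    exact cursor_blockStart_add i r h

/-- The sojourn in state `i` is stored at index `i + 1`, outside the common part of the two paths.
Up to the digital position `(i, r)`, all that matters about this sojourn is that it contains at
least `r` complete periods. -/
theorem cursor_congr {i r : ℕ} (h : ∀ l ≤ i, ω' l = ω l) (hr : r ≤ M.sojournTicks δ ω i)
    (hr' : r ≤ M.sojournTicks δ ω' i) (l : ℕ) (hl : l ≤ M.blockStart δ ω i + r) :
    M.cursor δ ω' l = M.cursor δ ω l ∧ (M.cursor δ ω l).1 ≤ i := by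
  induction l with
  | zero => simp [cursor]
  | succ l ih =>
    obtain ⟨h1, h2⟩ := ih (by omega)
    have hspec := cursor_spec (M := M) (δ := δ) (ω := ω) l
    rw [cursor, cursor, h1]
    rcases h2.lt_or_eq with h3 | h3
    · have h4 : M.sojournTicks δ ω' (M.cursor δ ω l).1 = M.sojournTicks δ ω (M.cursor δ ω l).1 := by
        simp only [sojournTicks, state, sojournTime]
        rw [h _ h3.le, h _ h3]
      rw [h4]
      refine ⟨rfl, ?_⟩
      split_ifs
      · exact h2
      · exact h3
    · have hlt : (M.cursor δ ω l).2 < r := by rw [h3] at hspec; omega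
      rw [h3, if_pos (by omega), if_pos (by omega)]
      exact ⟨rfl, le_rfl⟩

theorem dig_congr {i r : ℕ} (h : ∀ l ≤ i, ω' l = ω l) (hr : r ≤ M.sojournTicks δ ω i)
    (hr' : r ≤ M.sojournTicks δ ω' i) (l : ℕ) (hl : l ≤ M.blockStart δ ω i + r) :
    M.dig δ ω' l = M.dig δ ω l := by
  obtain ⟨h1, h2⟩ := cursor_congr h hr hr' l hl
  rw [dig, dig, h1, state, state, h _ h2]

theorem dig_snd (n : ℕ) : (M.dig δ ω n).2 = state ω (M.cursor δ ω n).1 := by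
  rw [dig]
  split_ifs <;> rfl

theorem dig_succ (n : ℕ) : M.dig δ ω (n + 1) =
    M.nextDig δ (state ω (M.cursor δ ω n).1) (M.cursor δ ω n).2
      (ω ((M.cursor δ ω n).1 + 1)) := by
  rw [dig, cursor, nextDig]
  by_cases h : (M.cursor δ ω n).2 < M.sojournTicks δ ω (M.cursor δ ω n).1
  · rw [if_pos h, if_pos (show _ < M.ticks δ _ (ω (_ + 1)).1 from h)]
    simp
  · rw [if_neg h, if_neg (show ¬ _ < M.ticks δ _ (ω (_ + 1)).1 from h)]
    simp

variable (M δ) in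
/-- Extension of a finite timed path to an infinite one, with a sojourn of `r` digitization
periods in its last state. -/
def extend (r : ℕ) {i : ℕ} (x : Hist S A i) (l : ℕ) : ℝ≥0 × A × S :=
  if h : l ≤ i then x ⟨l, Finset.mem_Iic.2 h⟩ else (r * δ, M.tau, M.init)

theorem extend_frestrictLe (r i : ℕ) {l : ℕ} (hl : l ≤ i) :
    M.extend δ r (frestrictLe (π := fun _ => ℝ≥0 × A × S) i ω) l = ω l := by
  rw [extend, dif_pos hl]
  rfl

theorem state_extend (r : ℕ) {i : ℕ} (x : Hist S A i) :
    state (M.extend δ r x) i = x.last := by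
  rw [state, extend, dif_pos le_rfl]
  rfl

theorem le_sojournTicks_extend (hδ : 0 < δ) {i r : ℕ} (hr : r ≤ M.sojournTicks δ ω i) :
    r ≤ M.sojournTicks δ
      (M.extend δ r (frestrictLe (π := fun _ => ℝ≥0 × A × S) i ω)) i := by
  have h1 : state (M.extend δ r (frestrictLe (π := fun _ => ℝ≥0 × A × S) i ω)) i = state ω i := by
    rw [state, extend_frestrictLe r i le_rfl]
    rfl
  rw [sojournTicks] at hr
  rw [sojournTicks, h1]
  by_cases hs : state ω i ∈ M.MS
  -- The sojourn in state `i` is the appended entry with index `i + 1`, which equals `r * δ`.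
  · rw [le_ticks_iff hδ hs, sojournTime, extend, dif_neg (by omega)]
  · rw [ticks_of_notMem hs] at hr
    omega

variable (M δ) in
/-- Timed paths of length `i` which, followed by `r` digitization periods in the last state,
correspond to the digital path `h` of length `n`. -/
def fiber {n : ℕ} (h : MDP.Hist S A n) (i r : ℕ) : Set (Hist S A i) :=
  {x | M.cursor δ (M.extend δ r x) n = (i, r) ∧
    frestrictLe (π := fun _ => A × S) n (M.dig δ (M.extend δ r x)) = h}

/-- This separates the event into a condition on the timed history up to state `i` and one on the
next sojourn, which is the form needed for conditioning on the history. The actual sojourn may be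
replaced by one of length `r * δ` because of `cursor_congr`. -/
theorem cursor_and_dig_iff (hδ : 0 < δ) {n : ℕ} (h : MDP.Hist S A n) (i r : ℕ) :
    M.cursor δ ω n = (i, r) ∧ frestrictLe (π := fun _ => A × S) n (M.dig δ ω) = h ↔
      frestrictLe (π := fun _ => ℝ≥0 × A × S) i ω ∈ M.fiber δ h i r ∧
        r ≤ M.sojournTicks δ ω i := by
  by_cases hr : r ≤ M.sojournTicks δ ω i
  · have hagree : ∀ l ≤ i, ω l =
        M.extend δ r (frestrictLe (π := fun _ => ℝ≥0 × A × S) i ω) l :=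
      fun l hl => (extend_frestrictLe r i hl).symm
    have hr' := le_sojournTicks_extend hδ hr
    have hc : M.cursor δ (M.extend δ r (frestrictLe (π := fun _ => ℝ≥0 × A × S) i ω)) n = (i, r) ↔
        M.cursor δ ω n = (i, r) := by
      constructor
      · intro hc
        rw [(cursor_congr hagree hr' hr n (cursor_eq_iff.1 hc).1.ge).1, hc]
      · intro hc
        rw [(cursor_congr (fun l hl => (hagree l hl).symm) hr hr' n (cursor_eq_iff.1 hc).1.ge).1,
          hc]
    simp only [fiber, Set.mem_ofPred_eq, hr, and_true, hc]
    refine and_congr_right fun hn => ?_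
    have hd : frestrictLe (π := fun _ => A × S) n
        (M.dig δ (M.extend δ r (frestrictLe (π := fun _ => ℝ≥0 × A × S) i ω)))
        = frestrictLe (π := fun _ => A × S) n (M.dig δ ω) := by
      funext l
      exact dig_congr (fun l hl => (hagree l hl).symm) hr hr' l.1
        ((Finset.mem_Iic.1 l.2).trans (cursor_eq_iff.1 hn).1.ge)
    rw [hd]
  · simp only [hr, and_false, iff_false]
    exact fun hc => hr (cursor_eq_iff.1 hc.1).2

theorem last_of_mem_fiber {n : ℕ} {h : MDP.Hist S A n} {i r : ℕ} {x : Hist S A i}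
    (hx : x ∈ M.fiber δ h i r) : x.last = MDP.Hist.last h := by
  obtain ⟨h1, rfl⟩ := hx
  have h2 := dig_snd (M := M) (δ := δ) (ω := M.extend δ r x) n
  rw [h1, state_extend] at h2
  exact h2.symm

variable [MeasurableSpace S] [DiscreteMeasurableSpace S] [MeasurableSpace A]
  [DiscreteMeasurableSpace A] [Countable S] [Countable A]

theorem measurable_state (i : ℕ) : Measurable fun ω : ℕ → ℝ≥0 × A × S => state ω i := by
  unfold state; fun_prop

theorem measurable_sojournTime (i : ℕ) :
    Measurable fun ω : ℕ → ℝ≥0 × A × S => sojournTime ω i := by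
  unfold sojournTime; fun_prop

theorem measurable_sojournTicks (i : ℕ) :
    Measurable fun ω : ℕ → ℝ≥0 × A × S => M.sojournTicks δ ω i := by
  have h : Measurable fun p : S × ℝ≥0 => M.ticks δ p.1 p.2 :=
    measurable_from_prod_countable_right fun s => measurable_ticks s
  exact h.comp ((measurable_state i).prodMk (measurable_sojournTime i))

theorem measurable_cursor (n : ℕ) :
    Measurable fun ω : ℕ → ℝ≥0 × A × S => M.cursor δ ω n := by
  induction n with
  | zero => exact measurable_const
  | succ n ih =>
    have h : Measurable fun ω : ℕ → ℝ≥0 × A × S => M.sojournTicks δ ω (M.cursor δ ω n).1 := by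
      have h1 : Measurable fun p : ℕ × (ℕ → ℝ≥0 × A × S) => M.sojournTicks δ p.2 p.1 :=
        measurable_from_prod_countable_right fun i => measurable_sojournTicks i
      exact h1.comp (ih.fst.prodMk measurable_id)
    exact Measurable.ite (measurableSet_lt ih.snd h)
      (ih.fst.prodMk (ih.snd.add_const 1)) ((ih.fst.add_const 1).prodMk measurable_const)

theorem measurable_dig : Measurable fun ω : ℕ → ℝ≥0 × A × S => M.dig δ ω := by
  refine measurable_pi_lambda _ fun n => ?_
  have h : Measurable fun p : (ℕ × ℕ) × (ℕ → ℝ≥0 × A × S) =>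
      if p.1.2 = 0 then (p.2 p.1.1).2 else (M.tau, state p.2 p.1.1) := by
    refine measurable_from_prod_countable_right fun c => ?_
    by_cases hc : c.2 = 0
    · simp only [hc, if_true]; fun_prop
    · simp only [hc, if_false]
      exact measurable_const.prodMk (measurable_state _)
  exact h.comp ((measurable_cursor n).prodMk measurable_id)

theorem measurable_extend (r i : ℕ) :
    Measurable fun x : Hist S A i => M.extend δ r x := by
  refine measurable_pi_lambda _ fun l => ?_
  by_cases h : l ≤ i
  · simp only [extend, h, dif_pos]; fun_prop
  · simp only [extend, h, dif_neg, not_false_eq_true]; fun_prop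

theorem measurableSet_fiber {n : ℕ} (h : MDP.Hist S A n) (i r : ℕ) :
    MeasurableSet (M.fiber δ h i r) := by
  have h1 := (measurable_cursor (M := M) (δ := δ) n).comp (measurable_extend (M := M) (δ := δ) r i)
  have h2 := (measurable_frestrictLe (X := fun _ => A × S) n).comp
    ((measurable_dig (M := M) (δ := δ)).comp (measurable_extend (M := M) (δ := δ) r i))
  exact (h1 (measurableSet_singleton (i, r))).inter (h2 (measurableSet_singleton h))

end DigitalPath

/-! ### From timed schedulers to digital schedulers -/

section Coupling

open Preorder

variable {S A : Type*} {ℓ : ℕ} {M : MarkovAutomaton S A ℓ} {δ : ℝ≥0} [Fintype S] [Fintype A]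
  [MeasurableSpace S] [DiscreteMeasurableSpace S] [MeasurableSpace A] [DiscreteMeasurableSpace A]

instance (σ : M.Scheduler) : IsProbabilityMeasure σ.pathMeasure := by
  unfold Scheduler.pathMeasure; infer_instance

theorem Scheduler.lintegral_succ (σ : M.Scheduler) (n : ℕ)
    {f : Hist S A n → ℝ≥0 × A × S → ℝ≥0∞} (hf : Measurable (Function.uncurry f)) :
    ∫⁻ ω, f (frestrictLe (π := fun _ => ℝ≥0 × A × S) n ω) (ω (n + 1)) ∂σ.pathMeasure
      = ∫⁻ ω, ∫⁻ y, f (frestrictLe (π := fun _ => ℝ≥0 × A × S) n ω) y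
        ∂(σ.step n (frestrictLe (π := fun _ => ℝ≥0 × A × S) n ω)) ∂σ.pathMeasure :=
  lintegral_traj_succ _ n hf

theorem Scheduler.ae_zero (σ : M.Scheduler) :
    ∀ᵐ ω ∂σ.pathMeasure, frestrictLe (π := fun _ => ℝ≥0 × A × S) 0 ω
      = fun _ => (0, M.tau, M.init) := by
  have hm : Measurable (frestrictLe (π := fun _ : ℕ => ℝ≥0 × A × S) 0) := by fun_prop
  have h := Kernel.traj_map_frestrictLe_apply (X := fun _ => ℝ≥0 × A × S) (κ := σ.stepKernel) 0 0
    (fun _ => (0, M.tau, M.init))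
  rw [Kernel.partialTraj_self, Kernel.id_apply] at h
  refine ae_of_ae_map (p := fun x => x = fun _ => (0, M.tau, M.init)) hm.aemeasurable ?_
  rw [Scheduler.pathMeasure, h]
  exact (ae_dirac_iff (p := fun x => x = fun _ => (0, M.tau, M.init))
    (measurableSet_singleton (fun _ => (0, M.tau, M.init)))).2 rfl

theorem mem_enabled_iff {s : S} {α : A} : α ∈ M.enabled s ↔ (M.succ s α).isSome := by
  refine ⟨isSome_succ_of_mem_enabled, fun h => ?_⟩
  by_contra hn
  have h1 : ∑ s', M.prob s α s' = 1 := by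
    rw [M.sum_prob, if_pos h]
  have h2 : ∀ s', M.prob s α s' = 0 := fun s' =>
    le_antisymm (not_lt.1 fun h' => hn ⟨s', h'⟩) (M.prob_nonneg _ _ _)
  simp [h2] at h1

theorem mem_enabled_digitization_iff {s : S} {α : A} :
    α ∈ (M.digitization δ).enabled s ↔ α ∈ M.enabled s := by
  rw [mem_enabled_iff]
  constructor
  · intro h
    have h1 : ∑ s', M.digProb δ s α s' = 1 := (M.digitization δ).sum_prob_of_enabled h
    rw [M.sum_digProb] at h1
    by_contra hn
    simp [hn] at h1
  · intro h
    have h1 := M.sum_digProb δ s α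
    rw [if_pos h] at h1
    by_contra hn
    have h2 : ∀ s', M.digProb δ s α s' = 0 := fun s' =>
      le_antisymm (not_lt.1 fun h' => hn ⟨s', h'⟩) (M.digProb_nonneg _ _ _ _)
    simp [h2] at h1

theorem digScheduler_choice_of_mem_MS (σ : (M.digitization δ).Scheduler) {n : ℕ}
    (h : MDP.Hist S A n) (hs : MDP.Hist.last h ∈ M.MS) : σ.choice n h = PMF.pure M.tau := by
  have h0 : ∀ α, α ≠ M.tau → σ.choice n h α = 0 := by
    intro α hα
    by_contra hne
    exact hα (eq_tau_of_mem_MS hs (isSome_succ_of_mem_enabled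
      (mem_enabled_digitization_iff.1 (σ.choice_enabled n h α hne))))
  classical
  ext α
  rw [PMF.pure_apply]
  split_ifs with hα
  · subst hα
    have := (σ.choice n h).tsum_coe
    rwa [tsum_eq_single M.tau h0] at this
  · exact h0 α hα

namespace Scheduler

variable (σ : M.Scheduler)

/-- Conditioning on the timed history up to state `i`: the fiber is determined by this history,
while the tick condition and the next digital step depend only on its last state and on the next
timed step. -/
theorem measure_cursor_dig (hδ : 0 < δ) {n : ℕ} (h : MDP.Hist S A n) (i r : ℕ)
    (Q : Set (A × S)) :
    σ.pathMeasure {ω | M.cursor δ ω n = (i, r) ∧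
        frestrictLe (π := fun _ => A × S) n (M.dig δ ω) = h ∧ M.dig δ ω (n + 1) ∈ Q}
      = ∫⁻ ω, (M.fiber δ h i r).indicator (fun x => σ.step i x
          {y | r ≤ M.ticks δ x.last y.1 ∧ M.nextDig δ x.last r y ∈ Q})
            (frestrictLe (π := fun _ => ℝ≥0 × A × S) i ω) ∂σ.pathMeasure := by
  have hset : MeasurableSet {p : Hist S A i × (ℝ≥0 × A × S) | p.1 ∈ M.fiber δ h i r ∧
      r ≤ M.ticks δ p.1.last p.2.1 ∧ M.nextDig δ p.1.last r p.2 ∈ Q} := by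
    have h1 : MeasurableSet {p : S × (ℝ≥0 × A × S) |
        r ≤ M.ticks δ p.1 p.2.1 ∧ M.nextDig δ p.1 r p.2 ∈ Q} := by
      have h2 : Measurable fun p : S × (ℝ≥0 × A × S) =>
          r ≤ M.ticks δ p.1 p.2.1 ∧ M.nextDig δ p.1 r p.2 ∈ Q :=
        measurable_from_prod_countable_right fun s => (measurableSet_nextDig s r Q).mem
      exact measurableSet_setOfPred.2 h2
    have h3 : Measurable fun p : Hist S A i × (ℝ≥0 × A × S) => (p.1.last, p.2) :=
      (Hist.measurable_last.comp measurable_fst).prodMk measurable_snd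
    exact (measurable_fst (measurableSet_fiber h i r)).inter (h3 h1)
  have hm : MeasurableSet {ω : ℕ → ℝ≥0 × A × S |
      frestrictLe (π := fun _ => ℝ≥0 × A × S) i ω ∈ M.fiber δ h i r ∧
      r ≤ M.ticks δ (state ω i) (ω (i + 1)).1 ∧ M.nextDig δ (state ω i) r (ω (i + 1)) ∈ Q} :=
    (show Measurable fun ω : ℕ → ℝ≥0 × A × S =>
      (frestrictLe (π := fun _ => ℝ≥0 × A × S) i ω, ω (i + 1)) by fun_prop) hset
  have hS : {ω | M.cursor δ ω n = (i, r) ∧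
        frestrictLe (π := fun _ => A × S) n (M.dig δ ω) = h ∧ M.dig δ ω (n + 1) ∈ Q}
      = {ω : ℕ → ℝ≥0 × A × S |
      frestrictLe (π := fun _ => ℝ≥0 × A × S) i ω ∈ M.fiber δ h i r ∧
      r ≤ M.ticks δ (state ω i) (ω (i + 1)).1 ∧ M.nextDig δ (state ω i) r (ω (i + 1)) ∈ Q} := by
    ext ω
    have h1 := cursor_and_dig_iff (M := M) (ω := ω) hδ h i r
    simp only [Set.mem_ofPred_eq]
    rw [← and_assoc, h1, and_assoc]
    refine and_congr_right fun hf => and_congr_right fun hr => ?_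
    rw [dig_succ, (h1.2 ⟨hf, hr⟩).1]
  rw [hS, ← lintegral_indicator_one hm]
  have := σ.lintegral_succ i (f := fun x y => {p : Hist S A i × (ℝ≥0 × A × S) |
    p.1 ∈ M.fiber δ h i r ∧ r ≤ M.ticks δ p.1.last p.2.1 ∧
      M.nextDig δ p.1.last r p.2 ∈ Q}.indicator 1 (x, y)) (measurable_one.indicator hset)
  refine Eq.trans this (lintegral_congr fun ω => ?_)
  by_cases hx : frestrictLe (π := fun _ => ℝ≥0 × A × S) i ω ∈ M.fiber δ h i r
  · rw [Set.indicator_of_mem hx, ← lintegral_indicator_one (measurableSet_nextDig _ r Q)]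
    refine lintegral_congr fun y => ?_
    by_cases hy : r ≤ M.ticks δ (Hist.last (frestrictLe (π := fun _ => ℝ≥0 × A × S) i ω)) y.1 ∧
        M.nextDig δ (Hist.last (frestrictLe (π := fun _ => ℝ≥0 × A × S) i ω)) r y ∈ Q
    · rw [Set.indicator_of_mem, Set.indicator_of_mem]
      · rfl
      · exact hy
      · exact ⟨hx, hy⟩
    · rw [Set.indicator_of_notMem, Set.indicator_of_notMem]
      · exact hy
      · exact fun h => hy h.2
  · rw [Set.indicator_of_notMem hx]
    exact (lintegral_congr fun y => Set.indicator_of_notMem (fun hm => hx hm.1) _).trans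
      lintegral_zero

variable (δ) in
/-- The probability that the digital path starts with `h` and that `σ` then selects `α` at the
current position of the timed path. -/
def digWeight {n : ℕ} (h : MDP.Hist S A n) (α : A) : ℝ≥0∞ :=
  ∑' c : ℕ × ℕ, ∫⁻ ω, (M.fiber δ h c.1 c.2).indicator (fun x => σ.step c.1 x
    {y | c.2 ≤ M.ticks δ x.last y.1} * σ.choice c.1 x α)
      (frestrictLe (π := fun _ => ℝ≥0 × A × S) c.1 ω) ∂σ.pathMeasure

theorem measure_eq_tsum_cursor (n : ℕ) {B : Set (ℕ → ℝ≥0 × A × S)} (hB : MeasurableSet B) :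
    σ.pathMeasure B = ∑' c : ℕ × ℕ, σ.pathMeasure {ω | M.cursor δ ω n = c ∧ ω ∈ B} := by
  have hU : B = ⋃ c : ℕ × ℕ, {ω | M.cursor δ ω n = c ∧ ω ∈ B} := by
    ext ω; simp
  conv_lhs => rw [hU]
  refine measure_iUnion (fun c c' hc => ?_) fun c =>
    (measurable_cursor n (measurableSet_singleton c)).inter hB
  refine Set.disjoint_left.2 fun ω h1 h2 => hc ?_
  exact h1.1.symm.trans h2.1

theorem measurableSet_digHist {n : ℕ} (h : MDP.Hist S A n) :
    MeasurableSet {ω : ℕ → ℝ≥0 × A × S | frestrictLe (π := fun _ => A × S) n (M.dig δ ω) = h} :=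
  ((measurable_frestrictLe (X := fun _ => A × S) n).comp measurable_dig)
    (measurableSet_singleton h)

/-- All timed histories in the fibers of `h` end in the last state of `h`, and the digital
transition probability does not depend on `r`. It is therefore a common factor of the sum over all
cursor positions. -/
theorem measure_dig_succ (hδ : 0 < δ) {n : ℕ} (h : MDP.Hist S A n) (α : A) (s' : S) :
    σ.pathMeasure {ω | frestrictLe (π := fun _ => A × S) n (M.dig δ ω) = h ∧
        M.dig δ ω (n + 1) = (α, s')}
      = σ.digWeight δ h α * ENNReal.ofReal (M.digProb δ (MDP.Hist.last h) α s') := by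
  have hm : MeasurableSet {ω : ℕ → ℝ≥0 × A × S |
      frestrictLe (π := fun _ => A × S) n (M.dig δ ω) = h ∧ M.dig δ ω (n + 1) = (α, s')} :=
    (measurableSet_digHist h).inter
      (((measurable_pi_apply (n + 1)).comp measurable_dig) (measurableSet_singleton (α, s')))
  rw [measure_eq_tsum_cursor (δ := δ) σ n hm, digWeight, ← ENNReal.tsum_mul_right]
  refine tsum_congr fun ⟨i, r⟩ => ?_
  have h1 := measure_cursor_dig σ hδ h i r {(α, s')}
  simp only [Set.mem_singleton_iff] at h1
  simp only [Set.mem_ofPred_eq]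
  rw [h1, ← lintegral_mul_const' _ _ ENNReal.ofReal_ne_top]
  refine lintegral_congr fun ω => ?_
  by_cases hx : frestrictLe (π := fun _ => ℝ≥0 × A × S) i ω ∈ M.fiber δ h i r
  · rw [Set.indicator_of_mem hx, Set.indicator_of_mem hx, step_nextDig σ _ hδ,
      last_of_mem_fiber hx, mul_assoc]
  · rw [Set.indicator_of_notMem hx, Set.indicator_of_notMem hx, zero_mul]

theorem measure_digHist (hδ : 0 < δ) {n : ℕ} (h : MDP.Hist S A n) :
    σ.pathMeasure {ω | frestrictLe (π := fun _ => A × S) n (M.dig δ ω) = h}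
      = ∑' c : ℕ × ℕ, ∫⁻ ω, (M.fiber δ h c.1 c.2).indicator (fun x => σ.step c.1 x
        {y | c.2 ≤ M.ticks δ x.last y.1})
          (frestrictLe (π := fun _ => ℝ≥0 × A × S) c.1 ω) ∂σ.pathMeasure := by
  rw [measure_eq_tsum_cursor (δ := δ) σ n (measurableSet_digHist h)]
  refine tsum_congr fun ⟨i, r⟩ => ?_
  have h1 := measure_cursor_dig σ hδ h i r Set.univ
  simp only [Set.mem_univ, and_true] at h1
  exact h1

theorem sum_digWeight (hδ : 0 < δ) {n : ℕ} (h : MDP.Hist S A n) :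
    ∑ α, σ.digWeight δ h α
      = σ.pathMeasure {ω | frestrictLe (π := fun _ => A × S) n (M.dig δ ω) = h} := by
  rw [measure_digHist σ hδ]
  simp only [digWeight]
  rw [← Summable.tsum_finsetSum fun _ _ => ENNReal.summable]
  refine tsum_congr fun ⟨i, r⟩ => ?_
  have hms : ∀ α, Measurable fun ω => (M.fiber δ h i r).indicator (fun x => σ.step i x
      {y | r ≤ M.ticks δ x.last y.1} * σ.choice i x α)
        (frestrictLe (π := fun _ => ℝ≥0 × A × S) i ω) := by
    intro α
    refine Measurable.comp (g := (M.fiber δ h i r).indicator (fun x => σ.step i x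
      {y | r ≤ M.ticks δ x.last y.1} * σ.choice i x α)) ?_
      (measurable_frestrictLe (X := fun _ => ℝ≥0 × A × S) i)
    -- On the fiber the last state is constant, so the set becomes independent of `x` and kernel
    -- measurability applies.
    have heq : (M.fiber δ h i r).indicator (fun x => σ.step i x
      {y | r ≤ M.ticks δ x.last y.1} * σ.choice i x α) = (M.fiber δ h i r).indicator
        (fun x => σ.stepKernel i x {y | r ≤ M.ticks δ (MDP.Hist.last h) y.1} * σ.choice i x α) := by
      refine Set.indicator_congr fun x hx => ?_
      rw [last_of_mem_fiber hx]
      rfl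
    rw [heq]
    refine Measurable.indicator (Measurable.mul ?_ (σ.measurable_choice i α))
      (measurableSet_fiber h i r)
    exact Kernel.measurable_coe _ (measurableSet_le measurable_const
      ((measurable_ticks _).comp measurable_fst))
  rw [← lintegral_finsetSum _ fun α _ => hms α]
  refine lintegral_congr fun ω => ?_
  by_cases hx : frestrictLe (π := fun _ => ℝ≥0 × A × S) i ω ∈ M.fiber δ h i r
  · simp only [Set.indicator_of_mem hx, ← Finset.mul_sum, sum_choice, mul_one]
  · simp [Set.indicator_of_notMem hx]

theorem mem_enabled_of_digWeight_ne_zero {n : ℕ} {h : MDP.Hist S A n} {α : A}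
    (hα : σ.digWeight δ h α ≠ 0) : α ∈ M.enabled (MDP.Hist.last h) := by
  by_contra hn
  refine hα ?_
  rw [digWeight, ENNReal.tsum_eq_zero]
  intro c
  rw [lintegral_congr (g := fun _ => 0), lintegral_zero]
  intro ω
  by_cases hx : frestrictLe (π := fun _ => ℝ≥0 × A × S) c.1 ω ∈ M.fiber δ h c.1 c.2
  · rw [Set.indicator_of_mem hx, mul_eq_zero]
    right
    by_contra hne
    exact hn (last_of_mem_fiber hx ▸ σ.choice_enabled _ _ α hne)
  · exact Set.indicator_of_notMem hx _

/-- A scheduler of the automaton and a scheduler of its digitization are compatible if the latter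
selects actions with the conditional probabilities, given the digital history, that are induced by
the former. -/
def Compatible (σ' : (M.digitization δ).Scheduler) : Prop :=
  ∀ (n : ℕ) (h : MDP.Hist S A n) (α : A), σ.digWeight δ h α
    = σ.pathMeasure {ω | frestrictLe (π := fun _ => A × S) n (M.dig δ ω) = h} * σ'.choice n h α

theorem digStep_singleton (σ' : (M.digitization δ).Scheduler) {n : ℕ} (h : MDP.Hist S A n)
    (α : A) (s' : S) : σ'.step n h {(α, s')}
      = σ'.choice n h α * ENNReal.ofReal (M.digProb δ (MDP.Hist.last h) α s') := by
  classical
  simp only [MDP.Scheduler.step, Measure.coe_finsetSum, Finset.sum_apply, Measure.smul_apply,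
    smul_eq_mul, Measure.dirac_apply, digitization]
  rw [Finset.sum_eq_single α, Finset.sum_eq_single s']
  · simp
  · intro b _ hb; simp [hb]
  · simp
  · intro b _ hb; simp [hb]
  · simp

/-- The digital path of a random timed path is distributed as a random path of the
digitization, under compatible schedulers. -/
theorem Compatible.map_dig (hδ : 0 < δ) {σ : M.Scheduler} {σ' : (M.digitization δ).Scheduler}
    (hc : σ.Compatible σ') : σ.pathMeasure.map (M.dig δ) = σ'.pathMeasure := by
  have : IsProbabilityMeasure (σ.pathMeasure.map (M.dig δ)) :=
    Measure.isProbabilityMeasure_map measurable_dig.aemeasurable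
  refine eq_traj_of_transition _ _ ?_ ?_
  · refine (ae_map_iff measurable_dig.aemeasurable
      ((measurable_frestrictLe (X := fun _ => A × S) 0) (measurableSet_singleton
        fun _ => ((M.digitization δ).tau, (M.digitization δ).init)))).2 ?_
    filter_upwards [σ.ae_zero] with ω hω
    funext ⟨l, hl⟩
    have hl0 : l = 0 := by simpa using hl
    subst hl0
    have h0 := congrFun hω ⟨0, hl⟩
    simp only [frestrictLe_apply] at h0 ⊢
    simp [dig, cursor, h0, digitization]
  · intro n h ⟨α, s'⟩
    rw [Measure.map_apply measurable_dig, Measure.map_apply measurable_dig]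
    · refine (measure_dig_succ σ hδ h α s').trans ?_
      rw [hc, mul_assoc, ← digStep_singleton]
      rfl
    · exact (measurable_frestrictLe (X := fun _ => A × S) n) (measurableSet_singleton h)
    · exact ((measurable_frestrictLe (X := fun _ => A × S) n) (measurableSet_singleton h)).inter
        (show MeasurableSet ((fun ω : ℕ → A × S => ω (n + 1)) ⁻¹' {(α, s')}) from
          (measurable_pi_apply (n + 1)) (measurableSet_singleton (α, s')))

/-- The digital scheduler plays `α` with the conditional probability `digWeight / p`, where `p` is
the probability of the digital history. These quotients sum to one by `sum_digWeight`. -/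
theorem exists_compatible_digScheduler (hδ : 0 < δ) :
    ∃ σ' : (M.digitization δ).Scheduler, σ.Compatible σ' := by
  classical
  let p : (n : ℕ) → (h : MDP.Hist S A n) → ℝ≥0∞ := fun n h =>
    σ.pathMeasure {ω | frestrictLe (π := fun _ => A × S) n (M.dig δ ω) = h}
  have hp : ∀ n h, p n h ≠ ⊤ := fun n h => measure_ne_top _ _
  let c : (n : ℕ) → (h : MDP.Hist S A n) → PMF A := fun n h =>
    -- On null histories any enabled action will do, because both sides of the compatibility
    -- equation vanish.
    if h0 : p n h = 0 then PMF.pure (M.exists_mem_enabled (MDP.Hist.last h)).choose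
    else PMF.ofFintype (fun α => σ.digWeight δ h α / p n h) (by
      simp only [div_eq_mul_inv]
      rw [← Finset.sum_mul, sum_digWeight σ hδ]
      exact ENNReal.mul_inv_cancel h0 (hp n h))
  refine ⟨⟨c, fun n h α hne => mem_enabled_digitization_iff.2 ?_⟩, fun n h α => ?_⟩
  · by_cases h0 : p n h = 0
    · simp only [c, dif_pos h0, PMF.pure_apply] at hne
      have hα : α = (M.exists_mem_enabled (MDP.Hist.last h)).choose := by
        by_contra h'; simp [h'] at hne
      rw [hα]
      exact (M.exists_mem_enabled (MDP.Hist.last h)).choose_spec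
    · simp only [c, dif_neg h0, PMF.ofFintype_apply] at hne
      refine mem_enabled_of_digWeight_ne_zero σ (δ := δ) fun hw => hne ?_
      rw [hw, ENNReal.zero_div]
  · change _ = p n h * c n h α
    by_cases h0 : p n h = 0
    · rw [h0, zero_mul]
      have h1 := sum_digWeight σ hδ h
      rw [show σ.pathMeasure _ = 0 from h0, Finset.sum_eq_zero_iff] at h1
      exact h1 α (Finset.mem_univ α)
    · simp only [c, dif_neg h0, PMF.ofFintype_apply]
      exact (ENNReal.mul_div_cancel h0 (hp n h)).symm

end Scheduler

end Coupling

/-! ### From digital schedulers to timed schedulers -/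

section Lift

open Preorder

variable {S A : Type*} {ℓ : ℕ} {M : MarkovAutomaton S A ℓ} {δ : ℝ≥0} [Fintype S] [Fintype A]
  [MeasurableSpace S] [DiscreteMeasurableSpace S] [MeasurableSpace A] [DiscreteMeasurableSpace A]

variable (δ) in
/-- The digital history of a timed history, on entering the last state. -/
def digHist {i : ℕ} (x : Hist S A i) : MDP.Hist S A (M.blockStart δ (M.extend δ 0 x) i) :=
  frestrictLe (π := fun _ => A × S) _ (M.dig δ (M.extend δ 0 x))

theorem last_digHist {i : ℕ} (x : Hist S A i) :
    MDP.Hist.last (M.digHist δ x) = x.last := by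
  have h1 := dig_snd (M := M) (δ := δ) (ω := M.extend δ 0 x) (M.blockStart δ (M.extend δ 0 x) i)
  rw [← add_zero (M.blockStart δ (M.extend δ 0 x) i), cursor_blockStart_add i 0 (Nat.zero_le _),
    state_extend, add_zero] at h1
  exact h1

theorem measurable_blockStart (i : ℕ) :
    Measurable fun ω : ℕ → ℝ≥0 × A × S => M.blockStart δ ω i :=
  Finset.measurable_sum _ fun l _ => (measurable_sojournTicks l).add_const 1

/-- The scheduler that acts on timed histories as `σ'` acts on their digital histories. -/
def liftScheduler (σ' : (M.digitization δ).Scheduler) : M.Scheduler where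
  choice i x := σ'.choice _ (M.digHist δ x)
  measurable_choice i α := by
    -- The length of the digital history depends on the timed history. Treating it as a separate
    -- coordinate in `ℕ` leaves one measurable function for each fixed length.
    have h : Measurable fun p : ℕ × (ℕ → A × S) =>
        σ'.choice p.1 (frestrictLe (π := fun _ => A × S) p.1 p.2) α :=
      measurable_from_prod_countable_right fun n =>
        (measurable_of_countable fun h => σ'.choice n h α).comp
          (measurable_frestrictLe (X := fun _ => A × S) n)
    have h2 : Measurable fun x : Hist S A i => M.extend δ 0 x := measurable_extend 0 i
    exact h.comp (((measurable_blockStart i).comp h2).prodMk (measurable_dig.comp h2))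
  choice_enabled i x α hα := by
    rw [← last_digHist (M := M) (δ := δ) x, ← mem_enabled_digitization_iff (δ := δ)]
    exact σ'.choice_enabled _ _ α hα

/-- The lifted scheduler reads the digital history on entry into the last state, whereas `h` may
contain `r` further periods. In a Markovian state there is no choice to make, and in a probabilistic
state `r = 0`, so the two histories coincide. -/
theorem liftScheduler_choice_of_mem_fiber (σ' : (M.digitization δ).Scheduler) {n : ℕ}
    {h : MDP.Hist S A n} {i r : ℕ} {x : Hist S A i} (hx : x ∈ M.fiber δ h i r) :
    (liftScheduler σ').choice i x = σ'.choice n h := by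
  by_cases hs : x.last ∈ M.MS
  · rw [Scheduler.choice_of_mem_MS _ _ hs,
      digScheduler_choice_of_mem_MS σ' h (last_of_mem_fiber hx ▸ hs)]
  · obtain ⟨h1, h2⟩ := hx
    obtain ⟨h3, h4⟩ := cursor_eq_iff.1 h1
    rw [sojournTicks, state_extend, ticks_of_notMem hs, Nat.le_zero] at h4
    subst h4
    rw [add_zero] at h3
    subst h3 h2
    rfl

/-- The lifted choice is constant on the fibers of `h`, so it factors out of every integral in
`digWeight`. -/
theorem compatible_liftScheduler (hδ : 0 < δ) (σ' : (M.digitization δ).Scheduler) :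
    (liftScheduler σ').Compatible σ' := by
  intro n h α
  rw [Scheduler.measure_digHist _ hδ, Scheduler.digWeight, ← ENNReal.tsum_mul_right]
  refine tsum_congr fun c => ?_
  rw [← lintegral_mul_const' _ _ (PMF.apply_ne_top _ _)]
  refine lintegral_congr fun ω => ?_
  by_cases hx : frestrictLe (π := fun _ => ℝ≥0 × A × S) c.1 ω ∈ M.fiber δ h c.1 c.2
  · rw [Set.indicator_of_mem hx, Set.indicator_of_mem hx,
      liftScheduler_choice_of_mem_fiber σ' hx]
  · rw [Set.indicator_of_notMem hx, Set.indicator_of_notMem hx, zero_mul]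

end Lift

/-! ### Expected rewards agree exactly -/

section Reward

open Preorder

variable {S A : Type*} {ℓ : ℕ} {M : MarkovAutomaton S A ℓ} {δ : ℝ≥0}

theorem cursor_injective (ω : ℕ → ℝ≥0 × A × S) : Function.Injective (M.cursor δ ω) := by
  intro n n' h
  rw [← (cursor_spec (M := M) (δ := δ) (ω := ω) n).2, h]
  exact (cursor_spec n').2

theorem monotone_cursor_fst (ω : ℕ → ℝ≥0 × A × S) : Monotone fun n => (M.cursor δ ω n).1 := by
  refine monotone_nat_of_le_succ fun n => ?_
  simp only [cursor]
  split_ifs <;> simp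

theorem monotone_blockStart (ω : ℕ → ℝ≥0 × A × S) : Monotone (M.blockStart δ ω) := by
  refine monotone_nat_of_le_succ fun n => ?_
  simp only [blockStart, Finset.sum_range_succ]
  omega

/-- Both paths pass through the same states in the same order, up to repetitions within a block, so
rewards are cut off at corresponding positions. -/
theorem forall_dig_notMem_iff (ω : ℕ → ℝ≥0 × A × S) (G : Set S) (n : ℕ) :
    (∀ k ≤ n, (M.dig δ ω k).2 ∉ G) ↔ ∀ l ≤ (M.cursor δ ω n).1, state ω l ∉ G := by
  constructor
  · intro h l hl
    have h1 := h (M.blockStart δ ω l) ((monotone_blockStart ω hl).trans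
      (by have := (cursor_spec (M := M) (δ := δ) (ω := ω) n).2; omega))
    have h2 := cursor_blockStart_add (M := M) (δ := δ) (ω := ω) l 0 (Nat.zero_le _)
    rw [add_zero] at h2
    rwa [dig_snd, h2] at h1
  · intro h k hk
    rw [dig_snd]
    exact h _ (monotone_cursor_fst ω hk)

/-- The cursor is a bijection from `ℕ` onto the pairs with `r ≤ sojournTicks i`, so a sum over
digital positions can be grouped by timed states. -/
theorem tsum_cursor (ω : ℕ → ℝ≥0 × A × S) (F : ℕ × ℕ → ℝ≥0∞) :
    ∑' n, F (M.cursor δ ω n)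
      = ∑' i, ∑' r, {c : ℕ × ℕ | c.2 ≤ M.sojournTicks δ ω c.1}.indicator F (i, r) := by
  rw [← ENNReal.tsum_prod (f := fun i r =>
    {c : ℕ × ℕ | c.2 ≤ M.sojournTicks δ ω c.1}.indicator F (i, r)),
    ← (cursor_injective (M := M) (δ := δ) ω).tsum_eq]
  · exact tsum_congr fun n => (Set.indicator_of_mem
      (show M.cursor δ ω n ∈ {c : ℕ × ℕ | c.2 ≤ M.sojournTicks δ ω c.1} from (cursor_spec n).1)
      F).symm
  · intro c hc
    have h1 : c.2 ≤ M.sojournTicks δ ω c.1 := by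
      by_contra h
      exact hc (Set.indicator_of_notMem
        (show c ∉ {c : ℕ × ℕ | c.2 ≤ M.sojournTicks δ ω c.1} from h) F)
    exact ⟨_, cursor_blockStart_add c.1 c.2 h1⟩

variable [Fintype S] [Fintype A] [MeasurableSpace S] [DiscreteMeasurableSpace S]
  [MeasurableSpace A] [DiscreteMeasurableSpace A]

/-- The finite timed paths that do not visit `G`. -/
def avoiding (G : Set S) (i : ℕ) : Set (Hist S A i) :=
  {x | ∀ l, (x l).2.2 ∉ G}

theorem measurableSet_avoiding (G : Set S) (i : ℕ) :
    MeasurableSet (avoiding (A := A) G i) := by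
  have : avoiding (A := A) G i = ⋂ l, {x : Hist S A i | (x l).2.2 ∈ Gᶜ} := by
    ext x; simp [avoiding]
  rw [this]
  refine MeasurableSet.iInter fun l => ?_
  exact (measurable_snd.comp (measurable_snd.comp (measurable_pi_apply l)))
    (MeasurableSet.of_discrete (s := Gᶜ))

theorem frestrictLe_mem_avoiding {G : Set S} {i : ℕ} {ω : ℕ → ℝ≥0 × A × S} :
    frestrictLe (π := fun _ => ℝ≥0 × A × S) i ω ∈ avoiding G i ↔ ∀ l ≤ i, state ω l ∉ G :=
  ⟨fun h l hl => h ⟨l, Finset.mem_Iic.2 hl⟩, fun h l => h l.1 (Finset.mem_Iic.1 l.2)⟩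

/-- Whether step `i` still counts is decided by the history up to state `i`, so the reward of the
step may be replaced by its conditional expectation. -/
theorem Scheduler.lintegral_avoiding (σ : M.Scheduler) (G : Set S) (i : ℕ)
    {f : S → ℝ≥0 × A × S → ℝ≥0∞} (hf : ∀ s, Measurable (f s)) :
    ∫⁻ ω, {i : ℕ | ∀ k ≤ i, state ω k ∉ G}.indicator
        (fun i => f (state ω i) (ω (i + 1))) i ∂σ.pathMeasure
      = ∫⁻ ω, (avoiding G i).indicator (fun x => ∫⁻ y, f x.last y ∂σ.step i x)
        (frestrictLe (π := fun _ => ℝ≥0 × A × S) i ω) ∂σ.pathMeasure := by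
  have h1 : Measurable fun p : Hist S A i × (ℝ≥0 × A × S) => f p.1.last p.2 :=
    (show Measurable fun p : S × (ℝ≥0 × A × S) => f p.1 p.2 from
      measurable_from_prod_countable_right hf).comp
      ((Hist.measurable_last.comp measurable_fst).prodMk measurable_snd)
  have h2 := σ.lintegral_succ i (f := fun x y => (avoiding G i ×ˢ Set.univ).indicator
    (fun p : Hist S A i × (ℝ≥0 × A × S) => f p.1.last p.2) (x, y))
    (h1.indicator ((measurableSet_avoiding G i).prod MeasurableSet.univ))
  refine Eq.trans (lintegral_congr fun ω => ?_) (h2.trans (lintegral_congr fun ω => ?_))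
  · by_cases hω : ∀ k ≤ i, state ω k ∉ G
    · rw [Set.indicator_of_mem, Set.indicator_of_mem]
      · rfl
      · exact ⟨frestrictLe_mem_avoiding.2 hω, trivial⟩
      · exact hω
    · rw [Set.indicator_of_notMem, Set.indicator_of_notMem]
      · exact fun h => hω (frestrictLe_mem_avoiding.1 h.1)
      · exact hω
  · by_cases hω : frestrictLe (π := fun _ => ℝ≥0 × A × S) i ω ∈ avoiding G i
    · rw [Set.indicator_of_mem hω]
      exact lintegral_congr fun y => Set.indicator_of_mem
        (show (_, _) ∈ avoiding G i ×ˢ Set.univ from ⟨hω, trivial⟩) _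
    · rw [Set.indicator_of_notMem hω]
      exact (lintegral_congr fun y => Set.indicator_of_notMem
        (show (_, _) ∉ avoiding G i ×ˢ Set.univ from fun h => hω h.1) _).trans lintegral_zero

variable (M δ) in
/-- The digital reward of the step after `r` elapsed periods in state `s`. -/
def tickReward (j : Fin ℓ) (r : ℕ) (s : S) (y : ℝ≥0 × A × S) : ℝ≥0∞ :=
  {y : ℝ≥0 × A × S | r ≤ M.ticks δ s y.1}.indicator
    (fun y => (M.digReward δ j s (M.nextDig δ s r y).1 : ℝ≥0∞)) y

theorem measurable_tickReward (j : Fin ℓ) (r : ℕ) (s : S) :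
    Measurable (M.tickReward δ j r s) := by
  have h1 : Measurable fun y : ℝ≥0 × A × S => M.ticks δ s y.1 :=
    (measurable_ticks s).comp measurable_fst
  have h2 : Measurable fun y : ℝ≥0 × A × S => M.nextDig δ s r y :=
    Measurable.ite (measurableSet_lt measurable_const h1) measurable_const measurable_snd
  exact Measurable.indicator
    ((measurable_of_countable fun c : A × S => (M.digReward δ j s c.1 : ℝ≥0∞)).comp h2)
    (measurableSet_le measurable_const h1)

theorem measurable_stepReward (j : Fin ℓ) (s : S) :
    Measurable fun y : ℝ≥0 × A × S =>
      ((M.stateReward j s * y.1 + M.actionReward j s y.2.1 : ℝ≥0) : ℝ≥0∞) := by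
  have : Measurable fun y : ℝ≥0 × A × S => M.actionReward j s y.2.1 :=
    (measurable_of_countable fun a : A => M.actionReward j s a).comp (by fun_prop)
  fun_prop

/-- In a Markovian state, period `r` is reached with probability `q ^ r`, and each period reached
earns `(ρ(s, ⊥) + ρ(s) / E) * (1 - q)`. The geometric series cancels the factor `1 - q` and leaves
the action reward plus `ρ(s)` times the mean sojourn. In a probabilistic state only `r = 0`
contributes. -/
theorem Scheduler.tsum_lintegral_tickReward (hδ : 0 < δ) (σ : M.Scheduler) (j : Fin ℓ) {i : ℕ}
    (x : Hist S A i) : ∑' r, ∫⁻ y, M.tickReward δ j r x.last y ∂σ.step i x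
      = ∫⁻ y, ((M.stateReward j x.last * y.1 + M.actionReward j x.last y.2.1 : ℝ≥0) : ℝ≥0∞)
        ∂σ.step i x := by
  by_cases hs : x.last ∈ M.MS
  · have hE := M.exitRate_pos hs
    set q := ENNReal.ofReal (Real.exp (-(M.exitRate x.last * δ))) with hq
    have h1 : ∀ r, ∫⁻ y, M.tickReward δ j r x.last y ∂σ.step i x
        = q ^ r * M.digReward δ j x.last M.tau := by
      intro r
      have h2 : ∀ s', ∫⁻ t, M.tickReward δ j r x.last (t, M.tau, s') ∂M.sojournMeasure x.last
          = q ^ r * M.digReward δ j x.last M.tau := by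
        intro s'
        have hm : MeasurableSet {t | r ≤ M.ticks δ x.last t} :=
          measurableSet_le measurable_const (measurable_ticks _)
        rw [← sojournMeasure_le_ticks hδ hs, mul_comm, ← lintegral_indicator_const hm]
        refine lintegral_congr fun t => ?_
        by_cases ht : r ≤ M.ticks δ x.last t
        · rw [tickReward, Set.indicator_of_mem (by exact ht), Set.indicator_of_mem (by exact ht),
            nextDig]
          split_ifs <;> rfl
        · rw [tickReward, Set.indicator_of_notMem (by exact ht),
            Set.indicator_of_notMem (by exact ht)]
      rw [lintegral_step_of_mem_MS σ x hs (measurable_tickReward j r _)]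
      simp only [h2, ← Finset.sum_mul, sum_ofReal_prob (tau_mem_enabled hs), one_mul]
    have h3 : ∫⁻ t : ℝ≥0, ((M.stateReward j x.last * t + M.actionReward j x.last M.tau : ℝ≥0)
        : ℝ≥0∞) ∂M.sojournMeasure x.last
        = M.stateReward j x.last * ENNReal.ofReal (1 / M.exitRate x.last)
          + M.actionReward j x.last M.tau := by
      simp only [ENNReal.coe_add, ENNReal.coe_mul]
      rw [lintegral_add_right _ measurable_const, lintegral_const_mul _ (by fun_prop),
        lintegral_id_sojournMeasure hs]
      simp
    have hexp : Real.exp (-(M.exitRate x.last * δ)) < 1 := by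
      rw [Real.exp_lt_one_iff, neg_lt_zero]
      exact mul_pos hE hδ
    have hq1 : q < 1 := by rw [hq, ENNReal.ofReal_lt_one]; exact hexp
    have h4 : ENNReal.ofReal (1 - Real.exp (-(M.exitRate x.last * δ))) = 1 - q := by
      rw [ENNReal.ofReal_sub _ (Real.exp_pos _).le, ENNReal.ofReal_one]
    rw [lintegral_step_of_mem_MS σ x hs (measurable_stepReward j _)]
    simp only [h1, h3, ← Finset.sum_mul,
      sum_ofReal_prob (tau_mem_enabled hs), one_mul, ENNReal.tsum_mul_right,
      ENNReal.tsum_geometric]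
    rw [digReward, if_neg (fun h => mem_PS_iff.1 h hs), if_pos ⟨hs, rfl⟩, ENNReal.coe_mul,
      ← ENNReal.ofReal, h4, mul_comm _ (1 - q), ← mul_assoc, ENNReal.inv_mul_cancel
        (tsub_pos_of_lt hq1).ne' (by simp), one_mul, ENNReal.coe_add, ENNReal.coe_mul, add_comm,
      mul_comm (M.stateReward j x.last : ℝ≥0∞)]
    congr 2
    rw [ENNReal.ofReal, one_div, one_div, Real.toNNReal_inv]
  · rw [tsum_eq_single 0, lintegral_step_of_notMem_MS σ x hs (measurable_tickReward j 0 _),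
      lintegral_step_of_notMem_MS σ x hs (measurable_stepReward j _)]
    · simp [tickReward, nextDig, ticks_of_notMem hs, digReward, mem_PS_iff.2 hs]
    · intro r hr
      rw [lintegral_congr (g := fun _ => 0), lintegral_zero]
      intro y
      exact Set.indicator_of_notMem (by simp [ticks_of_notMem hs, hr]) _

theorem measurable_digPathReward (j : Fin ℓ) (G : Set S) :
    Measurable ((M.digitization δ).pathReward j G) := by
  refine Measurable.tsum fun i => ?_
  have h1 : MeasurableSet {ω : ℕ → A × S | ∀ k ≤ i, (ω k).2 ∈ Gᶜ} := by
    have : {ω : ℕ → A × S | ∀ k ≤ i, (ω k).2 ∈ Gᶜ} = ⋂ k, ⋂ (_ : k ≤ i),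
        {ω : ℕ → A × S | (ω k).2 ∈ Gᶜ} := by ext; simp
    rw [this]
    exact MeasurableSet.iInter fun k => MeasurableSet.iInter fun _ =>
      (measurable_snd.comp (measurable_pi_apply k)) (MeasurableSet.of_discrete (s := Gᶜ))
  have h2 : Measurable fun ω : ℕ → A × S =>
      ((M.digitization δ).reward j (ω i).2 (ω (i + 1)).1 : ℝ≥0∞) :=
    (measurable_of_countable fun p : S × A => ((M.digitization δ).reward j p.1 p.2 : ℝ≥0∞)).comp
      (by fun_prop : Measurable fun ω : ℕ → A × S => ((ω i).2, (ω (i + 1)).1))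
  have h3 := h2.indicator h1
  convert! h3 using 2 with ω

theorem Scheduler.Compatible.expReward_eq (hδ : 0 < δ) {σ : M.Scheduler}
    {σ' : (M.digitization δ).Scheduler} (hc : σ.Compatible σ') (j : Fin ℓ) (G : Set S) :
    M.expReward σ j G = (M.digitization δ).expReward σ' j G := by
  have hdig : ∀ ω : ℕ → ℝ≥0 × A × S, (M.digitization δ).pathReward j G (M.dig δ ω)
      = ∑' i, ∑' r, {i : ℕ | ∀ k ≤ i, state ω k ∉ G}.indicator
        (fun i => M.tickReward δ j r (state ω i) (ω (i + 1))) i := by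
    intro ω
    let F : ℕ × ℕ → ℝ≥0∞ := fun c => {i : ℕ | ∀ k ≤ i, state ω k ∉ G}.indicator (fun i =>
      (M.digReward δ j (state ω i) (M.nextDig δ (state ω i) c.2 (ω (i + 1))).1 : ℝ≥0∞)) c.1
    have h1 : (M.digitization δ).pathReward j G (M.dig δ ω) = ∑' n, F (M.cursor δ ω n) := by
      refine tsum_congr fun n => ?_
      have h2 := forall_dig_notMem_iff (M := M) (δ := δ) ω G n
      by_cases hn : ∀ k ≤ n, (M.dig δ ω k).2 ∉ G
      · rw [Set.indicator_of_mem (by exact hn)]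
        simp only [F]
        rw [Set.indicator_of_mem (by exact h2.1 hn), dig_snd, dig_succ]
        rfl
      · rw [Set.indicator_of_notMem (by exact hn)]
        simp only [F]
        rw [Set.indicator_of_notMem (by exact fun h => hn (h2.2 h))]
    rw [h1, tsum_cursor]
    refine tsum_congr fun i => tsum_congr fun r => ?_
    simp only [tickReward, F]
    by_cases hi : ∀ k ≤ i, state ω k ∉ G
    · rw [Set.indicator_of_mem (s := {i : ℕ | ∀ k ≤ i, state ω k ∉ G}) (by exact hi)]
      by_cases hr : r ≤ M.ticks δ (state ω i) (ω (i + 1)).1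
      · rw [Set.indicator_of_mem (by exact hr), Set.indicator_of_mem (by exact hi),
          Set.indicator_of_mem (by exact hr)]
      · rw [Set.indicator_of_notMem (by exact hr), Set.indicator_of_notMem (by exact hr)]
    · rw [Set.indicator_of_notMem (s := {i : ℕ | ∀ k ≤ i, state ω k ∉ G}) (by exact hi)]
      refine Set.indicator_apply_eq_zero.2 fun _ => ?_
      exact Set.indicator_of_notMem (by exact hi) _
  have hmeas : ∀ {f : S → ℝ≥0 × A × S → ℝ≥0∞}, (∀ s, Measurable (f s)) → ∀ i,
      Measurable fun ω : ℕ → ℝ≥0 × A × S => {i : ℕ | ∀ k ≤ i, state ω k ∉ G}.indicator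
        (fun i => f (state ω i) (ω (i + 1))) i := by
    intro f hf i
    have h1 : Measurable fun ω : ℕ → ℝ≥0 × A × S => f (state ω i) (ω (i + 1)) :=
      (show Measurable fun p : S × (ℝ≥0 × A × S) => f p.1 p.2 from
        measurable_from_prod_countable_right hf).comp
        ((measurable_state i).prodMk (measurable_pi_apply (i + 1)))
    have h2 : Measurable (frestrictLe (π := fun _ : ℕ => ℝ≥0 × A × S) i) := by fun_prop
    convert! h1.indicator (h2 (measurableSet_avoiding G i)) using 2 with ω
    by_cases hi : ∀ k ≤ i, state ω k ∉ G
    · rw [Set.indicator_of_mem (by exact hi),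
        Set.indicator_of_mem (by exact frestrictLe_mem_avoiding.2 hi)]
    · rw [Set.indicator_of_notMem (by exact hi),
        Set.indicator_of_notMem (by exact fun h => hi (frestrictLe_mem_avoiding.1 h))]
  rw [expReward, MDP.expReward, ← hc.map_dig hδ,
    lintegral_map (measurable_digPathReward j G) measurable_dig]
  have hleft := lintegral_tsum (μ := σ.pathMeasure)
    fun i => (hmeas (fun s => measurable_stepReward (M := M) j s) i).aemeasurable
  simp only [hdig]
  refine hleft.trans ?_
  rw [lintegral_tsum fun i => (Measurable.tsum fun r =>
      hmeas (measurable_tickReward j r) i).aemeasurable]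
  refine tsum_congr fun i => ?_
  rw [lintegral_tsum fun r => (hmeas (measurable_tickReward j r) i).aemeasurable]
  refine (σ.lintegral_avoiding G i (f := fun s y =>
    ((M.stateReward j s * y.1 + M.actionReward j s y.2.1 : ℝ≥0) : ℝ≥0∞))
      (measurable_stepReward j)).trans ?_
  simp only [σ.lintegral_avoiding G i (measurable_tickReward j _)]
  -- Moving the sum over `r` back under the integral lets `tsum_lintegral_tickReward` apply to each
  -- timed history separately.
  rw [← lintegral_tsum]
  · refine lintegral_congr fun ω => ?_
    by_cases hi : frestrictLe (π := fun _ => ℝ≥0 × A × S) i ω ∈ avoiding G i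
    · simp only [Set.indicator_of_mem hi, σ.tsum_lintegral_tickReward hδ]
    · simp [Set.indicator_of_notMem hi]
  · intro r
    refine (Measurable.comp (g := (avoiding G i).indicator
      fun x => ∫⁻ y, M.tickReward δ j r x.last y ∂σ.step i x) ?_
      (measurable_frestrictLe (X := fun _ => ℝ≥0 × A × S) i)).aemeasurable
    refine Measurable.indicator ?_ (measurableSet_avoiding G i)
    have h1 : Measurable fun p : Hist S A i × (ℝ≥0 × A × S) =>
        M.tickReward δ j r p.1.last p.2 :=
      (show Measurable fun p : S × (ℝ≥0 × A × S) => M.tickReward δ j r p.1 p.2 from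
        measurable_from_prod_countable_right (measurable_tickReward j r)).comp
        ((Hist.measurable_last.comp measurable_fst).prodMk measurable_snd)
    exact Measurable.lintegral_kernel_prod_right (κ := σ.stepKernel i)
      (f := fun (x : Hist S A i) y => M.tickReward δ j r x.last y) h1

end Reward

/-! ### The one-step inequality for the survival bound -/

section Analytic

/-- With `1 + d` in place of `exp d` this would be an equality, the geometric expansion of `(1 + x)
^ j` for `x = y + d`. In the induction, `d + 1 ≤ exp d` is the only loss. It is applied with `x = λ
δ`, `y = E δ` and `d = (λ - E) δ`, and accounts for rates below the maximum. -/
theorem one_add_pow_le_exp_add_sum {x y d : ℝ} (hx : 0 ≤ x)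
    (hxy : x = y + d) (j : ℕ) :
    (1 + x) ^ j ≤ Real.exp (d * j)
      + y * ∑ c ∈ Finset.range j, Real.exp (d * c) * (1 + x) ^ (j - 1 - c) := by
  induction j with
  | zero => simp
  | succ j ih =>
    have h1 : ∑ c ∈ Finset.range (j + 1), Real.exp (d * c) * (1 + x) ^ (j + 1 - 1 - c)
        = (1 + x) * (∑ c ∈ Finset.range j, Real.exp (d * c) * (1 + x) ^ (j - 1 - c))
          + Real.exp (d * j) := by
      rw [Finset.sum_range_succ, Finset.mul_sum]
      congr 1
      · refine Finset.sum_congr rfl fun c hc => ?_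
        have : j + 1 - 1 - c = (j - 1 - c) + 1 := by have := Finset.mem_range.1 hc; omega
        rw [this]; ring
      · simp
    have h2 : Real.exp (d * (j + 1 : ℕ)) = Real.exp (d * j) * Real.exp d := by
      rw [← Real.exp_add]; congr 1; push_cast; ring
    have h3 : d + 1 ≤ Real.exp d := Real.add_one_le_exp d
    rw [h1, h2, pow_succ]
    have h4 := mul_le_mul_of_nonneg_right ih (by linarith : 0 ≤ 1 + x)
    have h5 := mul_nonneg (Real.exp_pos (d * j)).le (by linarith : 0 ≤ Real.exp d - 1 - d)
    subst hxy
    nlinarith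

variable {S A : Type*} {ℓ : ℕ} {M : MarkovAutomaton S A ℓ} {δ : ℝ≥0}

variable (M δ) in
/-- A lower bound for the probability that the elapsed time exceeds `k * δ` as soon as the number of
digitization steps exceeds `k`, if `N` steps have been made and the time `τ` has elapsed. -/
def survival (k N : ℕ) (τ : ℝ≥0) : ℝ≥0∞ :=
  if N ≤ k then ENNReal.ofReal (Real.exp (-(M.maxRate * (k * δ - τ)))
    * (1 + M.maxRate * δ) ^ (k - N))
  else if τ ≤ k * δ then 0 else 1

theorem measurable_survival (k N : ℕ) : Measurable (M.survival δ k N) := by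
  unfold survival
  split_ifs
  · fun_prop
  · exact Measurable.ite measurableSet_Iic measurable_const measurable_const

variable [Finite S]

theorem exitRate_le_maxRate {s : S} (hs : s ∈ M.MS) : M.exitRate s ≤ M.maxRate :=
  le_csSup ((Set.toFinite _).bddAbove) ⟨s, hs, rfl⟩

theorem maxRate_nonneg : 0 ≤ M.maxRate :=
  Real.sSup_nonneg (by rintro _ ⟨s, -, rfl⟩; exact M.exitRate_nonneg s)

/-- Since the digital clock is ahead, at least `(k - N) * δ` time remains, and `1 + λ δ ≤ exp (λ δ)`
for each remaining step. -/
theorem survival_le_one {k N : ℕ} {τ : ℝ≥0} (hτ : τ ≤ N * δ) : M.survival δ k N τ ≤ 1 := by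
  have hl := M.maxRate_nonneg
  unfold survival
  split_ifs with h1 h2
  · obtain ⟨j, rfl⟩ := Nat.exists_eq_add_of_le h1
    rw [ENNReal.ofReal_le_one, Nat.add_sub_cancel_left]
    have h3 : (1 + M.maxRate * δ) ^ j ≤ Real.exp (M.maxRate * (((N + j : ℕ) : ℝ) * δ - τ)) := by
      calc (1 + M.maxRate * δ) ^ j ≤ Real.exp (M.maxRate * δ) ^ j := by
            refine pow_le_pow_left₀ (by positivity) ?_ j
            linarith [Real.add_one_le_exp (M.maxRate * δ)]
        _ = Real.exp (j * (M.maxRate * δ)) := (Real.exp_nat_mul _ j).symm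
        _ ≤ _ := by
            refine Real.exp_le_exp.2 ?_
            have : (τ : ℝ) ≤ N * δ := by exact_mod_cast hτ
            push_cast
            nlinarith [mul_nonneg hl (sub_nonneg.2 this)]
    rw [Real.exp_neg, inv_mul_le_iff₀ (Real.exp_pos _), mul_one]
    exact h3
  · exact zero_le_one
  · exact le_rfl

/-- First-step analysis with `j = k - N` steps and time `u = k δ - τ` left. A sojourn with `c < j`
complete periods leaves `j - 1 - c` steps. With more periods the step budget is exceeded, and
overrun is avoided only by a sojourn longer than `u`. At rate `λ` the factor `exp (λ x)` of the
survival bound cancels the density, giving `exp (-λ u) * (λ δ ∑ (1 + λ δ) ^ (j - 1 - c) + 1) = exp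
(-λ u) * (1 + λ δ) ^ j`. Lower rates are handled by `one_add_pow_le_exp_add_sum`. -/
theorem survival_le_lintegral (hδ : 0 < δ) {s : S} (hs : s ∈ M.MS) {k N : ℕ} {τ : ℝ≥0}
    (hN : N ≤ k) (hτ : τ ≤ N * δ) :
    M.survival δ k N τ
      ≤ ∫⁻ t, M.survival δ k (N + (M.ticks δ s t + 1)) (τ + t) ∂M.sojournMeasure s := by
  obtain ⟨j, rfl⟩ := Nat.exists_eq_add_of_le hN
  have hl := M.maxRate_nonneg
  have hE := M.exitRate_pos hs
  have hEl := exitRate_le_maxRate hs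
  have hδ' : (0 : ℝ) < δ := hδ
  set E := M.exitRate s
  set L := M.maxRate with hL
  set u : ℝ := ((N + j : ℕ) : ℝ) * δ - τ with hu
  -- As the digital clock is ahead, the remaining time covers the remaining steps. Hence the
  -- sojourns below `j * δ` and those beyond `u` do not overlap.
  have huj : j * δ ≤ u := by
    have : (τ : ℝ) ≤ N * δ := by exact_mod_cast hτ
    rw [hu]; push_cast; linarith
  have hu0 : 0 ≤ u := le_trans (by positivity) huj
  have hmeas : Measurable fun t => M.survival δ (N + j) (N + (M.ticks δ s t + 1)) (τ + t) := by
    have h : Measurable fun p : ℕ × ℝ≥0 => M.survival δ (N + j) p.1 p.2 :=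
      measurable_from_prod_countable_right fun n => measurable_survival _ n
    exact h.comp ((((measurable_ticks s).add_const 1).const_add N).prodMk
      (measurable_id.const_add τ))
  -- On the `c`-th period the density times the survival bound is `E * exp (-L u) * exp ((L - E) x)
  -- * (1 + L δ) ^ (j - 1 - c)`. As `E ≤ L`, its minimum is at the left end `x = c δ`.
  let K : ℕ → ℝ := fun c => E * Real.exp (-(L * u)) * Real.exp ((L - E) * δ * c)
    * (1 + L * δ) ^ (j - 1 - c)
  have hK : ∀ c, 0 ≤ K c := fun c => by positivity
  -- The sojourns between `j * δ` and `u` contribute zero to the lower bound.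
  have hlow : ∀ x ∈ Set.Ici (0 : ℝ),
      (∑ c ∈ Finset.range j, (Set.Ico (c * (δ : ℝ)) ((c + 1) * δ)).indicator
        (fun _ => ENNReal.ofReal (K c)) x)
      + (Set.Ioi u).indicator (fun x => ENNReal.ofReal (E * Real.exp (-(E * x)))) x
      ≤ ENNReal.ofReal (E * Real.exp (-(E * x))) *
        M.survival δ (N + j) (N + (M.ticks δ s x.toNNReal + 1)) (τ + x.toNNReal) := by
    intro x hx
    have hx0 : 0 ≤ x := hx
    set m := M.ticks δ s x.toNNReal with hm
    have hm1 : m * (δ : ℝ) ≤ x := by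
      have := (le_ticks_iff hδ hs m x.toNNReal).1 le_rfl
      have h2 : ((m * δ : ℝ≥0) : ℝ) ≤ x.toNNReal := by exact_mod_cast this
      rwa [Real.coe_toNNReal x hx0] at h2
    have hm2 : x < (m + 1) * (δ : ℝ) := by
      by_contra h
      have : ((m + 1 : ℕ) : ℝ≥0) * δ ≤ x.toNNReal := by
        rw [Real.le_toNNReal_iff_coe_le hx0]
        push_cast
        exact not_lt.1 h
      have := (le_ticks_iff hδ hs (m + 1) x.toNNReal).2 this
      omega
    have hother : ∀ c : ℕ, c ≠ m → x ∉ Set.Ico (c * (δ : ℝ)) ((c + 1) * δ) := by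
      rintro c hc ⟨h1, h2⟩
      have h3 : (c : ℝ) < m + 1 := lt_of_mul_lt_mul_right (h1.trans_lt hm2) hδ'.le
      have h4 : (m : ℝ) < c + 1 := lt_of_mul_lt_mul_right (hm1.trans_lt h2) hδ'.le
      have h5 : c < m + 1 := by exact_mod_cast h3
      have h6 : m < c + 1 := by exact_mod_cast h4
      omega
    by_cases hmj : m < j
    · have hxu : x ∉ Set.Ioi u := by
        have : ((m + 1 : ℕ) : ℝ) ≤ j := by exact_mod_cast hmj
        push_cast at this
        have h7 := mul_le_mul_of_nonneg_right this hδ'.le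
        simp only [Set.mem_Ioi, not_lt]
        linarith
      rw [Finset.sum_eq_single m (fun c _ hc => Set.indicator_of_notMem (hother c hc) _)
        (fun h => absurd (Finset.mem_range.2 hmj) h), Set.indicator_of_mem
          (show x ∈ Set.Ico (m * (δ : ℝ)) ((m + 1) * δ) from ⟨hm1, hm2⟩),
        Set.indicator_of_notMem hxu, add_zero, survival, if_pos (by omega),
        ← ENNReal.ofReal_mul (by positivity)]
      refine ENNReal.ofReal_le_ofReal ?_
      have h8 : N + j - (N + (m + 1)) = j - 1 - m := by omega
      rw [h8, ← mul_assoc]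
      refine mul_le_mul_of_nonneg_right ?_ (by positivity)
      rw [mul_assoc E, mul_assoc E, ← Real.exp_add, ← Real.exp_add]
      refine mul_le_mul_of_nonneg_left (Real.exp_le_exp.2 ?_) hE.le
      rw [NNReal.coe_add, Real.coe_toNNReal x hx0]
      have h9 := mul_le_mul_of_nonneg_left hm1 (sub_nonneg.2 hEl)
      rw [hu]
      nlinarith
    · rw [Finset.sum_eq_zero, zero_add]
      · by_cases hxu : x ∈ Set.Ioi u
        · rw [Set.indicator_of_mem hxu, survival, if_neg (by omega), if_neg, mul_one]
          rw [not_le, ← NNReal.coe_lt_coe]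
          push_cast
          rw [Real.coe_toNNReal x hx0]
          have : u < x := hxu
          rw [hu] at this
          push_cast at this
          linarith
        · rw [Set.indicator_of_notMem hxu]
          exact zero_le
      · intro c hc
        exact Set.indicator_of_notMem (hother c (by have := Finset.mem_range.1 hc; omega)) _
  rw [lintegral_sojournMeasure hs hmeas]
  refine le_trans ?_ (setLIntegral_mono' measurableSet_Ici hlow)
  have hIoi : ∫⁻ x in Set.Ici (0 : ℝ),
      (Set.Ioi u).indicator (fun x => ENNReal.ofReal (E * Real.exp (-(E * x)))) x
      = ENNReal.ofReal (Real.exp (-(E * u))) := by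
    rw [setLIntegral_indicator measurableSet_Ioi, Set.inter_eq_left.2
      (show Set.Ioi u ⊆ Set.Ici 0 from fun x hx => hu0.trans (le_of_lt hx)), setLIntegral_congr Ioi_ae_eq_Ici,
      lintegral_Ici_exp hE]
  have hIco : ∀ c : ℕ, ∫⁻ x in Set.Ici (0 : ℝ), (Set.Ico (c * (δ : ℝ)) ((c + 1) * δ)).indicator
        (fun _ => ENNReal.ofReal (K c)) x = ENNReal.ofReal (K c * δ) := by
    intro c
    rw [setLIntegral_indicator measurableSet_Ico, Set.inter_eq_left.2
      (show Set.Ico (c * (δ : ℝ)) ((c + 1) * δ) ⊆ Set.Ici 0 from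
        fun x hx => le_trans (by positivity) hx.1), setLIntegral_const, Real.volume_Ico,
      ← ENNReal.ofReal_mul (hK c)]
    congr 2; ring
  rw [lintegral_add_left (by fun_prop (disch := measurability)), hIoi,
    lintegral_finsetSum _ fun c _ => measurable_const.indicator measurableSet_Ico]
  simp only [hIco]
  rw [← ENNReal.ofReal_sum_of_nonneg fun c _ => mul_nonneg (hK c) hδ'.le,
    ← ENNReal.ofReal_add (Finset.sum_nonneg fun c _ => mul_nonneg (hK c) hδ'.le)
      (Real.exp_pos _).le, survival, if_pos (by omega), Nat.add_sub_cancel_left]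
  refine ENNReal.ofReal_le_ofReal ?_
  have h1 := one_add_pow_le_exp_add_sum (x := L * δ) (y := E * δ) (d := (L - E) * δ)
    (by positivity) (by ring) j
  -- This supplies the first term on the right of `h1` from the sojourns longer than `u`, using `j *
  -- δ ≤ u`.
  have h2 : Real.exp (-(L * u)) * Real.exp ((L - E) * δ * j) ≤ Real.exp (-(E * u)) := by
    rw [← Real.exp_add]
    refine Real.exp_le_exp.2 ?_
    have := mul_le_mul_of_nonneg_left huj (sub_nonneg.2 hEl)
    nlinarith
  have h3 : ∑ c ∈ Finset.range j, K c * δ = Real.exp (-(L * u)) * (E * δ *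
      ∑ c ∈ Finset.range j, Real.exp ((L - E) * δ * c) * (1 + L * δ) ^ (j - 1 - c)) := by
    rw [Finset.mul_sum, Finset.mul_sum]
    refine Finset.sum_congr rfl fun c _ => ?_
    simp only [K]; ring
  have h4 := mul_le_mul_of_nonneg_left h1 (Real.exp_pos (-(L * u))).le
  rw [h3]
  calc _ ≤ _ := h4
    _ ≤ _ := by rw [mul_add]; linarith

end Analytic

/-! ### Probabilities of the exceptional events -/

section Events

open Preorder

variable {S A : Type*} {ℓ : ℕ} (M : MarkovAutomaton S A ℓ) (δ : ℝ≥0)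

open Classical in
/-- The number of digitization steps before the `i`-th state of a timed path is entered. -/
def timedSteps (ω : ℕ → ℝ≥0 × A × S) (i : ℕ) : ℕ :=
  ∑ l ∈ Finset.range i, if state ω l ∈ M.MS then M.sojournTicks δ ω l + 1 else 0

/-- The timed paths that make more than `k` digitization steps within time `k * δ`. -/
def overrun (k : ℕ) : Set (ℕ → ℝ≥0 × A × S) :=
  {ω | ∃ i, entryTime ω i ≤ k * δ ∧ k < M.timedSteps δ ω i}

/-- The timed paths with a Markovian transition at the digitization step with index `k`. -/
def jumpAt (k : ℕ) : Set (ℕ → ℝ≥0 × A × S) :=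
  {ω | ∃ i, state ω i ∈ M.MS ∧ M.timedSteps δ ω i + M.sojournTicks δ ω i = k}

variable {M δ} {ω ω' : ℕ → ℝ≥0 × A × S}

theorem timedSteps_succ_of_mem {i : ℕ} (h : state ω i ∈ M.MS) :
    M.timedSteps δ ω (i + 1) = M.timedSteps δ ω i + (M.sojournTicks δ ω i + 1) := by
  rw [timedSteps, Finset.sum_range_succ, if_pos h]
  rfl

theorem timedSteps_succ_of_notMem {i : ℕ} (h : state ω i ∉ M.MS) :
    M.timedSteps δ ω (i + 1) = M.timedSteps δ ω i := by
  rw [timedSteps, Finset.sum_range_succ, if_neg h, add_zero]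
  rfl

theorem entryTime_succ (i : ℕ) : entryTime ω (i + 1) = entryTime ω i + sojournTime ω i := by
  rw [entryTime, Finset.sum_range_succ]
  rfl

theorem monotone_timedSteps : Monotone (M.timedSteps δ ω) := by
  refine monotone_nat_of_le_succ fun i => ?_
  by_cases h : state ω i ∈ M.MS
  · rw [timedSteps_succ_of_mem h]; omega
  · rw [timedSteps_succ_of_notMem h]

theorem timedSteps_congr {i : ℕ} (h : ∀ l ≤ i, ω' l = ω l) :
    M.timedSteps δ ω' i = M.timedSteps δ ω i := by
  refine Finset.sum_congr rfl fun l hl => ?_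
  have hl := Finset.mem_range.1 hl
  have h1 : state ω' l = state ω l := by rw [state, state, h l hl.le]
  have h2 : sojournTime ω' l = sojournTime ω l := by rw [sojournTime, sojournTime, h (l + 1) hl]
  by_cases hs : state ω l ∈ M.MS
  · rw [if_pos hs, if_pos (by rwa [h1]), sojournTicks, sojournTicks, h1, h2]
  · rw [if_neg hs, if_neg (by rwa [h1])]

theorem entryTime_congr {i : ℕ} (h : ∀ l ≤ i, ω' l = ω l) :
    entryTime ω' i = entryTime ω i := by
  refine Finset.sum_congr rfl fun l hl => ?_
  have hl := Finset.mem_range.1 hl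
  simp only [sojournTime]
  rw [h (l + 1) hl]

theorem timedSteps_extend (i r : ℕ) :
    M.timedSteps δ (M.extend δ r (frestrictLe (π := fun _ => ℝ≥0 × A × S) i ω)) i
      = M.timedSteps δ ω i :=
  timedSteps_congr fun _ hl => extend_frestrictLe r i hl

theorem entryTime_extend (i r : ℕ) :
    entryTime (M.extend δ r (frestrictLe (π := fun _ => ℝ≥0 × A × S) i ω)) i = entryTime ω i :=
  entryTime_congr fun _ hl => extend_frestrictLe r i hl

/-- A Markovian sojourn is strictly shorter than its `ticks + 1` digitization steps, and
probabilistic states contribute neither time nor steps. Strictness matters at a positive lower end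
point. -/
theorem entryTime_eq_zero_or_lt (hδ : 0 < δ)
    (hω : ∀ i, state ω i ∉ M.MS → sojournTime ω i = 0) (i : ℕ) :
    entryTime ω i = 0 ∨ entryTime ω i < M.timedSteps δ ω i * δ := by
  induction i with
  | zero => left; simp [entryTime]
  | succ i ih =>
    by_cases h : state ω i ∈ M.MS
    · right
      have h1 : entryTime ω i ≤ M.timedSteps δ ω i * δ := by
        rcases ih with ih | ih
        · rw [ih]; exact zero_le
        · exact ih.le
      have h2 : sojournTime ω i < ((M.sojournTicks δ ω i + 1 : ℕ) : ℝ≥0) * δ := by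
        by_contra hn
        have := (le_ticks_iff hδ h (M.sojournTicks δ ω i + 1) _).2 (not_lt.1 hn)
        rw [sojournTicks] at this
        omega
      rw [entryTime_succ, timedSteps_succ_of_mem h, Nat.cast_add, add_mul]
      exact add_lt_add_of_le_of_lt h1 h2
    · rw [entryTime_succ, hω i h, add_zero, timedSteps_succ_of_notMem h]
      exact ih

theorem entryTime_le (hδ : 0 < δ) (hω : ∀ i, state ω i ∉ M.MS → sojournTime ω i = 0) (i : ℕ) :
    entryTime ω i ≤ M.timedSteps δ ω i * δ := by
  rcases entryTime_eq_zero_or_lt hδ hω i with h | h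
  · rw [h]; exact zero_le
  · exact h.le

variable [Fintype S] [Fintype A] [MeasurableSpace S] [DiscreteMeasurableSpace S]
  [MeasurableSpace A] [DiscreteMeasurableSpace A]

theorem measurable_timedSteps (i : ℕ) :
    Measurable fun ω : ℕ → ℝ≥0 × A × S => M.timedSteps δ ω i := by
  refine Finset.measurable_sum _ fun l _ => ?_
  exact Measurable.ite ((measurable_state l) (MeasurableSet.of_discrete (s := M.MS)))
    ((measurable_sojournTicks l).add_const 1) measurable_const

theorem measurable_entryTime (i : ℕ) :
    Measurable fun ω : ℕ → ℝ≥0 × A × S => entryTime ω i :=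
  Finset.measurable_sum _ fun l _ => measurable_sojournTime l

namespace Scheduler

variable (σ : M.Scheduler)

theorem measure_succ (i : ℕ) {B : Set (Hist S A i × (ℝ≥0 × A × S))} (hB : MeasurableSet B) :
    σ.pathMeasure {ω | (frestrictLe (π := fun _ => ℝ≥0 × A × S) i ω, ω (i + 1)) ∈ B}
      = ∫⁻ ω, σ.step i (frestrictLe (π := fun _ => ℝ≥0 × A × S) i ω)
        {y | (frestrictLe (π := fun _ => ℝ≥0 × A × S) i ω, y) ∈ B} ∂σ.pathMeasure := by
  have h1 : Measurable fun ω : ℕ → ℝ≥0 × A × S =>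
      (frestrictLe (π := fun _ => ℝ≥0 × A × S) i ω, ω (i + 1)) := by fun_prop
  rw [← lintegral_indicator_one (show MeasurableSet {ω : ℕ → ℝ≥0 × A × S |
    (frestrictLe (π := fun _ => ℝ≥0 × A × S) i ω, ω (i + 1)) ∈ B} from h1 hB)]
  refine (σ.lintegral_succ i (f := fun x y => B.indicator 1 (x, y))
    (measurable_one.indicator hB)).trans (lintegral_congr fun ω => ?_)
  rw [← lintegral_indicator_one (show MeasurableSet {y : ℝ≥0 × A × S |
    (frestrictLe (π := fun _ => ℝ≥0 × A × S) i ω, y) ∈ B} from measurable_prodMk_left hB)]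
  rfl

theorem ae_sojournTime : ∀ᵐ ω ∂σ.pathMeasure, ∀ i, state ω i ∉ M.MS → sojournTime ω i = 0 := by
  refine ae_all_iff.2 fun i => ?_
  have hB : MeasurableSet {p : Hist S A i × (ℝ≥0 × A × S) | p.1.last ∈ M.MSᶜ ∧ p.2.1 ∈ ({0}ᶜ : Set ℝ≥0)} :=
    ((Hist.measurable_last.comp measurable_fst) (MeasurableSet.of_discrete (s := M.MSᶜ))).inter
      ((measurable_fst.comp measurable_snd) (measurableSet_singleton 0).compl)
  rw [ae_iff]
  have h1 := σ.measure_succ i hB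
  have h2 : {ω : ℕ → ℝ≥0 × A × S | ¬ (state ω i ∉ M.MS → sojournTime ω i = 0)}
      = {ω | (frestrictLe (π := fun _ => ℝ≥0 × A × S) i ω, ω (i + 1)) ∈
        {p : Hist S A i × (ℝ≥0 × A × S) | p.1.last ∈ M.MSᶜ ∧ p.2.1 ∈ ({0}ᶜ : Set ℝ≥0)}} := by
    ext ω
    simp only [Set.mem_ofPred_eq, Classical.not_imp]
    rfl
  rw [h2, h1, lintegral_congr (g := fun _ => 0), lintegral_zero]
  intro ω
  by_cases hs : Hist.last (frestrictLe (π := fun _ => ℝ≥0 × A × S) i ω) ∈ M.MS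
  · refine measure_mono_null (t := ∅) (fun y hy => hy.1 hs) measure_empty
  · exact measure_mono_null (fun y hy => hy.2) (ae_iff.1 (ae_step_of_notMem_MS σ _ hs))

/-- Decompose by the position `(i, r)` in the timed path at which the digitization step with index
`k` starts. These events are disjoint, and on each of them the step is a jump with conditional
probability `1 - exp (-E δ) ≤ 1 - exp (-λ δ)`. -/
theorem measure_jumpAt_le (hδ : 0 < δ) (k : ℕ) : σ.pathMeasure (M.jumpAt δ k)
    ≤ ENNReal.ofReal (1 - Real.exp (-(M.maxRate * δ))) := by
  let N : (i : ℕ) → Hist S A i → ℕ := fun i x => M.timedSteps δ (M.extend δ 0 x) i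
  have hN : ∀ i, Measurable (N i) := fun i => (measurable_timedSteps i).comp (measurable_extend 0 i)
  let T : (r : ℕ) → Set (S × ℝ≥0) := fun r => {p | p.1 ∈ M.MS ∧ M.ticks δ p.1 p.2 = r}
  let T' : (r : ℕ) → Set (S × ℝ≥0) := fun r => {p | p.1 ∈ M.MS ∧ r ≤ M.ticks δ p.1 p.2}
  have htk : Measurable fun p : S × ℝ≥0 => M.ticks δ p.1 p.2 :=
    measurable_from_prod_countable_right fun s => measurable_ticks s
  have hMS : MeasurableSet {p : S × ℝ≥0 | p.1 ∈ M.MS} :=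
    measurable_fst (MeasurableSet.of_discrete (s := M.MS))
  have hT : ∀ r, MeasurableSet (T r) := fun r => hMS.inter (htk (measurableSet_singleton r))
  have hT' : ∀ r, MeasurableSet (T' r) := fun r =>
    hMS.inter (measurableSet_le measurable_const htk)
  let B : (c : ℕ × ℕ) → Set (S × ℝ≥0) → Set (Hist S A c.1 × (ℝ≥0 × A × S)) :=
    fun c T => {p | N c.1 p.1 + c.2 = k ∧ (p.1.last, p.2.1) ∈ T}
  have hB : ∀ c {T : Set (S × ℝ≥0)}, MeasurableSet T → MeasurableSet (B c T) := by
    intro c T hT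
    have h1 : Measurable fun p : Hist S A c.1 × (ℝ≥0 × A × S) => N c.1 p.1 + c.2 :=
      ((hN c.1).comp measurable_fst).add_const _
    have h2 : Measurable fun p : Hist S A c.1 × (ℝ≥0 × A × S) => (p.1.last, p.2.1) :=
      (Hist.measurable_last.comp measurable_fst).prodMk (measurable_fst.comp measurable_snd)
    exact (h1 (measurableSet_singleton k)).inter (h2 hT)
  let C : (c : ℕ × ℕ) → Set (ℕ → ℝ≥0 × A × S) := fun c =>
    {ω | (frestrictLe (π := fun _ => ℝ≥0 × A × S) c.1 ω, ω (c.1 + 1)) ∈ B c (T' c.2)}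
  have hNω : ∀ i (ω : ℕ → ℝ≥0 × A × S),
      N i (frestrictLe (π := fun _ => ℝ≥0 × A × S) i ω) = M.timedSteps δ ω i :=
    fun i ω => timedSteps_extend i 0
  have hsub : M.jumpAt δ k ⊆ ⋃ c : ℕ × ℕ,
      {ω | (frestrictLe (π := fun _ => ℝ≥0 × A × S) c.1 ω, ω (c.1 + 1)) ∈ B c (T c.2)} := by
    rintro ω ⟨i, hi, hk⟩
    refine Set.mem_iUnion.2 ⟨(i, M.sojournTicks δ ω i), ?_, hi, rfl⟩
    rw [hNω]
    exact hk
  -- The events with `T` and `T'` differ only in exactly `r` versus at least `r` complete periods.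
  -- By the geometric law the ratio of the two probabilities is `1 - exp (-E δ)`.
  have hle : ∀ c : ℕ × ℕ,
      σ.pathMeasure {ω | (frestrictLe (π := fun _ => ℝ≥0 × A × S) c.1 ω, ω (c.1 + 1)) ∈ B c (T c.2)}
        ≤ σ.pathMeasure (C c) * ENNReal.ofReal (1 - Real.exp (-(M.maxRate * δ))) := by
    intro c
    rw [σ.measure_succ c.1 (hB c (hT c.2)), σ.measure_succ c.1 (hB c (hT' c.2)),
      ← lintegral_mul_const' _ _ ENNReal.ofReal_ne_top]
    refine lintegral_mono fun ω => ?_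
    simp only
    obtain ⟨x, hx⟩ : ∃ x : Hist S A c.1, frestrictLe (π := fun _ => ℝ≥0 × A × S) c.1 ω = x :=
      ⟨_, rfl⟩
    rw [hx]
    by_cases hx : N c.1 x + c.2 = k ∧ x.last ∈ M.MS
    · have e1 : {y | (x, y) ∈ B c (T c.2)} = {y | y.1 ∈ {t | M.ticks δ x.last t = c.2}} := by
        ext y; exact ⟨fun h => h.2.2, fun h => ⟨hx.1, hx.2, h⟩⟩
      have e2 : {y | (x, y) ∈ B c (T' c.2)} = {y | y.1 ∈ {t | c.2 ≤ M.ticks δ x.last t}} := by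
        ext y; exact ⟨fun h => h.2.2, fun h => ⟨hx.1, hx.2, h⟩⟩
      rw [e1, e2, step_time_preimage σ x hx.2 (show MeasurableSet {t | M.ticks δ x.last t = c.2} from
          measurable_ticks _ (measurableSet_singleton _)),
        step_time_preimage σ x hx.2 (measurableSet_le measurable_const (measurable_ticks _)),
        sojournMeasure_ticks_eq hδ hx.2, sojournMeasure_le_ticks hδ hx.2]
      gcongr
      exact exitRate_le_maxRate hx.2
    · refine le_trans (le_of_eq ?_) zero_le
      refine measure_mono_null (t := ∅) (fun y hy => hx ⟨hy.1, hy.2.1⟩) measure_empty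
  have hCm : ∀ c, MeasurableSet (C c) := fun c =>
    (show Measurable fun ω : ℕ → ℝ≥0 × A × S =>
      (frestrictLe (π := fun _ => ℝ≥0 × A × S) c.1 ω, ω (c.1 + 1)) by fun_prop) (hB c (hT' c.2))
  have hC : ∀ i r (ω : ℕ → ℝ≥0 × A × S), ω ∈ C (i, r) ↔ M.timedSteps δ ω i + r = k ∧
      state ω i ∈ M.MS ∧ r ≤ M.sojournTicks δ ω i := by
    intro i r ω
    rw [← hNω]
    rfl
  -- The block of state `i` already contains the step with index `k`, so every later state is
  -- entered after more than `k` steps.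
  have hlt : ∀ {i r i' r' : ℕ} {ω : ℕ → ℝ≥0 × A × S}, ω ∈ C (i, r) → ω ∈ C (i', r') → ¬ i < i' := by
    intro i r i' r' ω hi hi' hlt
    obtain ⟨h1, h2, h3⟩ := (hC _ _ _).1 hi
    obtain ⟨h4, -, -⟩ := (hC _ _ _).1 hi'
    have h5 : M.timedSteps δ ω (i + 1) ≤ M.timedSteps δ ω i' := monotone_timedSteps hlt
    rw [timedSteps_succ_of_mem h2] at h5
    omega
  have hdisj : Pairwise (Function.onFun (AEDisjoint σ.pathMeasure) C) := by
    rintro ⟨i, r⟩ ⟨i', r'⟩ hne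
    refine Disjoint.aedisjoint (Set.disjoint_left.2 fun ω h1 h2 => hne ?_)
    have hi : i = i' := le_antisymm (not_lt.1 (hlt h2 h1)) (not_lt.1 (hlt h1 h2))
    subst hi
    have h3 := ((hC _ _ _).1 h1).1
    have h4 := ((hC _ _ _).1 h2).1
    rw [show r = r' by omega]
  calc σ.pathMeasure (M.jumpAt δ k)
      ≤ ∑' c, σ.pathMeasure
        {ω | (frestrictLe (π := fun _ => ℝ≥0 × A × S) c.1 ω, ω (c.1 + 1)) ∈ B c (T c.2)} :=
        (measure_mono hsub).trans (measure_iUnion_le _)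
    _ ≤ ∑' c, σ.pathMeasure (C c) * ENNReal.ofReal (1 - Real.exp (-(M.maxRate * δ))) :=
        ENNReal.tsum_le_tsum hle
    _ ≤ 1 * ENNReal.ofReal (1 - Real.exp (-(M.maxRate * δ))) := by
        rw [ENNReal.tsum_mul_right]
        gcongr
        rw [← measure_univ (μ := σ.pathMeasure)]
        exact tsum_meas_le_meas_iUnion_of_disjoint₀ _ (fun c => (hCm c).nullMeasurableSet) hdisj
          |>.trans (measure_mono (Set.subset_univ _))
    _ = _ := one_mul _

/-- The survival bound is a submartingale up to the first overrun. -/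
theorem survival_zero_le (hδ : 0 < δ) (k n : ℕ) :
    M.survival δ k 0 0 ≤ ∫⁻ ω, {ω : ℕ → ℝ≥0 × A × S | ∀ i ≤ n,
      ¬ (entryTime ω i ≤ k * δ ∧ k < M.timedSteps δ ω i)}.indicator
        (fun ω => M.survival δ k (M.timedSteps δ ω n) (entryTime ω n)) ω ∂σ.pathMeasure := by
  have hm : ∀ i, MeasurableSet {ω : ℕ → ℝ≥0 × A × S |
      entryTime ω i ≤ k * δ ∧ k < M.timedSteps δ ω i} := fun i =>
    (measurableSet_le (measurable_entryTime i) measurable_const).inter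
      (measurableSet_lt measurable_const (measurable_timedSteps i))
  have hmn : ∀ n, MeasurableSet {ω : ℕ → ℝ≥0 × A × S | ∀ i ≤ n,
      ¬ (entryTime ω i ≤ k * δ ∧ k < M.timedSteps δ ω i)} := by
    intro n
    have : {ω : ℕ → ℝ≥0 × A × S | ∀ i ≤ n,
        ¬ (entryTime ω i ≤ k * δ ∧ k < M.timedSteps δ ω i)} = ⋂ i, ⋂ (_ : i ≤ n),
          {ω : ℕ → ℝ≥0 × A × S | entryTime ω i ≤ k * δ ∧ k < M.timedSteps δ ω i}ᶜ := by
      ext; simp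
    rw [this]
    exact MeasurableSet.iInter fun i => MeasurableSet.iInter fun _ => (hm i).compl
  classical
  have hsurv : Measurable fun p : ℕ × ℝ≥0 => M.survival δ k p.1 p.2 :=
    measurable_from_prod_countable_right fun n => measurable_survival _ n
  induction n with
  | zero =>
    refine le_of_eq ?_
    rw [lintegral_congr (g := fun _ => M.survival δ k 0 0), lintegral_const, measure_univ, mul_one]
    intro ω
    rw [Set.indicator_of_mem]
    · simp [timedSteps, entryTime]
    · intro i hi
      obtain rfl : i = 0 := by omega
      simp [timedSteps]
  | succ n ih =>
    refine ih.trans ?_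
    let V : Set (Hist S A n) := {x | ∀ i ≤ n, ¬ (entryTime (M.extend δ 0 x) i ≤ k * δ ∧
      k < M.timedSteps δ (M.extend δ 0 x) i)}
    let N : Hist S A n → ℕ := fun x => M.timedSteps δ (M.extend δ 0 x) n
    let τ : Hist S A n → ℝ≥0 := fun x => entryTime (M.extend δ 0 x) n
    have hVm : MeasurableSet V := measurable_extend 0 n (hmn n)
    have hV : ∀ ω : ℕ → ℝ≥0 × A × S, frestrictLe (π := fun _ => ℝ≥0 × A × S) n ω ∈ V ↔
        ∀ i ≤ n, ¬ (entryTime ω i ≤ k * δ ∧ k < M.timedSteps δ ω i) := by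
      intro ω
      refine forall_congr' fun i => forall_congr' fun hi => ?_
      have h1 : ∀ l ≤ i, M.extend δ 0 (frestrictLe (π := fun _ => ℝ≥0 × A × S) n ω) l = ω l :=
        fun l hl => extend_frestrictLe 0 n (hl.trans hi)
      rw [timedSteps_congr h1, entryTime_congr h1]
    let N' : Hist S A n × (ℝ≥0 × A × S) → ℕ := fun p =>
      N p.1 + if p.1.last ∈ M.MS then M.ticks δ p.1.last p.2.1 + 1 else 0
    have hNm : Measurable N := (measurable_timedSteps n).comp (measurable_extend 0 n)
    have hτm : Measurable τ := (measurable_entryTime n).comp (measurable_extend 0 n)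
    have hN'm : Measurable N' := by
      have h1 : Measurable fun p : S × ℝ≥0 => if p.1 ∈ M.MS then M.ticks δ p.1 p.2 + 1 else 0 :=
        measurable_from_prod_countable_right fun s => Measurable.ite
          (show MeasurableSet {_t : ℝ≥0 | s ∈ M.MS} from MeasurableSet.const _)
          ((measurable_ticks s).add_const 1) measurable_const
      exact (hNm.comp measurable_fst).add (h1.comp
        ((Hist.measurable_last.comp measurable_fst).prodMk (measurable_fst.comp measurable_snd)))
    let g : Hist S A n × (ℝ≥0 × A × S) → ℝ≥0∞ := fun p => M.survival δ k (N' p) (τ p.1 + p.2.1)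
    have hgm : Measurable g := hsurv.comp (hN'm.prodMk
      ((hτm.comp measurable_fst).add (measurable_fst.comp measurable_snd)))
    let f : Hist S A n → ℝ≥0 × A × S → ℝ≥0∞ := fun x y => (V ×ˢ Set.univ).indicator g (x, y)
    have hfm : Measurable (Function.uncurry f) := hgm.indicator (hVm.prod MeasurableSet.univ)
    -- There are three cases: a Markovian state with steps left, where `survival_le_lintegral`
    -- applies; a Markovian state past both bounds, where the survival bound stays equal to one; and
    -- a probabilistic state, where almost surely neither count changes.
    have hstep : ∀ x ∈ V, τ x ≤ N x * δ →
        M.survival δ k (N x) (τ x) ≤ ∫⁻ y, g (x, y) ∂σ.step n x := by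
      intro x hx hτ
      by_cases hs : x.last ∈ M.MS
      · simp only [g, N', if_pos hs]
        have h1 : Measurable fun t => M.survival δ k (N x + (M.ticks δ x.last t + 1)) (τ x + t) :=
          hsurv.comp ((((measurable_ticks _).add_const 1).const_add _).prodMk
            (measurable_id.const_add _))
        rw [lintegral_step_time σ x hs h1]
        by_cases hN : N x ≤ k
        · exact survival_le_lintegral hδ hs hN hτ
        · have hτ' : ¬ τ x ≤ k * δ := fun h => hx n le_rfl ⟨h, not_le.1 hN⟩
          refine (survival_le_one hτ).trans (le_of_eq ?_)
          rw [lintegral_congr (g := fun _ => 1), lintegral_const, measure_univ, mul_one]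
          intro t
          rw [survival, if_neg (by omega), if_neg]
          exact fun h => hτ' (le_trans le_self_add h)
      · refine le_of_eq ?_
        rw [lintegral_congr_ae (g := fun _ => M.survival δ k (N x) (τ x)), lintegral_const,
          measure_univ, mul_one]
        filter_upwards [ae_step_of_notMem_MS σ x hs] with y hy
        simp only [g, N', if_neg hs, hy, add_zero]
    calc _ ≤ ∫⁻ ω, ∫⁻ y, f (frestrictLe (π := fun _ => ℝ≥0 × A × S) n ω) y
          ∂σ.step n (frestrictLe (π := fun _ => ℝ≥0 × A × S) n ω) ∂σ.pathMeasure := by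
          refine lintegral_mono_ae ?_
          filter_upwards [σ.ae_sojournTime] with ω hω
          by_cases hx : ∀ i ≤ n, ¬ (entryTime ω i ≤ k * δ ∧ k < M.timedSteps δ ω i)
          · rw [Set.indicator_of_mem (by exact hx)]
            have h1 := hstep (frestrictLe (π := fun _ => ℝ≥0 × A × S) n ω) ((hV ω).2 hx)
            simp only [N, τ, timedSteps_extend, entryTime_extend] at h1
            refine (h1 (entryTime_le hδ hω n)).trans (le_of_eq (lintegral_congr fun y => ?_))
            exact (Set.indicator_of_mem (show (_, y) ∈ V ×ˢ Set.univ from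
              ⟨(hV ω).2 hx, trivial⟩) _).symm
          · rw [Set.indicator_of_notMem (by exact hx)]
            exact zero_le
      _ = ∫⁻ ω, f (frestrictLe (π := fun _ => ℝ≥0 × A × S) n ω) (ω (n + 1)) ∂σ.pathMeasure :=
          (σ.lintegral_succ n hfm).symm
      _ ≤ _ := by
          refine lintegral_mono fun ω => ?_
          by_cases hx : ∀ i ≤ n, ¬ (entryTime ω i ≤ k * δ ∧ k < M.timedSteps δ ω i)
          · have h1 : f (frestrictLe (π := fun _ => ℝ≥0 × A × S) n ω) (ω (n + 1))
                = M.survival δ k (M.timedSteps δ ω (n + 1)) (entryTime ω (n + 1)) := by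
              refine (Set.indicator_of_mem (show (_, _) ∈ V ×ˢ Set.univ from
                ⟨(hV ω).2 hx, trivial⟩) _).trans ?_
              have h2 : N' (frestrictLe (π := fun _ => ℝ≥0 × A × S) n ω, ω (n + 1))
                  = M.timedSteps δ ω (n + 1) := by
                simp only [N', N, timedSteps_extend]
                by_cases hs : state ω n ∈ M.MS
                · rw [timedSteps_succ_of_mem hs, if_pos (by exact hs)]; rfl
                · rw [timedSteps_succ_of_notMem hs, if_neg (by exact hs), add_zero]
              have h3 : τ (frestrictLe (π := fun _ => ℝ≥0 × A × S) n ω) = entryTime ω n :=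
                entryTime_extend n 0
              rw [entryTime_succ, ← h2, ← h3]
              rfl
            rw [h1]
            -- If the first overrun happens at `n + 1`, the survival bound vanishes there, so
            -- restricting the integral to paths without overrun loses nothing.
            by_cases hy : entryTime ω (n + 1) ≤ k * δ ∧ k < M.timedSteps δ ω (n + 1)
            · rw [survival, if_neg (by omega), if_pos hy.1]
              exact zero_le
            · rw [Set.indicator_of_mem]
              intro i hi
              rcases Nat.le_succ_iff.1 hi with hi | rfl
              · exact hx i hi
              · exact hy
          · refine le_trans (le_of_eq (Set.indicator_of_notMem
              (show (_, _) ∉ V ×ˢ Set.univ from fun h => hx ((hV ω).1 h.1)) _)) zero_le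

/-- Almost surely the survival bound is at most one, so its initial value bounds from below the
probability of no overrun among the first `n` entries. Continuity from below then covers all `n`. -/
theorem measure_overrun_le (hδ : 0 < δ) (k : ℕ) : σ.pathMeasure (M.overrun δ k)
    ≤ ENNReal.ofReal (1 - (1 + M.maxRate * δ) ^ k * Real.exp (-(M.maxRate * (k * δ)))) := by
  let W : ℕ → Set (ℕ → ℝ≥0 × A × S) := fun n =>
    {ω | ∃ i ≤ n, entryTime ω i ≤ k * δ ∧ k < M.timedSteps δ ω i}
  have hm : ∀ i, MeasurableSet {ω : ℕ → ℝ≥0 × A × S |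
      entryTime ω i ≤ k * δ ∧ k < M.timedSteps δ ω i} := fun i =>
    (measurableSet_le (measurable_entryTime i) measurable_const).inter
      (measurableSet_lt measurable_const (measurable_timedSteps i))
  have hWm : ∀ n, MeasurableSet (W n) := by
    intro n
    have : W n = ⋃ i, ⋃ (_ : i ≤ n),
        {ω : ℕ → ℝ≥0 × A × S | entryTime ω i ≤ k * δ ∧ k < M.timedSteps δ ω i} := by
      ext; simp only [W, Set.mem_iUnion, Set.mem_ofPred_eq, exists_prop]
    rw [this]
    exact MeasurableSet.iUnion fun i => MeasurableSet.iUnion fun _ => hm i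
  have hU : M.overrun δ k = ⋃ n, W n := by
    ext ω
    simp only [overrun, W, Set.mem_iUnion]
    exact ⟨fun ⟨i, hi⟩ => ⟨i, i, le_rfl, hi⟩, fun ⟨n, i, _, hi⟩ => ⟨i, hi⟩⟩
  have hmono : Monotone W := fun n n' h ω ⟨i, hi, h'⟩ => ⟨i, hi.trans h, h'⟩
  rw [hU, hmono.measure_iUnion]
  refine iSup_le fun n => ?_
  have h0 : M.survival δ k 0 0 = ENNReal.ofReal
      ((1 + M.maxRate * δ) ^ k * Real.exp (-(M.maxRate * (k * δ)))) := by
    rw [survival, if_pos (Nat.zero_le _), mul_comm]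
    simp
  have h1 : M.survival δ k 0 0 ≤ σ.pathMeasure (W n)ᶜ := by
    refine (σ.survival_zero_le hδ k n).trans ?_
    rw [← lintegral_indicator_one (hWm n).compl]
    refine lintegral_mono_ae ?_
    filter_upwards [σ.ae_sojournTime] with ω hω
    by_cases hx : ∀ i ≤ n, ¬ (entryTime ω i ≤ k * δ ∧ k < M.timedSteps δ ω i)
    · rw [Set.indicator_of_mem (by exact hx), Set.indicator_of_mem]
      · exact survival_le_one (entryTime_le hδ hω n)
      · rintro ⟨i, hi, h⟩
        exact hx i hi h
    · rw [Set.indicator_of_notMem (by exact hx)]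
      exact zero_le
  have hl := M.maxRate_nonneg
  rw [h0, prob_compl_eq_one_sub (hWm n)] at h1
  rw [ENNReal.ofReal_sub _ (by positivity), ENNReal.ofReal_one]
  exact ENNReal.le_sub_of_add_le_right ENNReal.ofReal_ne_top
    (by rw [add_comm]; exact (ENNReal.le_sub_iff_add_le_right (measure_ne_top _ _) prob_le_one).1 h1)

end Scheduler

end Events

end MarkovAutomaton

/-! ### Timed versus digital reachability -/

/-- A well-formed interval in terms of the indices of its end points. -/
theorem TimeInterval.WellFormed.exists_indices {S A : Type*} {ℓ : ℕ} (M : MarkovAutomaton S A ℓ)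
    {δ : ℝ≥0} {I : TimeInterval} (h : I.WellFormed δ) :
    ∃ (a : ℕ) (u : Option ℕ), I.lower = a * δ ∧ (∀ b ∈ u, a < b) ∧
      (∀ t, t ∈ I.toSet ↔ a * δ ≤ t ∧ ∀ b ∈ u, t ≤ b * δ) ∧
      M.upperError δ I = u.elim 0 (fun b => M.stepError δ (b * δ)) + M.upperErrorLeft δ (a * δ) := by
  cases I with
  | bounded a b hab =>
    obtain ⟨⟨j, rfl⟩, ⟨k, rfl⟩⟩ := h
    refine ⟨j, some k, rfl, ?_, ?_, ?_⟩
    · simp only [Option.mem_some_iff, forall_eq']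
      exact_mod_cast lt_of_mul_lt_mul_right hab zero_le
    · intro t
      simp [TimeInterval.toSet]
    · rfl
  | unbounded a =>
    obtain ⟨j, rfl⟩ := h
    refine ⟨j, none, rfl, by simp, ?_, ?_⟩
    · intro t
      simp [TimeInterval.toSet]
    · simp [MarkovAutomaton.upperError]

namespace MarkovAutomaton

section Reach

open Preorder

variable {S A : Type*} {ℓ : ℕ} {M : MarkovAutomaton S A ℓ} {δ : ℝ≥0}

open Classical in
theorem digSteps_eq_sum (ω : ℕ → A × S) (n : ℕ) :
    M.digSteps ω n = ∑ i ∈ Finset.range n, if (ω i).2 ∈ M.MS then 1 else 0 := by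
  rw [digSteps, Finset.sum_boole, Nat.cast_id, ← Set.ncard_coe_finset]
  congr 1
  ext i
  simp

/-- Within a Markovian block every position passed is one digitization step. A probabilistic block
has a single position, with `r = 0`, and adds none. -/
theorem digSteps_dig (ω : ℕ → ℝ≥0 × A × S) (n : ℕ) : M.digSteps (M.dig δ ω) n
    = M.timedSteps δ ω (M.cursor δ ω n).1 + (M.cursor δ ω n).2 := by
  classical
  rw [digSteps_eq_sum]
  induction n with
  | zero => simp [cursor, timedSteps]
  | succ n ih =>
    have hspec := (cursor_spec (M := M) (δ := δ) (ω := ω) n).1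
    rw [Finset.sum_range_succ, ih, cursor, dig_snd]
    by_cases hs : state ω (M.cursor δ ω n).1 ∈ M.MS
    · rw [if_pos hs]
      split_ifs with h
      · simp only; omega
      · simp only [timedSteps_succ_of_mem hs]; omega
    · have h0 : M.sojournTicks δ ω (M.cursor δ ω n).1 = 0 := ticks_of_notMem hs _
      rw [if_neg hs, if_neg (by omega)]
      simp only [timedSteps_succ_of_notMem hs]
      omega

theorem mem_stepBounds_iff (hδ : 0 < δ) {I : TimeInterval} {a : ℕ} {u : Option ℕ}
    (hl : I.lower = a * δ) (hI : ∀ t, t ∈ I.toSet ↔ a * δ ≤ t ∧ ∀ b ∈ u, t ≤ b * δ) (k : ℕ) :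
    k ∈ I.stepBounds δ ↔ a ≤ k ∧ (∀ b ∈ u, k ≤ b) ∧ (0 < a → a < k) := by
  have hle : ∀ m n : ℕ, (m : ℝ≥0) * δ ≤ n * δ ↔ m ≤ n := fun m n => by
    rw [mul_le_mul_iff_left₀ hδ, Nat.cast_le]
  have hlt : ∀ m n : ℕ, (m : ℝ≥0) * δ < n * δ ↔ m < n := fun m n => by
    rw [mul_lt_mul_iff_left₀ hδ, Nat.cast_lt]
  have h0 : (0 : ℝ≥0) < a * δ ↔ 0 < a := by simpa using hlt 0 a
  rw [TimeInterval.stepBounds, Set.mem_ofPred_eq, hI, hl, h0, hlt, hle]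
  simp only [hle, and_assoc]

theorem mem_timedReach_iff {I : TimeInterval} {a : ℕ} {u : Option ℕ} (hu : ∀ b ∈ u, a < b)
    (hI : ∀ t, t ∈ I.toSet ↔ a * δ ≤ t ∧ ∀ b ∈ u, t ≤ b * δ) (G : Set S)
    (ω : ℕ → ℝ≥0 × A × S) : ω ∈ timedReach I G ↔
      ∃ i, state ω i ∈ G ∧ a * δ ≤ entryTime ω (i + 1) ∧ ∀ b ∈ u, entryTime ω i ≤ b * δ := by
  refine exists_congr fun i => and_congr_right fun _ => ?_
  rw [entryTime_succ]
  constructor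
  · rintro ⟨t, ht, h1, h2⟩
    rw [hI] at ht
    exact ⟨ht.1.trans h2, fun b hb => h1.trans (ht.2 b hb)⟩
  -- The later of the entry time and the lower end point witnesses the overlap. It stays below the
  -- upper end point because `a < b`.
  · rintro ⟨h1, h2⟩
    refine ⟨max (entryTime ω i) (a * δ), (hI _).2 ⟨le_max_right _ _, fun b hb => ?_⟩,
      le_max_left _ _, max_le le_self_add h1⟩
    refine max_le (h2 b hb) ?_
    gcongr
    exact (hu b hb).le

/-- Paths that reach the goal in the digital sense and not in the timed sense overrun the lower end
point. -/
theorem mem_timedReach_of_dig_mem (hδ : 0 < δ) {I : TimeInterval} {a : ℕ} {u : Option ℕ}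
    (hl : I.lower = a * δ) (hu : ∀ b ∈ u, a < b)
    (hI : ∀ t, t ∈ I.toSet ↔ a * δ ≤ t ∧ ∀ b ∈ u, t ≤ b * δ) {G : Set S}
    {ω : ℕ → ℝ≥0 × A × S} (hω : ∀ i, state ω i ∉ M.MS → sojournTime ω i = 0)
    (hover : 0 < a → ω ∉ M.overrun δ a) (h : M.dig δ ω ∈ M.dsReach (I.stepBounds δ) G) :
    ω ∈ timedReach I G := by
  obtain ⟨n, hn, hJ⟩ := h
  rw [dig_snd] at hn
  rw [mem_stepBounds_iff hδ hl hI, digSteps_dig] at hJ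
  obtain ⟨-, hJu, hJa⟩ := hJ
  have hspec := (cursor_spec (M := M) (δ := δ) (ω := ω) n).1
  generalize M.cursor δ ω n = c at *
  obtain ⟨i, r⟩ := c
  simp only at hn hJu hJa hspec
  rw [mem_timedReach_iff hu hI]
  refine ⟨i, hn, ?_, fun b hb => (entryTime_le hδ hω i).trans ?_⟩
  · rcases Nat.eq_zero_or_pos a with rfl | ha
    · simp
    -- More than `a` steps have been made by the end of sojourn `i`, so leaving state `i` before
    -- time `a * δ` would be an overrun.
    · have h1 : a < M.timedSteps δ ω (i + 1) := by
        by_cases hs : state ω i ∈ M.MS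
        · rw [timedSteps_succ_of_mem hs]
          have := hJa ha
          omega
        · have h0 : M.sojournTicks δ ω i = 0 := ticks_of_notMem hs _
          rw [timedSteps_succ_of_notMem hs]
          have := hJa ha
          omega
      by_contra hlt
      exact hover ha ⟨i + 1, (not_le.1 hlt).le, h1⟩
  · have := hJu b hb
    gcongr
    omega

/-- Paths that reach the goal in the timed sense and not in the digital sense overrun the upper
end point, or have a jump at the digitization step of the lower end point. -/
theorem dig_mem_of_mem_timedReach (hδ : 0 < δ) {I : TimeInterval} {a : ℕ} {u : Option ℕ}
    (hl : I.lower = a * δ) (hu : ∀ b ∈ u, a < b)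
    (hI : ∀ t, t ∈ I.toSet ↔ a * δ ≤ t ∧ ∀ b ∈ u, t ≤ b * δ) {G : Set S}
    {ω : ℕ → ℝ≥0 × A × S} (hω : ∀ i, state ω i ∉ M.MS → sojournTime ω i = 0)
    (hover : ∀ b ∈ u, ω ∉ M.overrun δ b) (hjump : 0 < a → ω ∉ M.jumpAt δ a)
    (h : ω ∈ timedReach I G) : M.dig δ ω ∈ M.dsReach (I.stepBounds δ) G := by
  rw [mem_timedReach_iff hu hI] at h
  obtain ⟨i, hi, ha, hb⟩ := h
  have hN : ∀ b ∈ u, M.timedSteps δ ω i ≤ b := fun b hbu => by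
    by_contra hlt
    exact hover b hbu ⟨i, hb b hbu, not_le.1 hlt⟩
  have key : ∀ r, r ≤ M.sojournTicks δ ω i → a ≤ M.timedSteps δ ω i + r →
      (∀ b ∈ u, M.timedSteps δ ω i + r ≤ b) → (0 < a → a < M.timedSteps δ ω i + r) →
      M.dig δ ω ∈ M.dsReach (I.stepBounds δ) G := by
    intro r hr h1 h2 h3
    refine ⟨M.blockStart δ ω i + r, ?_, ?_⟩
    · rw [dig_snd, cursor_blockStart_add i r hr]
      exact hi
    · rw [mem_stepBounds_iff hδ hl hI, digSteps_dig, cursor_blockStart_add i r hr]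
      exact ⟨h1, h2, h3⟩
  rcases Nat.eq_zero_or_pos a with rfl | ha0
  · exact key 0 (Nat.zero_le _) (Nat.zero_le _) hN (fun h => absurd h (lt_irrefl 0))
  · by_cases hNa : a < M.timedSteps δ ω i
    · exact key 0 (Nat.zero_le _) hNa.le hN (fun _ => hNa)
    · have hpos : (0 : ℝ≥0) < a * δ := mul_pos (by exact_mod_cast ha0) hδ
      -- The sojourn ends at or after `a * δ > 0`, and a positive entry time is strictly below its
      -- number of steps times `δ`.
      have h1 : a < M.timedSteps δ ω (i + 1) := by
        rcases entryTime_eq_zero_or_lt (M := M) hδ hω (i + 1) with h | h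
        · rw [h] at ha
          exact absurd ha (not_le.2 hpos)
        · exact_mod_cast lt_of_mul_lt_mul_right (ha.trans_lt h) zero_le
      have hs : state ω i ∈ M.MS := by
        by_contra hs
        rw [timedSteps_succ_of_notMem hs] at h1
        exact hNa h1
      rw [timedSteps_succ_of_mem hs] at h1
      -- The step with index `a` starts in state `i`. As it is not a jump, it is a self-loop, so
      -- state `i` is still occupied after `a + 1` steps. This count is admissible since `a + 1 ≤
      -- b`.
      have h2 : M.timedSteps δ ω i + M.sojournTicks δ ω i ≠ a := fun h => hjump ha0 ⟨i, hs, h⟩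
      refine key (a + 1 - M.timedSteps δ ω i) (by omega) (by omega) (fun b hbu => ?_)
        (fun _ => by omega)
      have := hu b hbu
      omega

theorem stepError_eq (hδ : 0 < δ) (k : ℕ) : M.stepError δ (k * δ)
    = 1 - (1 + M.maxRate * δ) ^ k * Real.exp (-(M.maxRate * (k * δ))) := by
  have hδ' : (δ : ℝ) ≠ 0 := by exact_mod_cast hδ.ne'
  rw [stepError]
  push_cast
  rw [mul_div_cancel_right₀ _ hδ', Real.rpow_natCast]

theorem stepError_nonneg [Finite S] (hδ : 0 < δ) (k : ℕ) : 0 ≤ M.stepError δ (k * δ) := by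
  have hl := M.maxRate_nonneg
  rw [stepError_eq hδ, sub_nonneg, Real.exp_neg, mul_inv_le_iff₀ (Real.exp_pos _), one_mul]
  calc (1 + M.maxRate * δ) ^ k ≤ Real.exp (M.maxRate * δ) ^ k := by
        refine pow_le_pow_left₀ (by positivity) ?_ k
        linarith [Real.add_one_le_exp (M.maxRate * δ)]
    _ = Real.exp (M.maxRate * (k * δ)) := by
        rw [← Real.exp_nat_mul]; congr 1; ring

theorem upperErrorLeft_nonneg [Finite S] (a : ℝ≥0) : 0 ≤ M.upperErrorLeft δ a := by
  have hl := M.maxRate_nonneg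
  rw [upperErrorLeft]
  split_ifs
  · exact le_rfl
  · rw [sub_nonneg, Real.exp_le_one_iff, neg_nonpos]
    positivity

theorem objError_nonneg [Finite S] (hδ : 0 < δ) {O : Objective S ℓ} (hO : O.WellFormed δ) :
    0 ≤ M.objLowerError δ O ∧ 0 ≤ M.objUpperError δ O := by
  cases O with
  | expReward j G => exact ⟨le_rfl, le_rfl⟩
  | reach I G =>
    obtain ⟨a, u, hl, -, -, hup⟩ := TimeInterval.WellFormed.exists_indices M (I := I) hO
    simp only [objLowerError, objUpperError, lowerError, hup, hl]
    refine ⟨?_, add_nonneg ?_ (upperErrorLeft_nonneg _)⟩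
    · split_ifs
      · exact le_rfl
      · exact stepError_nonneg hδ a
    · cases u with
      | none => exact le_rfl
      | some b => exact stepError_nonneg hδ b

variable [Fintype S] [Fintype A] [MeasurableSpace S] [DiscreteMeasurableSpace S]
  [MeasurableSpace A] [DiscreteMeasurableSpace A]

theorem measurableSet_dsReach (J : Set ℕ) (G : Set S) :
    MeasurableSet (M.dsReach J G : Set (ℕ → A × S)) := by
  classical
  have h1 : ∀ n, Measurable fun ω : ℕ → A × S => M.digSteps ω n := by
    intro n
    simp only [digSteps_eq_sum]
    refine Finset.measurable_sum _ fun i _ => ?_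
    exact (measurable_of_countable fun p : A × S => if p.2 ∈ M.MS then 1 else 0).comp
      (measurable_pi_apply i)
  have h2 : (M.dsReach J G : Set (ℕ → A × S))
      = ⋃ n, {ω : ℕ → A × S | (ω n).2 ∈ G ∧ M.digSteps ω n ∈ J} := by
    ext; simp [dsReach]
  rw [h2]
  refine MeasurableSet.iUnion fun n => ?_
  exact ((measurable_snd.comp (measurable_pi_apply n)) (MeasurableSet.of_discrete (s := G))).inter
    (h1 n (MeasurableSet.of_discrete (s := J)))

/-- Only an overrun of the lower end point can make a digital success a timed failure. For `a = 0`
this is impossible and there is no error. -/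
theorem Scheduler.Compatible.digValue_le (hδ : 0 < δ) {σ : M.Scheduler}
    {σ' : (M.digitization δ).Scheduler} (hc : σ.Compatible σ') {O : Objective S ℓ}
    (hO : O.WellFormed δ) :
    M.digValue δ σ' O ≤ M.value σ O + ENNReal.ofReal (M.objLowerError δ O) := by
  cases O with
  | expReward j G =>
    simp only [digValue, value, hc.expReward_eq hδ]
    exact le_self_add
  | reach I G =>
    obtain ⟨a, u, hl, hu, hI, -⟩ := TimeInterval.WellFormed.exists_indices M (I := I) hO
    simp only [digValue, value, ← hc.map_dig hδ]
    rw [Measure.map_apply measurable_dig (measurableSet_dsReach _ _)]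
    by_cases ha : a = 0
    · refine le_trans (measure_mono_ae ?_) le_self_add
      filter_upwards [σ.ae_sojournTime] with ω hω h
      exact mem_timedReach_of_dig_mem hδ hl hu hI hω (fun h0 => absurd ha h0.ne') h
    · have hl0 : I.lower ≠ 0 := by rw [hl]; simp [ha, hδ.ne']
      rw [objLowerError, lowerError, if_neg hl0, hl, stepError_eq hδ]
      refine le_trans ?_ (add_le_add_right (σ.measure_overrun_le hδ a) _)
      refine le_trans (measure_mono_ae ?_) (measure_union_le _ _)
      filter_upwards [σ.ae_sojournTime] with ω hω h
      by_cases ho : ω ∈ M.overrun δ a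
      · exact Or.inr ho
      · exact Or.inl (mem_timedReach_of_dig_mem hδ hl hu hI hω (fun _ => ho) h)

/-- The error is a union bound over the overrun of the upper end point and the jump at the lower end
point. A missing upper end point, or `a = 0`, makes the respective event empty. -/
theorem Scheduler.Compatible.value_le (hδ : 0 < δ) {σ : M.Scheduler}
    {σ' : (M.digitization δ).Scheduler} (hc : σ.Compatible σ') {O : Objective S ℓ}
    (hO : O.WellFormed δ) :
    M.value σ O ≤ M.digValue δ σ' O + ENNReal.ofReal (M.objUpperError δ O) := by
  cases O with
  | expReward j G =>
    simp only [digValue, value, hc.expReward_eq hδ]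
    exact le_self_add
  | reach I G =>
    obtain ⟨a, u, hl, hu, hI, hup⟩ := TimeInterval.WellFormed.exists_indices M (I := I) hO
    simp only [digValue, value, ← hc.map_dig hδ, objUpperError, hup]
    rw [Measure.map_apply measurable_dig (measurableSet_dsReach _ _)]
    have h1 : ∃ E, (∀ b ∈ u, M.overrun δ b ⊆ E) ∧
        σ.pathMeasure E ≤ ENNReal.ofReal (u.elim 0 (fun b => M.stepError δ (b * δ))) := by
      cases u with
      | none => exact ⟨∅, by simp, by simp⟩
      | some b =>
        refine ⟨M.overrun δ b, by simp, ?_⟩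
        simp only [Option.elim_some, stepError_eq hδ]
        exact σ.measure_overrun_le hδ b
    have h2 : ∃ E, (0 < a → M.jumpAt δ a ⊆ E) ∧
        σ.pathMeasure E ≤ ENNReal.ofReal (M.upperErrorLeft δ (a * δ)) := by
      by_cases ha : a = 0
      · exact ⟨∅, fun h => absurd ha h.ne', by simp⟩
      · refine ⟨M.jumpAt δ a, fun _ => le_rfl, ?_⟩
        rw [upperErrorLeft, if_neg (by simp [ha, hδ.ne'])]
        exact σ.measure_jumpAt_le hδ a
    obtain ⟨E₁, hE₁, hP₁⟩ := h1
    obtain ⟨E₂, hE₂, hP₂⟩ := h2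
    rw [ENNReal.ofReal_add _ (upperErrorLeft_nonneg _)]
    · refine le_trans ?_ (add_le_add_right (add_le_add hP₁ hP₂) _)
      refine le_trans (measure_mono_ae (t := M.dig δ ⁻¹' M.dsReach (I.stepBounds δ) G ∪ (E₁ ∪ E₂))
        ?_) ((measure_union_le _ _).trans (add_le_add_right (measure_union_le _ _) _))
      filter_upwards [σ.ae_sojournTime] with ω hω h
      by_cases ho : ω ∈ E₁ ∪ E₂
      · exact Or.inr ho
      · exact Or.inl (dig_mem_of_mem_timedReach hδ hl hu hI hω
          (fun b hb hm => ho (Or.inl (hE₁ b hb hm))) (fun h0 hm => ho (Or.inr (hE₂ h0 hm))) h)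
    · cases u with
      | none => exact le_rfl
      | some b => exact stepError_nonneg hδ b

end Reach

end MarkovAutomaton

/-! ### Thresholds, error boxes and the conclusion -/

/-- The threshold for `w` that ensures the threshold `p` for `v` if `w ≤ v + e` and
`v ≤ w + e'`. -/
def ThresholdRel.shift (e e' p : ℝ) : ThresholdRel → ℝ
  | .lt | .le => p - e'
  | .gt | .ge => p + e

theorem ThresholdRel.mem_Icc_shift {e e' : ℝ} (he : 0 ≤ e) (he' : 0 ≤ e') (p : ℝ)
    (rel : ThresholdRel) : p ∈ Set.Icc (rel.shift e e' p - e) (rel.shift e e' p + e') := by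
  cases rel <;> simp only [shift] <;> constructor <;> linarith

/-- For the over-approximation the threshold is weakened instead of strengthened: up by `e` for
upper bounds and down by `e'` for lower bounds. -/
theorem ThresholdRel.mem_Icc_shift_neg {e e' : ℝ} (he : 0 ≤ e) (he' : 0 ≤ e') (p : ℝ)
    (rel : ThresholdRel) :
    p ∈ Set.Icc (rel.shift (-e') (-e) p - e) (rel.shift (-e') (-e) p + e') := by
  cases rel <;> simp only [shift] <;> constructor <;> linarith

theorem ThresholdRel.Holds.of_shift {rel : ThresholdRel} {v w : ℝ≥0∞} {e e' p : ℝ}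
    (he : 0 ≤ e) (he' : 0 ≤ e') (h1 : w ≤ v + ENNReal.ofReal e) (h2 : v ≤ w + ENNReal.ofReal e')
    (h : rel.Holds (w : EReal) ((rel.shift e e' p : ℝ) : EReal)) :
    rel.Holds (v : EReal) (p : EReal) := by
  -- The errors are finite, so both values are infinite together, and comparing `⊤` with a real
  -- threshold does not depend on the threshold.
  by_cases hv : v = ⊤
  · have hw : w = ⊤ := by
      by_contra hw
      rw [hv, top_le_iff] at h2
      exact ENNReal.add_ne_top.2 ⟨hw, ENNReal.ofReal_ne_top⟩ h2
    subst hv hw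
    cases rel <;> simp_all [ThresholdRel.Holds]
  · have hw : w ≠ ⊤ := fun hw => by
      rw [hw, top_le_iff] at h1
      exact ENNReal.add_ne_top.2 ⟨hv, ENNReal.ofReal_ne_top⟩ h1
    lift v to ℝ≥0 using hv
    lift w to ℝ≥0 using hw
    have h1' : (w : ℝ) ≤ v + e := by
      have := ENNReal.toReal_mono (by simp) h1
      rwa [ENNReal.toReal_add (by simp) (by simp), ENNReal.toReal_ofReal he] at this
    have h2' : (v : ℝ) ≤ w + e' := by
      have := ENNReal.toReal_mono (by simp) h2
      rwa [ENNReal.toReal_add (by simp) (by simp), ENNReal.toReal_ofReal he'] at this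
    have hc : ∀ x : ℝ≥0, ((x : ℝ≥0∞) : EReal) = ((x : ℝ) : EReal) := fun x => rfl
    cases rel <;>
    · simp only [ThresholdRel.Holds, ThresholdRel.shift, hc, gt_iff_lt, ge_iff_le,
        EReal.coe_lt_coe_iff, EReal.coe_le_coe_iff] at h ⊢
      linarith

theorem mainTheorem1 {S A : Type*} [Fintype S] [Fintype A]
    [MeasurableSpace S] [DiscreteMeasurableSpace S] [MeasurableSpace A] [DiscreteMeasurableSpace A]
    {ℓ : ℕ} (M : MarkovAutomaton S A ℓ) (hM : M.NonZeno)
    (δ : ℝ≥0) (hδ : 0 < δ)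
    {d : ℕ} (obj : Fin d → Objective S ℓ) (rel : Fin d → ThresholdRel)
    (hobj : ∀ i, (obj i).WellFormed δ) :
    M.underApprox δ obj rel ⊆ {p : Fin d → ℝ | M.Achieves obj rel p} ∧
      {p : Fin d → ℝ | M.Achieves obj rel p} ⊆ M.overApprox δ obj rel := by
  have hnn := fun i => M.objError_nonneg hδ (hobj i)
  constructor
  · intro p' hp'
    -- The hypothesis is used at a single point: the strengthened thresholds, for which `p'` is a
    -- corner of the error box.
    obtain ⟨σ', hσ'⟩ := hp' (fun i =>
      (rel i).shift (M.objLowerError δ (obj i)) (M.objUpperError δ (obj i)) (p' i)) (fun i _ => (rel i).mem_Icc_shift (hnn i).1 (hnn i).2 (p' i))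
    have hc := MarkovAutomaton.compatible_liftScheduler hδ σ'
    exact ⟨_, fun i => (hσ' i).of_shift (hnn i).1 (hnn i).2 (hc.digValue_le hδ (hobj i))
      (hc.value_le hδ (hobj i))⟩
  · rintro p' ⟨σ, hσ⟩
    obtain ⟨σ', hc⟩ := σ.exists_compatible_digScheduler hδ
    let p : Fin d → ℝ := fun i =>
      (rel i).shift (-M.objUpperError δ (obj i)) (-M.objLowerError δ (obj i)) (p' i)
    refine ⟨p, fun i _ => (rel i).mem_Icc_shift_neg (hnn i).1 (hnn i).2 (p' i), σ', fun i => ?_⟩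
    · refine ThresholdRel.Holds.of_shift (hnn i).2 (hnn i).1 (hc.value_le hδ (hobj i))
        (hc.digValue_le hδ (hobj i)) ?_
      -- The roles of the two values, and hence of the two errors, are exchanged here. Strengthening
      -- the weakened threshold gives back `p'`.
      have h : (rel i).shift (M.objUpperError δ (obj i)) (M.objLowerError δ (obj i)) (p i) = p' i := by
        simp only [p]
        cases rel i <;> simp [ThresholdRel.shift]
      rw [h]
      exact hσ i

end
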